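/- **Conventions.** Functions take values in $\mathbb{R}\cup\{\infty\}$; $f$ is $\ell$-weakly convex if $f+\frac{\ell}{2}\|\cdot\|^2$ is convex, and closed if it is lower semicontinuous. $v\in\partial f(x)$ means that $f(x)$ is finite and $f(y)\ge f(x)+\langle v,y-x\rangle+o(\|y-x\|)$ as $y\to x$; $x$ is critical if $0\in\partial f(x)$. For $\lambda>0$, $f_\lambda(x)=\min_y\{f(y)+\frac1{2\lambda}\|y-x\|^2\}$ and $\mathrm{prox}_{\lambda f}(x)=\operatorname{argmin}_y\{f(y)+\frac1{2\lambda}\|y-x\|^2\}$. For a linear operator $A$, $\lambda_{\max}(A)$ is its largest real eigenvalue. A set $\mathcal M\ni x$ is an *active $C^2$ manifold* of $f$ at $x$ if for some open neighbourhood $\mathcal U$ of $x$: $\mathcal M\cap\mathcal U$ is a $C^2$ submanifold on which $f$ is finite and $C^2$; and $\inf\{\|v\|: v\in\partial f(y),\ y\in\mathcal U\setminus\mathcal M\}>0$. Let $f_{\mathcal M}$ be $f$ on $\mathcal M$ and $+\infty$ elsewhere, and put $df(x)(u)=\liminf_{t\downarrow0,\,u'\to u}\frac{f(x+tu')-f(x)}{t}$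 and $$d^2f(x)(u)=\inf_w\ \liminf_{t\downarrow0,\,w'\to w}\frac{f(x+tu+\frac12t^2w')-f(x)-t\,df(x)(u)}{\frac12t^2}.$$ A critical point $x$ of $f$ is a *strict saddle* if $f$ has an active $C^2$ manifold $\mathcal M$ at $x$ with $d^2f_{\mathcal M}(x)(u)<0$ for some tangent vector $u\in T_{\mathcal M}(x)$. $f$ has the *strict saddle property* if each of its critical points is a local minimizer or a strict saddle. For $f=h\circ F+m$, the problem admits a *composite active $C^2$ manifold* at $x$ if there are sets $\mathcal M\ni x$, $\mathcal K\ni F(x)$ and open neighbourhoods $U$ of $x$, $V$ of $F(x)$ such that: $\mathcal M\cap U$ and $\mathcal K\cap V$ are $C^2$ submanifolds on which $m$, respectively $h$, is finite and $C^2$; $\nabla F(x)\,T_{\mathcal M}(x)+T_{\mathcal K}(F(x))$ is the whole space; and $\inf\{\|\nabla F(x)^{\top}z+w\| : z\in\partial h(u),\ w\in\partial m(y),\ (y,u)\in (U\times V)\setminus(\mathcal M\times\mathcal K)\}>0$. **Statement.** Let $\ell>0$, $\lambda\in(0,1/\ell)$, $\eta>0$ and $\bar x\in\mathbb{R}^d$.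 In each of the following settings assume that $f$ is $\ell$-weakly convex and has the strict saddle property, and that $\nabla f_\lambda(\bar x)=0$ and $\lambda_{\max}(\nabla S(\bar x))\le1$. Then $\bar x$ is a local minimizer of $f$. 1. (Proximal point.) $f:\mathbb{R}^d\to\mathbb{R}\cup\{\infty\}$ is closed and has an active $C^2$ manifold at $\bar x$; $\eta\ell<1$; $S=\mathrm{prox}_{\eta f}$. 2. (Proximal gradient.) $f=g+m$ with $g:\mathbb{R}^d\to\mathbb{R}$ of class $C^2$ with Lipschitz gradient and $m:\mathbb{R}^d\to\mathbb{R}\cup\{\infty\}$ closed and $\mu$-weakly convex, $\mu\ge0$; $f$ has an active $C^2$ manifold at $\bar x$; $\eta\mu<1$; $S(x)=\mathrm{prox}_{\eta m}(x-\eta\nabla g(x))$. 3. (Proximal linear.) $f=h\circ F+m$ with $F:\mathbb{R}^d\to\mathbb{R}^n$ of class $C^2$, $h:\mathbb{R}^n\to\mathbb{R}\cup\{\infty\}$ closed and convex, and $m:\mathbb{R}^d\to\mathbb{R}\cup\{\infty\}$ closed and $\mu$-weakly convex, $\mu\ge0$; the problem admits a composite active $C^2$ manifold at $\bar x$; $\eta\mu<1$;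 $S(x)=\operatorname{argmin}_y\{h(F(x)+\nabla F(x)(y-x))+m(y)+\frac1{2\eta}\|y-x\|^2\}$. -/

import Mathlib

open Filter Topology

noncomputable section

/-! Functions with values in `ℝ ∪ {∞}` are maps `f : E → EReal` with `f x ≠ ⊥` for all `x`;
closedness of `f` is `LowerSemicontinuous f`. -/

section General

variable {E : Type*} [NormedAddCommGroup E] [InnerProductSpace ℝ E]

/-- Convexity of an extended-real-valued function (in `EReal`, `0 * ⊤ = 0`). -/
def ExtConvex (f : E → EReal) : Prop :=
  ∀ x y : E, ∀ a b : ℝ, 0 ≤ a → 0 ≤ b → a + b = 1 →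
    f (a • x + b • y) ≤ (a : EReal) * f x + (b : EReal) * f y

/-- `f` is `ℓ`-weakly convex: `f + (ℓ/2) ‖·‖²` is convex. -/
def WeaklyConvex (ℓ : ℝ) (f : E → EReal) : Prop :=
  ExtConvex fun x => f x + ((ℓ / 2 * ‖x‖ ^ 2 : ℝ) : EReal)

/-- The (Fréchet) subdifferential: `v ∈ ∂f(x)` iff `f(x)` is finite and
`f(y) ≥ f(x) + ⟪v, y - x⟫ + o(‖y - x‖)` as `y → x`. -/
def subdiff (f : E → EReal) (x : E) : Set E :=
  {v | f x ≠ ⊥ ∧ f x ≠ ⊤ ∧ ∀ ε : ℝ, 0 < ε → ∀ᶠ y in 𝓝 x,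
    f x + ((inner ℝ v (y - x) - ε * ‖y - x‖ : ℝ) : EReal) ≤ f y}

/-- Critical points: `0 ∈ ∂f(x)`. -/
def IsCriticalPoint (f : E → EReal) (x : E) : Prop := (0 : E) ∈ subdiff f x

/-- The subderivative `df(x)(u) = liminf_{t ↓ 0, u' → u} (f(x + t u') - f(x)) / t`. -/
def subderiv (f : E → EReal) (x u : E) : EReal :=
  liminf (fun q : ℝ × E => ((q.1⁻¹ : ℝ) : EReal) * (f (x + q.1 • q.2) - f x))
    (𝓝[>] (0 : ℝ) ×ˢ 𝓝 u)

/-- The parabolic subderivative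
`d²f(x)(u|w) = liminf_{t ↓ 0, w' → w} (f(x + t u + t²/2 w') - f(x) - t df(x)(u)) / (t²/2)`. -/
def parabolicSubderiv (f : E → EReal) (x u w : E) : EReal :=
  liminf (fun q : ℝ × E => ((2 / q.1 ^ 2 : ℝ) : EReal) *
      (f (x + q.1 • u + (q.1 ^ 2 / 2) • q.2) - f x - (q.1 : EReal) * subderiv f x u))
    (𝓝[>] (0 : ℝ) ×ˢ 𝓝 w)

/-- `d²f(x)(u) = inf_w d²f(x)(u|w)`. For the restriction of a function to a manifold `M` along
which it is `C²`, at a critical point and for `u ∈ T_M(x)`, the quantity `d²f_M(x)(u|w)` has one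
and the same finite value for all second order tangents `w` to `M` at `x` along `u`, and is `+∞`
for all other `w`; so this infimum is that common value. -/
def secondSubderiv (f : E → EReal) (x u : E) : EReal := ⨅ w : E, parabolicSubderiv f x u w

open Classical in
/-- `f_M`: equal to `f` on `M` and to `+∞` off `M`. -/
def restrictTo (f : E → EReal) (M : Set E) : E → EReal := fun x => if x ∈ M then f x else ⊤

/-- `N` is a `C^p` (embedded) submanifold: near each of its points it is the zero set of a
`C^p` map with surjective derivative. -/
def IsSmoothManifold (p : WithTop ℕ∞) (N : Set E) : Prop :=
  ∀ x ∈ N, ∃ (k : ℕ) (W : Set E) (G : E → EuclideanSpace ℝ (Fin k)),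
    IsOpen W ∧ x ∈ W ∧ ContDiffOn ℝ p G W ∧ Function.Surjective (fderiv ℝ G x) ∧
      N ∩ W = {y | y ∈ W ∧ G y = 0}

/-- The restriction of `f` to `N` is (finite and) `C^p`: near each point of `N` it agrees on `N`
with a real-valued `C^p` function. -/
def IsSmoothAlong (p : WithTop ℕ∞) (f : E → EReal) (N : Set E) : Prop :=
  ∀ x ∈ N, ∃ (W : Set E) (φ : E → ℝ), IsOpen W ∧ x ∈ W ∧ ContDiffOn ℝ p φ W ∧
    ∀ y ∈ N ∩ W, f y = (φ y : EReal)

/-- `M` is an active `C^p` manifold of `f` around its point `x` (that `x` is critical is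
always required separately). -/
def IsActiveManifold (p : WithTop ℕ∞) (f : E → EReal) (M : Set E) (x : E) : Prop :=
  x ∈ M ∧ ∃ U : Set E, IsOpen U ∧ x ∈ U ∧
    IsSmoothManifold p (M ∩ U) ∧ IsSmoothAlong p f (M ∩ U) ∧
    ∃ c : ℝ, 0 < c ∧ ∀ y ∈ U, y ∉ M → ∀ v ∈ subdiff f y, c ≤ ‖v‖

/-- Strict saddles: critical points with a `C²` active manifold `M` and a tangent direction
`u ∈ T_M(x)` along which `d²f_M(x)(u) < 0`. -/
def IsStrictSaddle (f : E → EReal) (x : E) : Prop :=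
  IsCriticalPoint f x ∧ ∃ M : Set E, IsActiveManifold 2 f M x ∧
    ∃ u ∈ tangentConeAt ℝ M x, secondSubderiv (restrictTo f M) x u < 0

/-- Every critical point is a local minimizer or a strict saddle. -/
def StrictSaddleProperty (f : E → EReal) : Prop :=
  ∀ x : E, IsCriticalPoint f x → IsLocalMin f x ∨ IsStrictSaddle f x

/-- The Moreau envelope `f_r(x) = min_y f(y) + ‖y - x‖² / (2 r)`, as a real-valued function
(for closed `ℓ`-weakly convex `f`, not identically `+∞`, and `0 < r < 1/ℓ`, it is finite). -/
def moreauEnvelope (r : ℝ) (f : E → EReal) (x : E) : ℝ :=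
  (⨅ y : E, f y + ((1 / (2 * r) * ‖y - x‖ ^ 2 : ℝ) : EReal)).toReal

/-- A minimizer of `φ` (arbitrary if there is none). -/
def argmin (φ : E → EReal) : E := Classical.epsilon fun y => ∀ z : E, φ y ≤ φ z

/-- The proximal map `prox_{η f}(x) = argmin_y f(y) + ‖y - x‖² / (2 η)`. -/
def prox (η : ℝ) (f : E → EReal) (x : E) : E :=
  argmin fun y => f y + ((1 / (2 * η) * ‖y - x‖ ^ 2 : ℝ) : EReal)

/-- The largest (real) eigenvalue of an operator on a finite-dimensional space. -/
def lambdaMax (A : E →L[ℝ] E) : ℝ :=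
  sSup {r : ℝ | Module.End.HasEigenvalue (A : E →ₗ[ℝ] E) r}

end General

section Maps

variable {E : Type*} [NormedAddCommGroup E] [InnerProductSpace ℝ E] [CompleteSpace E]
variable {E₂ : Type*} [NormedAddCommGroup E₂] [InnerProductSpace ℝ E₂] [CompleteSpace E₂]

/-- The update map of the proximal gradient method for `g + m`. -/
def proxGradMap (η : ℝ) (g : E → ℝ) (m : E → EReal) (x : E) : E :=
  prox η m (x - η • gradient g x)

/-- The update map of the proximal linear method for `h ∘ F + m`. -/
def proxLinMap (η : ℝ) (h : E₂ → EReal) (F : E → E₂) (m : E → EReal) (x : E) : E :=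
  argmin fun y => h (F x + fderiv ℝ F x (y - x)) + m y
    + ((1 / (2 * η) * ‖y - x‖ ^ 2 : ℝ) : EReal)

/-- The problem `min h(F(x)) + m(x)` admits a composite `C^p` active manifold at `x`, namely
`M ∩ F⁻¹(K)`: `M` and `K` are `C^p` manifolds around `x` and `F x` along which `m` and `h` are
`C^p`; `F` restricted to `M` is transverse to `K` at `x`; and the vectors `∇F(x)ᵀ z + w` with
`z ∈ ∂h(u)`, `w ∈ ∂m(y)`, `(y, u)` near `(x, F x)` but not in `M × K`, are bounded away from
zero. (That `x` is critical is required separately.) -/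
def AdmitsCompositeActiveManifold (p : WithTop ℕ∞) (h : E₂ → EReal) (F : E → E₂)
    (m : E → EReal) (x : E) : Prop :=
  ∃ (M : Set E) (K : Set E₂), x ∈ M ∧ F x ∈ K ∧
    ∃ (U : Set E) (V : Set E₂), IsOpen U ∧ x ∈ U ∧ IsOpen V ∧ F x ∈ V ∧
      (IsSmoothManifold p (M ∩ U) ∧ IsSmoothAlong p m (M ∩ U)) ∧
      (IsSmoothManifold p (K ∩ V) ∧ IsSmoothAlong p h (K ∩ V)) ∧
      (∀ v : E₂, ∃ a ∈ tangentConeAt ℝ M x, ∃ b ∈ tangentConeAt ℝ K (F x),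
        fderiv ℝ F x a + b = v) ∧
      ∃ c : ℝ, 0 < c ∧ ∀ y ∈ U, ∀ u ∈ V, ¬ (y ∈ M ∧ u ∈ K) →
        ∀ z ∈ subdiff h u, ∀ w ∈ subdiff m y,
          c ≤ ‖ContinuousLinearMap.adjoint (fderiv ℝ F x) z + w‖

end Maps

end

/-! The three methods are instances of one. The proximal gradient step is the proximal linear step
with `h` the identity of `ℝ`, and the proximal point step is its case `g = 0`. So the work is done
for `h ∘ F + m`.

Stationarity of the Moreau envelope makes `x₀` its own proximal point, hence critical, and it
remains to exclude a strict saddle. At a strict saddle there are points `x₀ + t u'` with `t ↓ 0`,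
`u' → u` and objective at most `f x₀ - c t²`, `c > 0` (`IsStrictSaddle.exists_frequently_le`).
Nothing else is kept of the saddle: its manifold is never compared with the composite active one.
Such points are shown to force an eigenvalue of `∇S(x₀)` above one.

The subproblem is studied with two independent centres, `x₀ + ξ` for the linearization of `F` and
`x₀ + γ` for the proximal term. Transversality and the implicit function theorem give feasible
points uniformly under perturbation, hence bounded Lagrange multipliers (`exists_multiplier`,
`exists_primalDual`). Solutions `y` satisfy `y - x₀ = O(‖(ξ, γ)‖)` (`isBigO_sub`), and sharpness
puts `y` on `M` and the inner model value on `K` (`eventually_active`). The problem is then smooth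
to second order, and comparison with feasible competitors gives `y = x₀ + D (ξ, γ) + o(‖(ξ, γ)‖)`
(`isLittleO_solution`). Here `D (ξ, γ)` lies in the tangent space `T` of `M ∩ F⁻¹(K)` and solves `R
(D (ξ, γ)) b = L (ξ, γ) b` for all `b ∈ T`, with `R` the `lagrangianHessian`, coercive on `T`, and
`L (ξ, γ) b = η⁻¹ ⟪γ, b⟫ - ⟪z₀, F'' ξ b⟫` the `centreForm`.

On equal centres, `∇S(x₀) a = D (a, a)`. With `W a b = L (a, a) b`, every nonzero `a ∈ T` such that
`W a = r R a` on `T` is an eigenvector with eigenvalue `r`. The difference `R - W` is the Hessian of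
the Lagrangian without the proximal term, so negative curvature corresponds to `r > 1`.

To find the curvature, the multiplier inequalities of the subproblem with centres `x₀` and `x₀ + t
v` are tested at `x₀ + t u'` and divided by `t²` (`decrease_le`). The vector `v` is free: multiples
of a `v` normal to `T` force `u ∈ T`, and the `v` with `D (0, v) = u` gives `R u u < W u u`.
Maximizing `W / R` on `T` then yields `r > 1` (`exists_pencil_eigenvector`, `one_lt_lambdaMax`). -/

open Asymptotics

/-! ### Weak convexity in `EReal` and minimizers of strongly convex functions -/

section WeakConvexity

variable {E : Type*} [NormedAddCommGroup E] [InnerProductSpace ℝ E]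

/-- The value `⊤` imposes nothing, so lower bounds need only be tested against real majorants; this
keeps the later estimates in `ℝ`. -/
lemma EReal.coe_le_of_forall_real {x : EReal} {c : ℝ} (h : ∀ α : ℝ, x ≤ α → c ≤ α) :
    (c : EReal) ≤ x := by
  induction x with
  | bot => exact absurd (h (c - 1) bot_le) (by linarith)
  | top => exact le_top
  | coe x => exact EReal.coe_le_coe_iff.2 (h x le_rfl)

lemma EReal.exists_coe_of_le {x : EReal} {a : ℝ} (hx : x ≠ ⊥) (h : x ≤ a) :
    ∃ α : ℝ, x = α ∧ α ≤ a := by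
  induction x with
  | bot => exact absurd rfl hx
  | top => exact absurd h (by simp)
  | coe x => exact ⟨x, rfl, EReal.coe_le_coe_iff.1 h⟩

lemma EReal.exists_coe_of_add_le {x y : EReal} {a : ℝ} (hx : x ≠ ⊥) (hy : y ≠ ⊥)
    (h : x + y ≤ a) : ∃ α β : ℝ, x = α ∧ y = β ∧ α + β ≤ a := by
  induction x with
  | bot => exact absurd rfl hx
  | top => rw [EReal.top_add_of_ne_bot hy] at h; exact absurd h (by simp)
  | coe x =>
    induction y with
    | bot => exact absurd rfl hy
    | top => rw [EReal.add_top_of_ne_bot hx] at h; exact absurd h (by simp)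
    | coe y => exact ⟨x, y, rfl, rfl, by exact_mod_cast h⟩

lemma EReal.le_sub_of_add_coe_le {x : EReal} {q r : ℝ} (h : x + (r : EReal) ≤ (q : EReal)) :
    x ≤ ((q - r : ℝ) : EReal) := by
  induction x with
  | bot => exact bot_le
  | top => simp at h
  | coe x =>
    have : x + r ≤ q := by exact_mod_cast h
    exact EReal.coe_le_coe_iff.2 (by linarith)

lemma le_of_forall_Ioo_le_add_mul {X Y β : ℝ} (h : ∀ t ∈ Set.Ioo (0 : ℝ) 1, X ≤ β + t * Y) :
    X ≤ β := by
  have h1 : Tendsto (fun t : ℝ => β + t * Y) (𝓝[>] 0) (𝓝 (β + 0 * Y)) :=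
    ((continuous_const.add (continuous_id.mul continuous_const)).tendsto 0).mono_left
      nhdsWithin_le_nhds
  simpa using ge_of_tendsto h1 (by
    filter_upwards [Ioo_mem_nhdsGT (show (0 : ℝ) < 1 by norm_num)] with t ht using h t ht)

lemma norm_combo_sq (x y : E) {s t : ℝ} (hst : s + t = 1) :
    ‖s • x + t • y‖ ^ 2 = s * ‖x‖ ^ 2 + t * ‖y‖ ^ 2 - s * t * ‖x - y‖ ^ 2 := by
  obtain rfl : t = 1 - s := by linarith
  rw [norm_add_sq_real, norm_sub_sq_real, norm_smul, norm_smul, mul_pow, mul_pow,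
    inner_smul_left, inner_smul_right, Real.norm_eq_abs, Real.norm_eq_abs, sq_abs, sq_abs]
  simp only [conj_trivial]
  ring

/-- `f` is convex up to the quadratic `(ℓ/2) ‖·‖²`, expressed through real upper bounds of the
values; `ℓ` may have any sign. -/
def ConvexUpTo (ℓ : ℝ) (f : E → EReal) : Prop :=
  ∀ ⦃x y : E⦄ ⦃a b s t : ℝ⦄, f x ≤ a → f y ≤ b → 0 ≤ s → 0 ≤ t → s + t = 1 →
    f (s • x + t • y) ≤ ((s * a + t * b + ℓ / 2 * (s * t) * ‖x - y‖ ^ 2 : ℝ) : EReal)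

lemma ExtConvex.le_combo {f : E → EReal} (hf : ExtConvex f) {x y : E} {a b s t : ℝ}
    (hx : f x ≤ a) (hy : f y ≤ b) (hs : 0 ≤ s) (ht : 0 ≤ t) (hst : s + t = 1) :
    f (s • x + t • y) ≤ ((s * a + t * b : ℝ) : EReal) := by
  refine (hf x y s t hs ht hst).trans ?_
  rw [EReal.coe_add, EReal.coe_mul, EReal.coe_mul]
  exact add_le_add (mul_le_mul_of_nonneg_left hx (by exact_mod_cast hs))
    (mul_le_mul_of_nonneg_left hy (by exact_mod_cast ht))

lemma ExtConvex.convexUpTo {f : E → EReal} (hf : ExtConvex f) : ConvexUpTo 0 f := by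
  intro x y a b s t hx hy hs ht hst
  simpa using hf.le_combo hx hy hs ht hst

lemma WeaklyConvex.convexUpTo {f : E → EReal} {ℓ : ℝ} (hf : WeaklyConvex ℓ f) :
    ConvexUpTo ℓ f := by
  intro x y a b s t hx hy hs ht hst
  have h := ExtConvex.le_combo hf (x := x) (y := y) (a := a + ℓ / 2 * ‖x‖ ^ 2)
    (b := b + ℓ / 2 * ‖y‖ ^ 2) (by rw [EReal.coe_add]; gcongr) (by rw [EReal.coe_add]; gcongr)
    hs ht hst
  refine (EReal.le_sub_of_add_coe_le h).trans (EReal.coe_le_coe_iff.2 (le_of_eq ?_))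
  rw [norm_combo_sq x y hst]; ring

lemma ConvexUpTo.add {f g : E → EReal} {ℓ ℓ' : ℝ} (hf : ConvexUpTo ℓ f) (hg : ConvexUpTo ℓ' g)
    (hf' : ∀ x, f x ≠ ⊥) (hg' : ∀ x, g x ≠ ⊥) : ConvexUpTo (ℓ + ℓ') fun x => f x + g x := by
  intro x y a b s t hx hy hs ht hst
  obtain ⟨α, α', h1, h2, h3⟩ := EReal.exists_coe_of_add_le (hf' x) (hg' x) hx
  obtain ⟨β, β', h4, h5, h6⟩ := EReal.exists_coe_of_add_le (hf' y) (hg' y) hy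
  refine (add_le_add (hf h1.le h4.le hs ht hst) (hg h2.le h5.le hs ht hst)).trans ?_
  rw [← EReal.coe_add]
  refine EReal.coe_le_coe_iff.2 ?_
  have := mul_le_mul_of_nonneg_left h3 hs
  have := mul_le_mul_of_nonneg_left h6 ht
  linarith

/-- For a quadratic the convexity defect is an identity. A negative modulus in `ConvexUpTo` records
strong convexity, so adding a proximal term amounts to adding moduli. -/
lemma convexUpTo_quadratic (r : ℝ) (c : E) :
    ConvexUpTo (-(2 * r)) fun y => ((r * ‖y - c‖ ^ 2 : ℝ) : EReal) := by
  intro x y a b s t hx hy hs ht hst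
  refine EReal.coe_le_coe_iff.2 ?_
  have hx := mul_le_mul_of_nonneg_left (EReal.coe_le_coe_iff.1 hx) hs
  have hy := mul_le_mul_of_nonneg_left (EReal.coe_le_coe_iff.1 hy) ht
  have h : s • x + t • y - c = s • (x - c) + t • (y - c) := by
    rw [smul_sub, smul_sub, sub_add_sub_comm, ← add_smul, hst, one_smul]
  have h' := norm_combo_sq (x - c) (y - c) hst
  rw [sub_sub_sub_cancel_right] at h'
  rw [h, h']
  linarith

lemma ConvexUpTo.comp_affine {E₂ : Type*} [NormedAddCommGroup E₂] [InnerProductSpace ℝ E₂]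
    {h : E₂ → EReal} (hh : ConvexUpTo 0 h) (A : E →L[ℝ] E₂) (a : E₂) :
    ConvexUpTo 0 fun y => h (a + A y) := by
  intro x y α β s t hx hy hs ht hst
  have := hh hx hy hs ht hst
  beta_reduce
  rw [show a + A (s • x + t • y) = s • (a + A x) + t • (a + A y) by
    rw [map_add, map_smul, map_smul, smul_add, smul_add, add_add_add_comm, ← add_smul, hst,
      one_smul]]
  simpa using this

/-- A closed strongly convex function has a minimizer, about which it grows quadratically. -/
lemma ConvexUpTo.exists_minimizer [FiniteDimensional ℝ E] {ψ : E → EReal} {κ : ℝ}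
    (hκ : 0 < κ) (hψ : ConvexUpTo (-κ) ψ) (hlsc : LowerSemicontinuous ψ) (hbot : ∀ x, ψ x ≠ ⊥)
    {x₀ : E} (hx₀ : ψ x₀ ≠ ⊤) :
    ∃ (p : E) (v : ℝ), ψ p = v ∧ ∀ y, ((v + κ / 2 * ‖y - p‖ ^ 2 : ℝ) : EReal) ≤ ψ y := by
  obtain ⟨v₀, hv₀⟩ : ∃ v₀ : ℝ, ψ x₀ = v₀ :=
    ⟨_, (EReal.coe_toReal hx₀ (hbot x₀)).symm⟩
  obtain ⟨r, hr, hball⟩ : ∃ r > 0, ∀ y, ‖y - x₀‖ < r → ((v₀ - 1 : ℝ) : EReal) < ψ y := by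
    have := hlsc x₀ ((v₀ - 1 : ℝ) : EReal) (by
      show ((v₀ - 1 : ℝ) : EReal) < ψ x₀
      rw [hv₀]; exact_mod_cast sub_one_lt v₀)
    obtain ⟨r, hr, h⟩ := Metric.eventually_nhds_iff.1 this
    exact ⟨r, hr, fun y hy => h (by rwa [dist_eq_norm])⟩
  -- Radius of the sublevel set. If `y` lies at distance `D > r`, the point of the segment at
  -- distance `r / 2` from `x₀` has value at most `v₀ - κ r D / 8` by strong convexity, whereas
  -- lower semicontinuity keeps it above `v₀ - 1`.
  set R := max r (8 / (κ * r)) with hR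
  have hsub : ∀ y, ψ y ≤ v₀ → ‖y - x₀‖ ≤ R := by
    intro y hy
    by_contra! hD
    have hD1 : r < ‖y - x₀‖ := (le_max_left _ _).trans_lt hD
    have hD2 : 8 / (κ * r) < ‖y - x₀‖ := (le_max_right _ _).trans_lt hD
    have hD0 : 0 < ‖y - x₀‖ := hr.trans hD1
    set D := ‖y - x₀‖ with hDdef
    set s := r / (2 * D) with hs
    have hs0 : 0 < s := by positivity
    have hs1 : s ≤ 1 / 2 := by
      rw [hs, div_le_div_iff₀ (by positivity) (by norm_num)]; linarith
    have hsD : s * D = r / 2 := by rw [hs]; field_simp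
    have hz := hψ hv₀.le hy (show 0 ≤ 1 - s by linarith) hs0.le (by ring)
    have hz' := hball ((1 - s) • x₀ + s • y) (by
      rw [show (1 - s) • x₀ + s • y - x₀ = s • (y - x₀) by module, norm_smul, Real.norm_eq_abs,
        abs_of_pos hs0, ← hDdef, hsD]; linarith)
    have h3 := EReal.coe_lt_coe_iff.1 (hz'.trans_le hz)
    rw [norm_sub_rev, ← hDdef] at h3
    have h4 : κ / 2 * ((1 - s) * s) * D ^ 2 = κ / 2 * (r / 2) * (1 - s) * D := by
      rw [← hsD]; ring
    rw [div_lt_iff₀ (by positivity)] at hD2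
    have h5 : κ / 2 * (r / 2) * (1 / 2) * D ≤ κ / 2 * (r / 2) * (1 - s) * D := by
      gcongr; linarith
    nlinarith
  obtain ⟨p, hpR, hp⟩ := LowerSemicontinuousOn.exists_isMinOn (s := Metric.closedBall x₀ R)
    ⟨x₀, Metric.mem_closedBall_self (hr.le.trans (le_max_left _ _))⟩
    (isCompact_closedBall x₀ R) (hlsc.lowerSemicontinuousOn _)
  have hp0 : ψ p ≤ v₀ := hv₀ ▸ hp (Metric.mem_closedBall_self (hr.le.trans (le_max_left _ _)))
  have hpmin : ∀ y, ψ p ≤ ψ y := by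
    intro y
    by_cases hy : ψ y ≤ v₀
    · exact hp (by rw [Metric.mem_closedBall, dist_eq_norm]; exact hsub y hy)
    · exact hp0.trans (not_le.1 hy).le
  obtain ⟨v, hv, -⟩ := EReal.exists_coe_of_le (hbot p) hp0
  refine ⟨p, v, hv, fun y => EReal.coe_le_of_forall_real fun β hβ => ?_⟩
  -- Minimality of `p` against the point at parameter `t` towards `y`, divided by `t`; the limit `t
  -- → 0` retains the whole quadratic gap.
  refine le_of_forall_Ioo_le_add_mul (Y := κ / 2 * ‖y - p‖ ^ 2) fun t ht => ?_
  have h1 := (hpmin _).trans (hψ hv.le hβ (sub_nonneg.2 ht.2.le) ht.1.le (by ring))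
  rw [hv, norm_sub_rev] at h1
  have h2 := EReal.coe_le_coe_iff.1 h1
  have h3 : t * (v + κ / 2 * ‖y - p‖ ^ 2) ≤ t * (β + t * (κ / 2 * ‖y - p‖ ^ 2)) := by
    linarith
  exact le_of_mul_le_mul_left h3 ht.1

end WeakConvexity

/-! ### Stationary points of the Moreau envelope -/

section Moreau

variable {E : Type*} [NormedAddCommGroup E] [InnerProductSpace ℝ E] [FiniteDimensional ℝ E]

lemma LowerSemicontinuous.add_coe {α : Type*} [TopologicalSpace α] {f : α → EReal}
    (hf : LowerSemicontinuous f) {q : α → ℝ} (hq : Continuous q) :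
    LowerSemicontinuous fun x => f x + (q x : EReal) := by
  refine hf.add' (continuous_coe_real_ereal.comp hq).lowerSemicontinuous fun x => ?_
  exact EReal.continuousAt_add (Or.inr (EReal.coe_ne_bot _)) (Or.inr (EReal.coe_ne_top _))

lemma EReal.add_coe_ne_bot {x : EReal} (hx : x ≠ ⊥) (r : ℝ) : x + (r : EReal) ≠ ⊥ := by
  simp [hx]

/-- A stationary point of the Moreau envelope is a proximal fixed point. -/
lemma le_add_sq_of_gradient_moreauEnvelope_eq_zero {f : E → EReal} {ℓ lam : ℝ}
    (hf : ConvexUpTo ℓ f) (hlsc : LowerSemicontinuous f) (hbot : ∀ x, f x ≠ ⊥)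
    (hlam : 0 < lam) (hℓ : ℓ < lam⁻¹) {x₀ : E} (hx₀ : f x₀ ≠ ⊤)
    (hgrad : gradient (moreauEnvelope lam f) x₀ = 0) (y : E) :
    f x₀ ≤ f y + ((1 / (2 * lam) * ‖y - x₀‖ ^ 2 : ℝ) : EReal) := by
  have hconv : ∀ x, ConvexUpTo (-(lam⁻¹ - ℓ))
      fun y => f y + ((1 / (2 * lam) * ‖y - x‖ ^ 2 : ℝ) : EReal) := by
    intro x
    have := hf.add (convexUpTo_quadratic (1 / (2 * lam)) x) hbot (fun _ => EReal.coe_ne_bot _)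
    convert! this using 1
    field_simp; ring
  have hmin := fun x => (hconv x).exists_minimizer (sub_pos.2 hℓ)
    (hlsc.add_coe (by fun_prop)) (fun y => EReal.add_coe_ne_bot (hbot y) _)
    (x₀ := x₀) (EReal.add_ne_top hx₀ (EReal.coe_ne_top _))
  choose p v hpv hgrow using hmin
  have henv : ∀ x, moreauEnvelope lam f x = v x := by
    intro x
    have : (⨅ y : E, f y + ((1 / (2 * lam) * ‖y - x‖ ^ 2 : ℝ) : EReal)) = (v x : EReal) := by
      refine le_antisymm ((iInf_le _ (p x)).trans (hpv x).le) (le_iInf fun y => ?_)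
      refine le_trans (EReal.coe_le_coe_iff.2 ?_) (hgrow x y)
      have := sub_pos.2 hℓ
      have : 0 ≤ (lam⁻¹ - ℓ) / 2 * ‖y - p x‖ ^ 2 := by positivity
      linarith
    rw [moreauEnvelope, this, EReal.toReal_coe]
  have hfp : ∀ x, ∃ α : ℝ, f (p x) = α ∧ v x = α + 1 / (2 * lam) * ‖p x - x‖ ^ 2 := by
    intro x
    obtain ⟨α, β, h1, h2, -⟩ := EReal.exists_coe_of_add_le (hbot _) (EReal.coe_ne_bot _)
      (hpv x).le
    refine ⟨α, h1, ?_⟩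
    have := hpv x
    simp only [h1] at this
    exact_mod_cast this.symm
  choose α hα hvα using hfp
  set κ := lam⁻¹ - ℓ with hκ
  have hκ0 : 0 < κ := sub_pos.2 hℓ
  set g := lam⁻¹ • (x₀ - p x₀) with hg
  have hexp : ∀ y x : E, 1 / (2 * lam) * ‖y - x‖ ^ 2 = 1 / (2 * lam) * ‖y - x₀‖ ^ 2
      - lam⁻¹ * inner ℝ (y - x₀) (x - x₀) + 1 / (2 * lam) * ‖x - x₀‖ ^ 2 := by
    intro y x
    rw [show y - x = (y - x₀) - (x - x₀) by abel, norm_sub_sq_real (y - x₀)]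
    field_simp
  -- Above, `p x₀` competes at `x`; below, `p x` competes at `x₀`, where quadratic growth absorbs
  -- the cross term in `p x - p x₀` by Young's inequality.
  have hbound : ∀ x, ‖v x - v x₀ - inner ℝ g (x - x₀)‖ ≤
      (1 / (2 * lam) + lam⁻¹ ^ 2 / (2 * κ)) * ‖‖x - x₀‖ ^ 2‖ := by
    intro x
    have hginner : inner ℝ g (x - x₀) = - (lam⁻¹ * inner ℝ (p x₀ - x₀) (x - x₀)) := by
      rw [hg, inner_smul_left, ← neg_sub (p x₀) x₀, inner_neg_left]; simp
    have hup : v x ≤ α x₀ + 1 / (2 * lam) * ‖p x₀ - x‖ ^ 2 := by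
      have := (hgrow x (p x₀))
      rw [hα, ← EReal.coe_add] at this
      have := EReal.coe_le_coe_iff.1 this
      have h0 : 0 ≤ κ / 2 * ‖p x₀ - p x‖ ^ 2 := by positivity
      linarith
    have hlow : v x₀ + κ / 2 * ‖p x - p x₀‖ ^ 2 ≤ α x + 1 / (2 * lam) * ‖p x - x₀‖ ^ 2 := by
      have := (hgrow x₀ (p x))
      rw [hα, ← EReal.coe_add] at this
      exact EReal.coe_le_coe_iff.1 this
    have e1 := hexp (p x₀) x
    have e2 := hexp (p x) x
    have e3 := hvα x
    have e4 := hvα x₀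
    have hsplit : inner ℝ (p x - x₀) (x - x₀) =
        inner ℝ (p x - p x₀) (x - x₀) + inner ℝ (p x₀ - x₀) (x - x₀) := by
      rw [← inner_add_left]; congr 1; abel
    have hcs := real_inner_le_norm (p x - p x₀) (x - x₀)
    set a := ‖p x - p x₀‖
    set b := ‖x - x₀‖
    have hb : 0 ≤ b := norm_nonneg _
    have hyoung : lam⁻¹ * (a * b) ≤ κ / 2 * a ^ 2 + lam⁻¹ ^ 2 / (2 * κ) * b ^ 2 := by
      have : 0 ≤ (κ * a - lam⁻¹ * b) ^ 2 / (2 * κ) := by positivity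
      have h2 : (κ * a - lam⁻¹ * b) ^ 2 / (2 * κ) =
        κ / 2 * a ^ 2 + lam⁻¹ ^ 2 / (2 * κ) * b ^ 2 - lam⁻¹ * (a * b) := by
        field_simp; ring
      linarith
    have hli : 0 < lam⁻¹ := inv_pos.2 hlam
    have hcs' := mul_le_mul_of_nonneg_left hcs hli.le
    have hb2 : 0 ≤ lam⁻¹ ^ 2 / (2 * κ) * b ^ 2 := by positivity
    have hb3 : 0 ≤ 1 / (2 * lam) * b ^ 2 := by positivity
    rw [Real.norm_of_nonneg (sq_nonneg b), Real.norm_eq_abs, abs_le, hginner, add_mul]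
    rw [hsplit, mul_add] at e2
    constructor <;> linarith
  -- `gradient` is zero where the function is not differentiable, so the stationarity hypothesis
  -- carries information only once the gradient is identified as `lam⁻¹ • (x₀ - p x₀)`.
  have hgradAt : HasGradientAt (moreauEnvelope lam f) g x₀ := by
    rw [hasGradientAt_iff_isLittleO, funext henv]
    refine (Asymptotics.IsBigO.of_bound _ (Eventually.of_forall hbound)).trans_isLittleO ?_
    have h := Asymptotics.isLittleO_norm_pow_id (E' := E) one_lt_two
    exact h.comp_tendsto (k := fun x => x - x₀) (by
      have : Tendsto (fun x => x - x₀) (𝓝 x₀) (𝓝 (x₀ - x₀)) :=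
        (continuous_id.sub continuous_const).tendsto x₀
      simpa using this)
  have hp : p x₀ = x₀ := by
    rw [hgradAt.gradient, hg, smul_eq_zero] at hgrad
    rcases hgrad with h | h
    · exact absurd h (inv_pos.2 hlam).ne'
    · exact (sub_eq_zero.1 h).symm
  have h1 := hpv x₀
  rw [hp] at h1
  have h2 : f x₀ = v x₀ := by simpa using h1
  rw [h2]
  refine le_trans (EReal.coe_le_coe_iff.2 ?_) (hgrow x₀ y)
  have : 0 ≤ κ / 2 * ‖y - p x₀‖ ^ 2 := by positivity
  linarith

/-- A global lower bound with a quadratic error yields a subgradient. -/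
lemma mem_subdiff_of_forall_le {E : Type*} [NormedAddCommGroup E] [InnerProductSpace ℝ E]
    {f : E → EReal} {x v : E} {a C : ℝ} (hx : f x = a)
    (h : ∀ y, ((a + inner ℝ v (y - x) - C * ‖y - x‖ ^ 2 : ℝ) : EReal) ≤ f y) :
    v ∈ subdiff f x := by
  refine ⟨by simp [hx], by simp [hx], fun ε hε => ?_⟩
  have hlim : Tendsto (fun y => C * ‖y - x‖) (𝓝 x) (𝓝 0) := by
    have : Tendsto (fun y => C * ‖y - x‖) (𝓝 x) (𝓝 (C * ‖x - x‖)) :=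
      (Continuous.tendsto (by fun_prop) x)
    simpa using this
  filter_upwards [hlim.eventually (gt_mem_nhds hε)] with y hy
  refine le_trans ?_ (h y)
  rw [hx, ← EReal.coe_add]
  refine EReal.coe_le_coe_iff.2 ?_
  have := mul_le_mul_of_nonneg_right hy.le (norm_nonneg (y - x))
  nlinarith

end Moreau

/-! ### Taylor expansion and implicit solutions -/

section Calculus

variable {E F Z X : Type*} [NormedAddCommGroup E] [NormedSpace ℝ E]
  [NormedAddCommGroup F] [NormedSpace ℝ F] [NormedAddCommGroup Z] [NormedSpace ℝ Z]
  [NormedAddCommGroup X] [NormedSpace ℝ X]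

omit [NormedSpace ℝ E] in
lemma tendsto_sub_self_nhds_zero (x₀ : E) : Tendsto (fun x => x - x₀) (𝓝 x₀) (𝓝 0) := by
  have : Tendsto (fun x => x - x₀) (𝓝 x₀) (𝓝 (x₀ - x₀)) :=
    (continuous_id.sub continuous_const).tendsto x₀
  simpa using this

/-- Second order Taylor expansion with Peano remainder. -/
lemma ContDiffAt.taylor_two {f : E → F} {x₀ : E} (hf : ContDiffAt ℝ 2 f x₀) :
    (fun x => f x - f x₀ - fderiv ℝ f x₀ (x - x₀)
      - (1 / 2 : ℝ) • fderiv ℝ (fderiv ℝ f) x₀ (x - x₀) (x - x₀)) =o[𝓝 x₀]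
      fun x => ‖x - x₀‖ ^ 2 := by
  have hsymm : IsSymmSndFDerivAt ℝ f x₀ := hf.isSymmSndFDerivAt (by simp)
  have hev : ∀ᶠ x in 𝓝 x₀, DifferentiableAt ℝ f x := by
    filter_upwards [hf.eventually (by simp)] with x hx using hx.differentiableAt (by simp)
  obtain ⟨r, hr, hball⟩ := Metric.eventually_nhds_iff_ball.1 hev
  set B := fderiv ℝ (fderiv ℝ f) x₀
  have hB : HasFDerivAt (fderiv ℝ f) B x₀ :=
    ((hf.fderiv_right (m := 1) (by norm_num)).differentiableAt (by simp)).hasFDerivAt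
  -- A mean value estimate: the derivative of the remainder is the first-order remainder of `fderiv
  -- ℝ f`, which is `o(‖x - x₀‖)`. Symmetry of the second derivative cancels the factor `1 / 2`.
  have key := (convex_ball x₀ r).isLittleO_pow_succ (n := 1)
    (f := fun x => f x - fderiv ℝ f x₀ (x - x₀) - (1 / 2 : ℝ) • B (x - x₀) (x - x₀))
    (f' := fun x => fderiv ℝ f x - fderiv ℝ f x₀ - B (x - x₀))
    (Metric.mem_ball_self hr) (fun x hx => ?_) ?_
  · rw [nhdsWithin_eq_nhds.2 (Metric.ball_mem_nhds x₀ hr)] at key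
    refine key.congr_left fun x => ?_
    simp only [sub_self, map_zero, smul_zero, sub_zero]
    abel
  · have h1 : HasFDerivAt f (fderiv ℝ f x) x := (hball x hx).hasFDerivAt
    have h2 : HasFDerivAt (fun x => x - x₀) (ContinuousLinearMap.id ℝ E) x :=
      (hasFDerivAt_id x).sub_const x₀
    have h3 := (fderiv ℝ f x₀).hasFDerivAt.comp x h2
    have h4 := ((B.hasFDerivAt.comp x h2).clm_apply h2).const_smul (1 / 2 : ℝ)
    refine HasFDerivAt.hasFDerivWithinAt (((h1.sub h3).sub h4).congr_fderiv ?_)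
    ext v
    have := hsymm (x - x₀) v
    simp only [sub_apply, ContinuousLinearMap.comp_apply,
      smul_apply, add_apply,
      ContinuousLinearMap.flip_apply, ContinuousLinearMap.id_apply, Function.comp_apply]
    rw [show B v (x - x₀) = B (x - x₀) v from this.symm, ← two_smul ℝ, smul_smul]
    norm_num
  · rw [nhdsWithin_eq_nhds.2 (Metric.ball_mem_nhds x₀ hr)]
    simpa using hB.isLittleO.norm_right

/-- Implicit solution of `Ψ (x, s) = 0` when the partial derivative in `s` is the identity. -/
lemma HasStrictFDerivAt.exists_implicit_solution [CompleteSpace X] [CompleteSpace Z]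
    {Ψ : X × Z → Z} {Ψ' : X × Z →L[ℝ] Z} {x₀ : X} {s₀ : Z}
    (hΨ : HasStrictFDerivAt Ψ Ψ' (x₀, s₀))
    (h0 : Ψ (x₀, s₀) = 0) (hid : ∀ s, Ψ' (0, s) = s) :
    ∃ σ : X → Z, σ x₀ = s₀ ∧ HasFDerivAt σ (-(Ψ' ∘L .inl ℝ X Z)) x₀ ∧
      ∀ᶠ x in 𝓝 x₀, Ψ (x, σ x) = 0 := by
  have hpart : Ψ' ∘L .inr ℝ X Z = ContinuousLinearMap.id ℝ Z := by
    ext s; simp [hid]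
  have hinv : (Ψ' ∘L .inr ℝ X Z).IsInvertible := by
    rw [hpart]; exact ContinuousLinearMap.isInvertible_equiv (f := .refl ℝ Z)
  refine ⟨hΨ.implicitFunctionOfProdDomain hinv, ?_, ?_, ?_⟩
  · exact (hΨ.eventually_apply_eq_iff_implicitFunctionOfProdDomain hinv).self_of_nhds.mp rfl
  · have := (hΨ.hasStrictFDerivAt_implicitFunctionOfProdDomain hinv).hasFDerivAt
    convert! this using 1
    rw [hpart, ContinuousLinearMap.inverse_id]
    ext; simp
  · simpa [h0] using hΨ.eventually_apply_implicitFunctionOfProdDomain hinv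

/-- Tangent vectors of a level set are realized by curves. -/
lemma HasStrictFDerivAt.exists_curve [CompleteSpace Z] [FiniteDimensional ℝ Z] {G : E → Z}
    {G' : E →L[ℝ] Z} {x u : E} (hG : HasStrictFDerivAt G G' x) (hG0 : G x = 0)
    (hsurj : Function.Surjective G') (hu : G' u = 0) :
    ∃ c : ℝ → E, c 0 = x ∧ HasDerivAt c u 0 ∧ ∀ᶠ t in 𝓝 0, G (c t) = 0 := by
  obtain ⟨ρ, hρ⟩ := G'.exists_rightInverse_of_surjective (LinearMap.range_eq_top.2 hsurj)
  have hρ' : ∀ s, G' (ρ s) = s := fun s => DFunLike.congr_fun hρ s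
  -- The curve is sought as `x + t • u + ρ s`: the derivative in `s` is the identity, and `G' u = 0`
  -- makes `s` have zero velocity, so the velocity remains `u`.
  let i : ℝ × Z →L[ℝ] E := (ContinuousLinearMap.toSpanSingleton ℝ u).coprod ρ
  have hi : ∀ q, i q = q.1 • u + ρ q.2 := fun q => by simp [i]
  have h1 : HasStrictFDerivAt (fun q : ℝ × Z => x + i q) i (0, 0) :=
    i.hasStrictFDerivAt.const_add x
  have h2 : HasStrictFDerivAt (fun q : ℝ × Z => G (x + i q)) (G' ∘L i) (0, 0) := by
    refine HasStrictFDerivAt.comp (g := G) (f := fun q : ℝ × Z => x + i q) (0, 0) ?_ h1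
    simpa [hi] using hG
  obtain ⟨σ, hσ0, hσ, hsol⟩ := h2.exists_implicit_solution (by simp [hi, hG0])
    (fun s => by simp [hi, hρ'])
  refine ⟨fun t => x + i (t, σ t), by simp [hi, hσ0], ?_, hsol⟩
  have hσ' : HasDerivAt σ 0 0 := by
    have := hσ.hasDerivAt
    simpa [hi, hu] using this
  have h3 : HasDerivAt (fun t : ℝ => i (t, σ t)) (i (1, 0)) 0 :=
    i.hasFDerivAt.comp_hasDerivAt 0 ((hasDerivAt_id (0 : ℝ)).prodMk hσ')
  simpa [hi] using h3.const_add x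

end Calculus

/-! ### Local models along manifolds, and decrease at strict saddles -/

section LocalEquation

variable {E : Type*} [NormedAddCommGroup E] [InnerProductSpace ℝ E]

/-- Near `x`, the set `M` is the regular zero set of the `C²` map `G`, and `f` agrees on `M` with
the `C²` function `φ`. -/
structure IsLocalModel {k : ℕ} (f : E → EReal) (M : Set E) (x : E)
    (G : E → EuclideanSpace ℝ (Fin k)) (φ : E → ℝ) : Prop where
  contDiffAt_eq : ContDiffAt ℝ 2 G x
  surjective : Function.Surjective (fderiv ℝ G x)
  eq_zero : G x = 0
  contDiffAt : ContDiffAt ℝ 2 φ x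
  mem_iff : ∀ᶠ y in 𝓝 x, y ∈ M ↔ G y = 0
  eq_on : ∀ᶠ y in 𝓝 x, G y = 0 → f y = φ y

lemma exists_isLocalModel {f : E → EReal} {M U : Set E} {x : E} (hx : x ∈ M) (hU : IsOpen U)
    (hxU : x ∈ U) (hM : IsSmoothManifold 2 (M ∩ U)) (hf : IsSmoothAlong 2 f (M ∩ U)) :
    ∃ (k : ℕ) (G : E → EuclideanSpace ℝ (Fin k)) (φ : E → ℝ), IsLocalModel f M x G φ := by
  obtain ⟨k, W, G, hW, hxW, hG, hsurj, hMW⟩ := hM x ⟨hx, hxU⟩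
  obtain ⟨W', φ, hW', hxW', hφ, hfφ⟩ := hf x ⟨hx, hxU⟩
  have hmem : ∀ y ∈ U, y ∈ W → (y ∈ M ↔ G y = 0) := by
    intro y hyU hyW
    have := Set.ext_iff.1 hMW y
    simp only [Set.mem_inter_iff, Set.mem_ofPred_eq, hyU, hyW, and_true, true_and] at this
    exact this
  refine ⟨k, G, φ, hG.contDiffAt (hW.mem_nhds hxW), hsurj, (hmem x hxU hxW).1 hx,
    hφ.contDiffAt (hW'.mem_nhds hxW'), ?_, ?_⟩
  · filter_upwards [hU.mem_nhds hxU, hW.mem_nhds hxW] with y h1 h2 using hmem y h1 h2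
  · filter_upwards [hU.mem_nhds hxU, hW.mem_nhds hxW, hW'.mem_nhds hxW'] with y h1 h2 h3 h4
    exact hfφ y ⟨⟨(hmem y h1 h2).2 h4, h1⟩, h3⟩

namespace IsLocalModel

variable {k : ℕ} {f : E → EReal} {M : Set E} {x : E} {G : E → EuclideanSpace ℝ (Fin k)}
  {φ : E → ℝ}

lemma apply_self (h : IsLocalModel f M x G φ) : f x = φ x := h.eq_on.self_of_nhds h.eq_zero

lemma hasStrictFDerivAt (h : IsLocalModel f M x G φ) :
    HasStrictFDerivAt G (fderiv ℝ G x) x := h.contDiffAt_eq.hasStrictFDerivAt (by simp)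

lemma hasFDerivAt (h : IsLocalModel f M x G φ) : HasFDerivAt φ (fderiv ℝ φ x) x :=
  (h.contDiffAt.differentiableAt (by simp)).hasFDerivAt

/-- `G` is zero at `x` and at the nearby points of `M`, so the difference quotients defining a
tangent vector vanish. -/
lemma fderiv_eq_zero_of_mem_tangentConeAt (h : IsLocalModel f M x G φ) {u : E}
    (hu : u ∈ tangentConeAt ℝ M x) : fderiv ℝ G x u = 0 := by
  rcases exists_fun_of_mem_tangentConeAt hu with ⟨ι, l, hl, c, d, hd₀, hds, hcd⟩
  have h1 := (h.hasStrictFDerivAt.hasFDerivAt.hasFDerivWithinAt (s := M)).lim hd₀ hds hcd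
  have h2 : Tendsto (fun n => x + d n) l (𝓝 x) := by simpa using tendsto_const_nhds.add hd₀
  refine tendsto_nhds_unique h1 (Tendsto.congr' ?_ tendsto_const_nhds)
  filter_upwards [h2.eventually h.mem_iff, hds] with n hn hn'
  simp [hn.1 hn', h.eq_zero]

/-- The subgradient inequality is tested on a curve in the zero set of `G` with velocity `a`, where
`f` is the smooth `φ`. Applied to `a` and `-a`, it shows that all subgradients share the tangential
derivative of `φ`. -/
lemma inner_le_fderiv (h : IsLocalModel f M x G φ) {w a : E} (hw : w ∈ subdiff f x)
    (ha : fderiv ℝ G x a = 0) : inner ℝ w a ≤ fderiv ℝ φ x a := by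
  obtain ⟨c, hc0, hc, hcG⟩ := h.hasStrictFDerivAt.exists_curve h.eq_zero h.surjective ha
  have hct : Tendsto c (𝓝 0) (𝓝 x) := by simpa [hc0] using hc.continuousAt.tendsto
  have hφc : HasDerivAt (fun t => φ (c t)) (fderiv ℝ φ x a) 0 := by
    have := h.hasFDerivAt
    rw [← hc0] at this
    rw [← hc0]
    exact this.comp_hasDerivAt 0 hc
  have hs1 := hφc.tendsto_slope_zero_right
  have hs2 := hc.tendsto_slope_zero_right
  have hkey : ∀ ε : ℝ, 0 < ε → inner ℝ w a - ε * ‖a‖ ≤ fderiv ℝ φ x a := by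
    intro ε hε
    have hev := (hct.eventually (hw.2.2 ε hε)).and (hcG.and (hct.eventually h.eq_on))
    refine le_of_tendsto_of_tendsto ((tendsto_const_nhds.inner hs2).sub
      (tendsto_const_nhds.mul hs2.norm)) hs1 ?_
    filter_upwards [hev.filter_mono nhdsWithin_le_nhds, self_mem_nhdsWithin] with t ht ht0
    obtain ⟨h1, h2, h3⟩ := ht
    rw [h3 h2, h.apply_self, ← EReal.coe_add] at h1
    have h1 := EReal.coe_le_coe_iff.1 h1
    have ht0 : 0 < t := ht0
    simp only [zero_add, hc0, norm_smul, Real.norm_eq_abs, inner_smul_right, smul_eq_mul,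
      abs_of_pos (inv_pos.2 ht0)]
    rw [show t⁻¹ * inner ℝ w (c t - x) - ε * (t⁻¹ * ‖c t - x‖) =
      t⁻¹ * (inner ℝ w (c t - x) - ε * ‖c t - x‖) by ring]
    exact mul_le_mul_of_nonneg_left (by linarith) (inv_pos.2 ht0).le
  refine le_of_forall_Ioo_le_add_mul (Y := ‖a‖) fun t ht => ?_
  linarith [hkey t ht.1]

lemma fderiv_eq_inner (h : IsLocalModel f M x G φ) {w a : E} (hw : w ∈ subdiff f x)
    (ha : fderiv ℝ G x a = 0) : fderiv ℝ φ x a = inner ℝ w a := by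
  refine le_antisymm ?_ (h.inner_le_fderiv hw ha)
  have := h.inner_le_fderiv hw (a := -a) (by simp [ha])
  simp only [inner_neg_right, map_neg] at this
  linarith

/-- The function `φ` may be chosen with gradient any given subgradient. -/
lemma exists_fderiv_eq (h : IsLocalModel f M x G φ) {w : E} (hw : w ∈ subdiff f x) :
    ∃ φ' : E → ℝ, IsLocalModel f M x G φ' ∧ fderiv ℝ φ' x = innerSL ℝ w := by
  obtain ⟨ρ, hρ⟩ := (fderiv ℝ G x).exists_rightInverse_of_surjective
    (LinearMap.range_eq_top.2 h.surjective)
  have hρ' : ∀ s, fderiv ℝ G x (ρ s) = s := fun s => DFunLike.congr_fun hρ s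
  -- `fderiv ℝ φ x - ⟪w, ·⟫` vanishes on the kernel of `fderiv ℝ G x`, hence equals `Λ` composed
  -- with it. Subtracting `Λ ∘ G` corrects the gradient and changes `φ` only off the zero set of
  -- `G`.
  set Λ : EuclideanSpace ℝ (Fin k) →L[ℝ] ℝ := (fderiv ℝ φ x - innerSL ℝ w) ∘L ρ with hΛ
  have hd : HasFDerivAt (fun y => φ y - Λ (G y)) (fderiv ℝ φ x - Λ ∘L fderiv ℝ G x) x :=
    h.hasFDerivAt.sub (Λ.hasFDerivAt.comp x h.hasStrictFDerivAt.hasFDerivAt)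
  refine ⟨fun y => φ y - Λ (G y), ⟨h.contDiffAt_eq, h.surjective, h.eq_zero,
    h.contDiffAt.sub (Λ.contDiff.contDiffAt.comp x h.contDiffAt_eq), h.mem_iff, ?_⟩, ?_⟩
  · filter_upwards [h.eq_on] with y hy h0
    rw [hy h0, h0]; simp
  · rw [hd.fderiv]
    ext a
    have := h.fderiv_eq_inner hw (a := a - ρ (fderiv ℝ G x a)) (by simp [hρ'])
    simp only [map_sub, inner_sub_right] at this
    simp only [hΛ, sub_apply, ContinuousLinearMap.comp_apply,
      innerSL_apply_apply]
    linarith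

end IsLocalModel

/-- The liminf is bounded by its value along a single curve in `M` with velocity `u`, where the
quotient converges. -/
lemma subderiv_restrictTo_le {k : ℕ} {f : E → EReal} {M : Set E} {x : E}
    {G : E → EuclideanSpace ℝ (Fin k)} {φ : E → ℝ} (h : IsLocalModel f M x G φ) {u : E}
    (hu : fderiv ℝ G x u = 0) : subderiv (restrictTo f M) x u ≤ (fderiv ℝ φ x u : ℝ) := by
  obtain ⟨c, hc0, hc, hcG⟩ := h.hasStrictFDerivAt.exists_curve h.eq_zero h.surjective hu
  have hct : Tendsto c (𝓝 0) (𝓝 x) := by simpa [hc0] using hc.continuousAt.tendsto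
  have hφc : HasDerivAt (fun t => φ (c t)) (fderiv ℝ φ x u) 0 := by
    have := h.hasFDerivAt
    rw [← hc0] at this
    rw [← hc0]
    exact this.comp_hasDerivAt 0 hc
  have hs1 := hφc.tendsto_slope_zero_right
  have hs2 := hc.tendsto_slope_zero_right
  set g : ℝ → ℝ × E := fun t => (t, t⁻¹ • (c (0 + t) - c 0)) with hg
  have hgt : Tendsto g (𝓝[>] 0) (𝓝[>] (0 : ℝ) ×ˢ 𝓝 u) := tendsto_id.prodMk hs2
  have hmap : map g (𝓝[>] 0) ≤ 𝓝[>] (0 : ℝ) ×ˢ 𝓝 u := hgt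
  unfold subderiv
  refine le_trans (liminf_le_liminf_of_le hmap) ?_
  have h2 : Tendsto (fun t : ℝ => ((t⁻¹ • (φ (c (0 + t)) - φ (c 0)) : ℝ) : EReal)) (𝓝[>] 0)
    (𝓝 ((fderiv ℝ φ x u : ℝ) : EReal)) := (continuous_coe_real_ereal.tendsto _).comp hs1
  refine le_of_eq ?_
  rw [← Filter.liminf_comp]
  refine (Filter.liminf_congr ?_).trans h2.liminf_eq
  have hmem := (hcG.and (hct.eventually (h.eq_on.and h.mem_iff))).filter_mono
    (nhdsWithin_le_nhds (s := Set.Ioi 0))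
  filter_upwards [hmem, self_mem_nhdsWithin] with t ht ht0
  obtain ⟨h1, h2, h3⟩ := ht
  have ht0 : 0 < t := ht0
  have hx : x ∈ M := h.mem_iff.self_of_nhds.2 h.eq_zero
  have hy : x + t • t⁻¹ • (c t - x) = c t := by
    rw [smul_smul, mul_inv_cancel₀ ht0.ne', one_smul, add_sub_cancel]
  have hr : ∀ y ∈ M, restrictTo f M y = f y := fun y hy => if_pos hy
  simp only [hg, Function.comp_apply, zero_add, hc0, hy, hr _ (h3.2 h1), hr x hx, h2 h1,
    h.apply_self, smul_eq_mul]
  push_cast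
  rfl

/-- At a strict saddle the function decreases quadratically along some direction. -/
lemma IsStrictSaddle.exists_frequently_le {f : E → EReal} {x : E} (h : IsStrictSaddle f x) :
    ∃ (u : E) (a c : ℝ), f x = a ∧ 0 < c ∧ ∃ᶠ q : ℝ × E in 𝓝[>] (0 : ℝ) ×ˢ 𝓝 u,
      f (x + q.1 • q.2) ≤ ((a - c * q.1 ^ 2 : ℝ) : EReal) := by
  obtain ⟨hcrit, M, ⟨hxM, U, hU, hxU, hM, hfM, -⟩, u, huM, hneg⟩ := h
  obtain ⟨k, G, φ, hmod⟩ := exists_isLocalModel hxM hU hxU hM hfM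
  have hu := hmod.fderiv_eq_zero_of_mem_tangentConeAt huM
  have hsub : subderiv (restrictTo f M) x u ≤ 0 := by
    have := subderiv_restrictTo_le hmod hu
    rwa [hmod.fderiv_eq_inner hcrit hu, inner_zero_left] at this
  obtain ⟨w, hw⟩ := iInf_lt_iff.1 hneg
  obtain ⟨b, hb1, hb2⟩ := EReal.lt_iff_exists_real_btwn.1 hw
  have hb0 : b < 0 := by exact_mod_cast hb2
  have hfreq := frequently_lt_of_liminf_lt (by isBoundedDefault) hb1
  -- A second-order quotient below `b < 0` means a decrease of `(-b / 2) t²`. The points `x + t u +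
  -- (t² / 2) w'` are `x + t (u + (t / 2) w')`, and these directions tend to `u`.
  refine ⟨u, φ x, -b / 2, hmod.apply_self, by linarith, ?_⟩
  have htend : Tendsto (fun q : ℝ × E => (q.1, u + (q.1 / 2) • q.2))
      (𝓝[>] (0 : ℝ) ×ˢ 𝓝 w) (𝓝[>] (0 : ℝ) ×ˢ 𝓝 u) := by
    refine tendsto_fst.prodMk ?_
    have h1 : Tendsto (fun q : ℝ × E => u + (q.1 / 2) • q.2) (𝓝 (0, w))
        (𝓝 (u + ((0 : ℝ) / 2) • w)) := Continuous.tendsto (by fun_prop) (0, w)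
    simp only [zero_div, zero_smul, add_zero] at h1
    refine h1.mono_left ?_
    rw [nhds_prod_eq]
    exact prod_mono_left _ nhdsWithin_le_nhds
  refine htend.frequently ?_
  have hpos : ∀ᶠ q : ℝ × E in 𝓝[>] (0 : ℝ) ×ˢ 𝓝 w, 0 < q.1 :=
    tendsto_fst.eventually self_mem_nhdsWithin
  refine (hfreq.and_eventually hpos).mono ?_
  rintro ⟨t, w'⟩ ⟨h1, ht : 0 < t⟩
  simp only at h1 ⊢
  have hy : x + t • (u + (t / 2) • w') = x + t • u + (t ^ 2 / 2) • w' := by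
    module
  rw [hy]
  set y := x + t • u + (t ^ 2 / 2) • w'
  have hxM' : restrictTo f M x = φ x := by rw [restrictTo, if_pos hxM, hmod.apply_self]
  rw [hxM'] at h1
  set Y := restrictTo f M y - (φ x : EReal) - (t : EReal) * subderiv (restrictTo f M) x u with hY
  have hY1 : Y ≤ ((b * t ^ 2 / 2 : ℝ) : EReal) := by
    have ht2 : 0 < 2 / t ^ 2 := by positivity
    clear_value Y
    induction Y with
    | bot => exact bot_le
    | top => rw [EReal.coe_mul_top_of_pos ht2] at h1; exact absurd h1 (by simp)
    | coe r =>
      rw [← EReal.coe_mul] at h1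
      have h1 := EReal.coe_lt_coe_iff.1 h1
      refine EReal.coe_le_coe_iff.2 ?_
      rw [div_mul_eq_mul_div, div_lt_iff₀ (by positivity)] at h1
      linarith
  -- The first-order term is dropped by sign: criticality made the subderivative along `u`
  -- nonpositive.
  have hY2 : restrictTo f M y - (φ x : EReal) ≤ Y := by
    rw [hY, sub_eq_add_neg (restrictTo f M y - (φ x : EReal))]
    refine le_add_of_nonneg_right ?_
    rw [EReal.neg_nonneg]
    exact mul_nonpos_of_nonneg_of_nonpos (by exact_mod_cast ht.le) hsub
  have hY3 := hY2.trans hY1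
  rw [sub_eq_add_neg, ← EReal.coe_neg] at hY3
  have hY4 := EReal.le_sub_of_add_coe_le hY3
  have hfy : f y ≤ restrictTo f M y := by
    rw [restrictTo]; split_ifs
    · exact le_rfl
    · exact le_top
  refine (hfy.trans hY4).trans (EReal.coe_le_coe_iff.2 (le_of_eq ?_))
  ring

end LocalEquation

lemma ConvexUpTo.mono {E : Type*} [NormedAddCommGroup E] [InnerProductSpace ℝ E]
    {f : E → EReal} {ℓ ℓ' : ℝ} (hf : ConvexUpTo ℓ f) (h : ℓ ≤ ℓ') : ConvexUpTo ℓ' f := by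
  intro x y a b s t hx hy hs ht hst
  refine (hf hx hy hs ht hst).trans (EReal.coe_le_coe_iff.2 ?_)
  gcongr

/-! ### Lagrange multipliers by separation -/

section Duality

variable {E E₂ : Type*} [NormedAddCommGroup E] [InnerProductSpace ℝ E]
  [NormedAddCommGroup E₂] [InnerProductSpace ℝ E₂] [CompleteSpace E₂]

/-- Fenchel duality: a minimization problem that is uniformly bounded above under perturbations
of the inner argument has a Lagrange multiplier. -/
lemma exists_multiplier {h : E₂ → EReal} {k : E → EReal} (hh : ConvexUpTo 0 h)
    (hk : ConvexUpTo 0 k) (A : E →L[ℝ] E₂) (a : E₂) {v r C : ℝ} (hr : 0 < r)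
    (hmin : ∀ (y : E) (α β : ℝ), h (a + A y) ≤ α → k y ≤ β → v ≤ α + β)
    (hC : ∀ e : E₂, ‖e‖ < r → ∃ (y : E) (α β : ℝ), h (a + A y + e) ≤ α ∧ k y ≤ β ∧ α + β ≤ C) :
    ∃ z : E₂, ‖z‖ * r ≤ 2 * (C + 1 - v) ∧ ∀ (y : E) (u : E₂) (α β : ℝ), h u ≤ α → k y ≤ β →
      v + inner ℝ z (u - (a + A y)) ≤ α + β := by
  -- The strict epigraph of `e ↦ inf_y h (a + A y + e) + k y`. By `hC` it contains a cylinder over a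
  -- ball, by minimality it misses `(0, v)`, and a separating functional provides the multiplier.
  set S : Set (E₂ × ℝ) := {q | ∃ (y : E) (α β : ℝ), h (a + A y + q.1) ≤ α ∧ k y ≤ β ∧
    α + β < q.2} with hS
  have hconv : Convex ℝ S := by
    rintro ⟨e₁, s₁⟩ ⟨y₁, α₁, β₁, h1, h2, h3⟩ ⟨e₂, s₂⟩ ⟨y₂, α₂, β₂, h4, h5, h6⟩ c d hc hd hcd
    refine ⟨c • y₁ + d • y₂, c * α₁ + d * α₂, c * β₁ + d * β₂, ?_, ?_, ?_⟩
    · have := hh h1 h4 hc hd hcd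
      have he : a + A (c • y₁ + d • y₂) + (c • e₁ + d • e₂) =
          c • (a + A y₁ + e₁) + d • (a + A y₂ + e₂) := by
        obtain rfl : d = 1 - c := by linarith
        rw [map_add, map_smul, map_smul]; module
      rw [← he] at this
      simpa only [zero_div, zero_mul, add_zero, Prod.smul_mk, Prod.mk_add_mk] using this
    · simpa using hk h2 h5 hc hd hcd
    · simp only [Prod.smul_mk, Prod.mk_add_mk, smul_eq_mul] at h3 h6 ⊢
      rcases hc.eq_or_lt with rfl | hc'
      · obtain rfl : d = 1 := by linarith
        simpa using h6
      · nlinarith [mul_lt_mul_of_pos_left h3 hc', mul_le_mul_of_nonneg_left h6.le hd]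
  have hopen : Metric.ball (0 : E₂) r ×ˢ Set.Ioi C ⊆ interior S := by
    refine interior_maximal ?_ (Metric.isOpen_ball.prod isOpen_Ioi)
    rintro ⟨e, s⟩ ⟨he, hs⟩
    obtain ⟨y, α, β, h1, h2, h3⟩ := hC e (by simpa using he)
    exact ⟨y, α, β, h1, h2, h3.trans_lt hs⟩
  have hnot : ((0 : E₂), v) ∉ interior S := fun hmem => by
    obtain ⟨y, α, β, h1, h2, h3⟩ := interior_subset hmem
    exact absurd (hmin y α β (by simpa using h1) h2) (not_le.2 h3)
  obtain ⟨f, hf⟩ := geometric_hahn_banach_open_point hconv.interior isOpen_interior hnot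
  have hne : (interior S).Nonempty :=
    ⟨(0, C + 1), hopen ⟨Metric.mem_ball_self hr, by simp⟩⟩
  have hle : ∀ q ∈ S, f q ≤ f (0, v) := by
    intro q hq
    have h1 : S ⊆ closure (interior S) :=
      subset_closure.trans (hconv.closure_interior_eq_closure_of_nonempty_interior hne).ge
    exact closure_minimal (fun q hq => (hf q hq).le)
      (isClosed_le f.continuous continuous_const) (h1 hq)
  set τ := f (0, 1) with hτ
  have hfs : ∀ e s, f (e, s) = f (e, 0) + s * τ := by
    intro e s
    rw [hτ, ← smul_eq_mul, ← map_smul, ← map_add]; simp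
  -- The hyperplane is not vertical, since high points over `e = 0` are interior; the functional can
  -- therefore be scaled to have last component `-1`.
  have hτ0 : τ < 0 := by
    have h1 := hf (0, max C v + 1)
      (hopen ⟨Metric.mem_ball_self hr, (le_max_left C v).trans_lt (lt_add_one _)⟩)
    rw [hfs, hfs 0 v] at h1
    have h2 : (max C v + 1 - v) * τ < 0 := by linarith
    have h3 : 0 < max C v + 1 - v := by linarith [le_max_right C v]
    by_contra! h4
    exact absurd h2 (not_lt.2 (mul_nonneg h3.le h4))
  have h00 : f ((0 : E₂), (0 : ℝ)) = 0 := by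
    rw [show ((0 : E₂), (0 : ℝ)) = 0 from rfl, map_zero]
  set ζ : StrongDual ℝ E₂ := (-τ)⁻¹ • (f ∘L .inl ℝ E₂ ℝ) with hζ
  set z := (InnerProductSpace.toDual ℝ E₂).symm ζ
  have hz : ∀ e, inner ℝ z e = (-τ)⁻¹ * f (e, 0) := fun e => by
    rw [InnerProductSpace.toDual_symm_apply, hζ]; simp
  have key : ∀ e s, (e, s) ∈ S → v + inner ℝ z e ≤ s := by
    intro e s hes
    have h1 := hle _ hes
    rw [hfs, hfs 0 v, h00] at h1
    have h2 : 0 < (-τ)⁻¹ := inv_pos.2 (by linarith)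
    have h3 := mul_le_mul_of_nonneg_left h1 h2.le
    have h4 : (-τ)⁻¹ * τ = -1 := by rw [inv_neg, neg_mul, inv_mul_cancel₀ hτ0.ne]
    rw [hz]
    have h5 : (-τ)⁻¹ * (f (e, 0) + s * τ) = (-τ)⁻¹ * f (e, 0) - s := by
      rw [mul_add, mul_left_comm, h4]; ring
    have h6 : (-τ)⁻¹ * (0 + v * τ) = -v := by rw [zero_add, mul_left_comm, h4]; ring
    linarith
  refine ⟨z, ?_, ?_⟩
  · by_cases hz0 : ‖z‖ = 0
    · rw [hz0, zero_mul]
      have := key 0 (C + 1) (interior_subset (hopen ⟨Metric.mem_ball_self hr, by simp⟩))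
      rw [inner_zero_right] at this
      linarith
    · have hz1 : 0 < ‖z‖ := lt_of_le_of_ne (norm_nonneg _) (Ne.symm hz0)
      -- The perturbation of length `r / 2` along `z`, at height `C + 1`, bounds `‖z‖`.
      have := key ((r / 2 / ‖z‖) • z) (C + 1) (interior_subset (hopen ⟨by
        rw [mem_ball_zero_iff, norm_smul, Real.norm_of_nonneg (by positivity),
          div_mul_cancel₀ _ hz0]; linarith, by simp⟩))
      rw [inner_smul_right, real_inner_self_eq_norm_sq] at this
      have h2 : r / 2 / ‖z‖ * ‖z‖ ^ 2 = ‖z‖ * r / 2 := by field_simp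
      linarith
  · intro y u α β hu hy
    refine le_of_forall_pos_le_add fun ε hε => ?_
    exact key _ _ ⟨y, α, β, by simpa using hu, hy, by simpa using hε⟩

end Duality

/-! ### Quadratic forms: Rayleigh quotients and perturbed minimizers -/

section QuadraticForms

variable {E P : Type*} [NormedAddCommGroup E] [InnerProductSpace ℝ E]
  [NormedAddCommGroup P] [NormedSpace ℝ P]

lemma isLittleO_bilin {ι V W G : Type*} [NormedAddCommGroup V] [NormedSpace ℝ V]
    [NormedAddCommGroup W] [NormedSpace ℝ W] [NormedAddCommGroup G] [NormedSpace ℝ G]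
    {l : Filter ι} (B : V →L[ℝ] W →L[ℝ] G) {a : ι → V} {b : ι → W} {g g' : ι → ℝ}
    (ha : a =o[l] g) (hb : b =O[l] g') : (fun i => B (a i) (b i)) =o[l] fun i => g i * g' i := by
  have h1 : (fun i => B (a i) (b i)) =O[l] fun i => ‖a i‖ * ‖b i‖ :=
    IsBigO.of_bound ‖B‖ (Eventually.of_forall fun i => by
      simpa [mul_assoc] using B.le_opNorm₂ (a i) (b i))
  exact h1.trans_isLittleO (ha.norm_left.mul_isBigO hb.norm_left)

lemma isBigO_bilin {ι V W G : Type*} [NormedAddCommGroup V] [NormedSpace ℝ V]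
    [NormedAddCommGroup W] [NormedSpace ℝ W] [NormedAddCommGroup G] [NormedSpace ℝ G]
    {l : Filter ι} (B : V →L[ℝ] W →L[ℝ] G) {a : ι → V} {b : ι → W} {g g' : ι → ℝ}
    (ha : a =O[l] g) (hb : b =O[l] g') : (fun i => B (a i) (b i)) =O[l] fun i => g i * g' i := by
  have h1 : (fun i => B (a i) (b i)) =O[l] fun i => ‖a i‖ * ‖b i‖ :=
    IsBigO.of_bound ‖B‖ (Eventually.of_forall fun i => by
      simpa [mul_assoc] using B.le_opNorm₂ (a i) (b i))
  exact h1.trans (ha.norm_left.mul hb.norm_left)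

lemma eq_zero_of_forall_linear_quadratic {β q : ℝ} (h : ∀ t : ℝ, 0 ≤ 2 * t * β + t ^ 2 * q) :
    β = 0 := by
  have h1 := h (-β / (|q| + 1))
  have h2 : 0 < |q| + 1 := by positivity
  have h3 : 2 * (-β / (|q| + 1)) * β + (-β / (|q| + 1)) ^ 2 * q =
      β ^ 2 / (|q| + 1) ^ 2 * (q - 2 * (|q| + 1)) := by field_simp; ring
  rw [h3] at h1
  by_contra hβ
  have h4 : 0 < β ^ 2 / (|q| + 1) ^ 2 := by positivity
  nlinarith [le_abs_self q, abs_nonneg q]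

/-- Generalized Rayleigh quotient: if `W` exceeds the positive definite form `R` somewhere on `T`,
then the pencil `(W, R)` has an eigenvalue greater than one on `T`. -/
lemma exists_pencil_eigenvector [FiniteDimensional ℝ E] (T : Submodule ℝ E)
    (R W : E →L[ℝ] E →L[ℝ] ℝ) (hR : ∀ a b, R a b = R b a) (hW : ∀ a b, W a b = W b a)
    {κ : ℝ} (hκ : 0 < κ) (hcoer : ∀ a ∈ T, κ * ‖a‖ ^ 2 ≤ R a a) {u : E} (hu : u ∈ T)
    (hlt : R u u < W u u) :
    ∃ (r : ℝ) (a : E), 1 < r ∧ a ∈ T ∧ a ≠ 0 ∧ ∀ b ∈ T, W a b = r * R a b := by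
  have hpos : ∀ a ∈ T, a ≠ 0 → 0 < R a a := fun a ha ha0 =>
    lt_of_lt_of_le (by have := norm_pos_iff.2 ha0; positivity) (hcoer a ha)
  have hu0 : u ≠ 0 := by rintro rfl; simp at hlt
  have hcomp : IsCompact (Metric.sphere (0 : E) 1 ∩ T) :=
    (isCompact_sphere 0 1).inter_right T.closed_of_finiteDimensional
  have hnorm : ∀ a ∈ T, a ≠ 0 → ‖a‖⁻¹ • a ∈ Metric.sphere (0 : E) 1 ∩ T := by
    intro a ha ha0
    refine ⟨?_, T.smul_mem _ ha⟩
    rw [mem_sphere_zero_iff_norm, norm_smul, norm_inv, norm_norm,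
      inv_mul_cancel₀ (norm_ne_zero_iff.2 ha0)]
  have hne0 : ∀ a ∈ Metric.sphere (0 : E) 1 ∩ (T : Set E), a ≠ 0 := by
    rintro a ⟨ha, -⟩ rfl
    simp at ha
  have hcont : ContinuousOn (fun a => W a a / R a a) (Metric.sphere (0 : E) 1 ∩ T) := by
    refine ContinuousOn.div (by fun_prop) (by fun_prop) fun a ha => ?_
    exact (hpos a ha.2 (hne0 a ha)).ne'
  -- With `r` the maximal quotient, `r R - W` is nonnegative on `T` and vanishes at `a`, so its
  -- first variation at `a` vanishes; this is the eigenvector equation.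
  obtain ⟨a, ha, hmax⟩ := hcomp.exists_isMaxOn ⟨_, hnorm u hu hu0⟩ hcont
  set r := W a a / R a a with hr
  have hquot : ∀ b ∈ T, b ≠ 0 → W b b ≤ r * R b b := by
    intro b hb hb0
    have h1 : W (‖b‖⁻¹ • b) (‖b‖⁻¹ • b) / R (‖b‖⁻¹ • b) (‖b‖⁻¹ • b) ≤ r :=
      hmax (hnorm b hb hb0)
    have h2 : ‖b‖⁻¹ ≠ 0 := inv_ne_zero (norm_ne_zero_iff.2 hb0)
    simp only [map_smul, smul_apply, smul_eq_mul] at h1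
    rw [mul_div_mul_left _ _ h2, mul_div_mul_left _ _ h2, div_le_iff₀ (hpos b hb hb0)] at h1
    exact h1
  have hquot' : ∀ b ∈ T, 0 ≤ r * R b b - W b b := by
    intro b hb
    by_cases hb0 : b = 0
    · simp [hb0]
    · linarith [hquot b hb hb0]
  have ha0 := hne0 a ha
  have hRa := hpos a ha.2 ha0
  have hra : r * R a a = W a a := by rw [hr]; field_simp
  refine ⟨r, a, ?_, ha.2, ha0, fun b hb => ?_⟩
  · by_contra! hr1
    have := hquot u hu hu0
    nlinarith [hpos u hu hu0]
  · have := eq_zero_of_forall_linear_quadratic (β := r * R a b - W a b)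
      (q := r * R b b - W b b) fun t => by
        have h1 := hquot' (a + t • b) (T.add_mem ha.2 (T.smul_mem t hb))
        simp only [map_add, map_smul, add_apply, smul_apply, smul_eq_mul] at h1
        rw [hR b a, hW b a] at h1
        linarith
    linarith

/-- A parametrized linear variational equation with a coercive form has a linear solution map. -/
lemma exists_variational_solution [FiniteDimensional ℝ E] [FiniteDimensional ℝ P]
    (T : Submodule ℝ E) (R : E →L[ℝ] E →L[ℝ] ℝ) {κ : ℝ} (hκ : 0 < κ)
    (hcoer : ∀ a ∈ T, κ * ‖a‖ ^ 2 ≤ R a a) (L : P →L[ℝ] E →L[ℝ] ℝ) :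
    ∃ D : P →L[ℝ] E, ∀ p, D p ∈ T ∧ ∀ b ∈ T, R (D p) b = L p b := by
  have huniq : ∀ a ∈ T, (∀ b ∈ T, R a b = 0) → a = 0 := by
    intro a ha h
    have := hcoer a ha
    rw [h a ha] at this
    by_contra h0
    have := norm_pos_iff.2 h0
    have : 0 < κ * ‖a‖ ^ 2 := by positivity
    linarith
  let B : T →ₗ[ℝ] Module.Dual ℝ T :=
    { toFun := fun a => (R a : E →ₗ[ℝ] ℝ) ∘ₗ T.subtype
      map_add' := fun a b => by ext; simp
      map_smul' := fun c a => by ext; simp }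
  have hB : ∀ a b, B a b = R a b := fun a b => rfl
  have hinj : Function.Injective B := by
    rw [injective_iff_map_eq_zero]
    intro a ha
    refine Subtype.ext (huniq a a.2 fun b hb => ?_)
    exact DFunLike.congr_fun ha ⟨b, hb⟩
  let e := B.linearEquivOfInjective hinj (Subspace.dual_finrank_eq).symm
  let Lr : P →ₗ[ℝ] Module.Dual ℝ T :=
    { toFun := fun p => (L p : E →ₗ[ℝ] ℝ) ∘ₗ T.subtype
      map_add' := fun a b => by ext; simp
      map_smul' := fun c a => by ext; simp }
  refine ⟨LinearMap.toContinuousLinearMap (T.subtype ∘ₗ (e.symm : _ →ₗ[ℝ] T) ∘ₗ Lr), fun p =>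
    ⟨Submodule.coe_mem _, fun b hb => ?_⟩⟩
  have h1 : e (e.symm (Lr p)) = Lr p := e.apply_symm_apply _
  exact DFunLike.congr_fun h1 ⟨b, hb⟩

/-- Approximate minimizers of a perturbed quadratic family are differentiable in the parameter. -/
lemma isLittleO_minimizer_sub (T : Submodule ℝ E) (R : E →L[ℝ] E →L[ℝ] ℝ)
    (hR : ∀ a b, R a b = R b a) {κ : ℝ} (hκ : 0 < κ) (hcoer : ∀ a ∈ T, κ * ‖a‖ ^ 2 ≤ R a a)
    (L : P →L[ℝ] E →L[ℝ] ℝ) (D : P →L[ℝ] E) (hD : ∀ p, D p ∈ T)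
    (hDL : ∀ p, ∀ b ∈ T, R (D p) b = L p b) {δ τ δ' : P → E} {e : P → ℝ}
    (hδ : δ =O[𝓝 0] fun p => ‖p‖) (hτ : ∀ p, τ p ∈ T)
    (hδτ : (fun p => δ p - τ p) =o[𝓝 0] fun p => ‖p‖)
    (hδ' : (fun p => δ' p - D p) =o[𝓝 0] fun p => ‖p‖)
    (he : e =o[𝓝 0] fun p => ‖p‖ ^ 2)
    (hle : ∀ᶠ p in 𝓝 0, 1 / 2 * R (δ p) (δ p) - L p (δ p) ≤
      1 / 2 * R (δ' p) (δ' p) - L p (δ' p) + e p) :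
    (fun p => δ p - D p) =o[𝓝 0] fun p => ‖p‖ := by
  have hDO : (fun p => D p) =O[𝓝 0] fun p => ‖p‖ :=
    (D.isBigO_id (𝓝 0)).trans (isBigO_refl _ _).norm_right
  have hLid : (fun p : P => p) =O[𝓝 0] fun p => ‖p‖ := (isBigO_refl _ _).norm_right
  have hτO : τ =O[𝓝 0] fun p => ‖p‖ := by
    simpa using hδ.sub hδτ.isBigO
  have hδ'O : δ' =O[𝓝 0] fun p => ‖p‖ := by
    simpa using hδ'.isBigO.add hDO
  have hdiff : ∀ {a b : P → E}, a =O[𝓝 0] (fun p => ‖p‖) → b =O[𝓝 0] (fun p => ‖p‖) →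
      (fun p => a p - b p) =o[𝓝 0] (fun p => ‖p‖) →
      (fun p => (1 / 2 * R (a p) (a p) - L p (a p)) - (1 / 2 * R (b p) (b p) - L p (b p)))
        =o[𝓝 0] fun p => ‖p‖ ^ 2 := by
    intro a b ha hb hab
    have h1 := (isLittleO_bilin R hab (ha.add hb)).const_mul_left (1 / 2)
    have h2 := isLittleO_bilin L.flip hab hLid
    refine (h1.sub h2).congr (fun p => ?_) (fun p => by ring)
    simp only [map_sub, map_add, sub_apply, ContinuousLinearMap.flip_apply]
    rw [hR (b p) (a p)]
    ring
  have h1 := hdiff hδ hτO hδτ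
  have h2 := hdiff hδ'O hDO hδ'
  -- On `T` the excess of the quadratic over its value at `D p` is exactly `½ R (τ - D p) (τ - D
  -- p)`, so an `o(‖p‖²)` gap in value controls the squared distance.
  have h3 : (fun p => ‖τ p - D p‖ ^ 2) =o[𝓝 0] fun p => ‖p‖ ^ 2 := by
    refine IsBigO.trans_isLittleO (IsBigO.of_bound (2 / κ) ?_) ((he.add h2).sub h1)
    filter_upwards [hle] with p hp
    have h4 := hcoer _ (T.sub_mem (hτ p) (hD p))
    have h5 : R (τ p - D p) (τ p - D p) = 2 * ((1 / 2 * R (τ p) (τ p) - L p (τ p)) -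
        (1 / 2 * R (D p) (D p) - L p (D p))) := by
      rw [← hDL p _ (hτ p), ← hDL p _ (hD p)]
      simp only [map_sub, sub_apply]
      rw [hR (τ p) (D p)]; ring
    rw [h5] at h4
    rw [Real.norm_of_nonneg (sq_nonneg _), div_mul_eq_mul_div, le_div_iff₀ hκ]
    refine le_trans ?_ (mul_le_mul_of_nonneg_left (le_abs_self _) zero_le_two)
    linarith
  have h4 : (fun p => τ p - D p) =o[𝓝 0] fun p => ‖p‖ :=
    (IsLittleO.of_pow (n := 2) h3 two_ne_zero).of_norm_left
  simpa using hδτ.add h4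

end QuadraticForms

/-! ### Composite constraints and the convex model at a critical point -/

section Composite

variable {E E₂ : Type*} [NormedAddCommGroup E] [InnerProductSpace ℝ E]
  [NormedAddCommGroup E₂] [InnerProductSpace ℝ E₂]

/-- Inner affine model `F x + ∇F x (y - x)`. -/
noncomputable def linModel (F : E → E₂) (x y : E) : E₂ := F x + fderiv ℝ F x (y - x)

/-- On the diagonal the derivative in the model centre cancels: `F'` against the `-F'` from `y - x`,
while the second derivative is applied to `y - x = 0`. -/
lemma hasStrictFDerivAt_linModel {F : E → E₂} (hF : ContDiff ℝ 2 F) (x₀ : E) :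
    HasStrictFDerivAt (fun q : E × E => linModel F q.1 q.2)
      (fderiv ℝ F x₀ ∘L .snd ℝ E E) (x₀, x₀) := by
  have hF' : ContDiff ℝ 1 (fderiv ℝ F) := hF.fderiv_right (by norm_num)
  have hc : ContDiff ℝ 1 (fun q : E × E => linModel F q.1 q.2) :=
    ((hF.of_le (by norm_num)).comp contDiff_fst).add
      ((hF'.comp contDiff_fst).clm_apply (contDiff_snd.sub contDiff_fst))
  refine hc.contDiffAt.hasStrictFDerivAt' ?_ (by simp)
  have h1 : HasFDerivAt F (fderiv ℝ F x₀) x₀ := (hF.differentiable (by simp) x₀).hasFDerivAt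
  have h2 : HasFDerivAt (fderiv ℝ F) (fderiv ℝ (fderiv ℝ F) x₀) x₀ :=
    (hF'.differentiable (by simp) x₀).hasFDerivAt
  have h3 : HasFDerivAt (fun q : E × E => q.1) (ContinuousLinearMap.fst ℝ E E) (x₀, x₀) :=
    hasFDerivAt_fst
  have h4 : HasFDerivAt (fun q : E × E => q.2) (ContinuousLinearMap.snd ℝ E E) (x₀, x₀) :=
    hasFDerivAt_snd
  have h5 := (HasFDerivAt.comp (x₀, x₀) (g := F) (f := fun q : E × E => q.1) h1 h3).add
    ((HasFDerivAt.comp (x₀, x₀) (g := fderiv ℝ F) (f := fun q : E × E => q.1) h2 h3).clm_apply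
      (h4.sub h3))
  refine h5.congr_fderiv ?_
  ext v <;> simp

/-- Transversality: the derivative of the joint constraint map is onto. -/
lemma surjective_prod_of_transversal {Z₁ Z₂ : Type*} [NormedAddCommGroup Z₁] [NormedSpace ℝ Z₁]
    [NormedAddCommGroup Z₂] [NormedSpace ℝ Z₂] {A : E →L[ℝ] E₂} {G' : E →L[ℝ] Z₁}
    {H' : E₂ →L[ℝ] Z₂} (hG : Function.Surjective G') (hH : Function.Surjective H')
    (htrans : ∀ v : E₂, ∃ a b, G' a = 0 ∧ H' b = 0 ∧ A a + b = v) :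
    Function.Surjective (G'.prod (H' ∘L A)) := by
  rintro ⟨p, q⟩
  obtain ⟨a₀, ha₀⟩ := hG p
  obtain ⟨b₀, hb₀⟩ := hH (q - H' (A a₀))
  obtain ⟨a₁, b₁, h1, h2, h3⟩ := htrans b₀
  refine ⟨a₀ + a₁, ?_⟩
  have : H' (A a₁) = q - H' (A a₀) := by rw [← hb₀, ← h3, map_add, h2, add_zero]
  simp [ha₀, h1, this]

/-- Solving the constraints `G y = 0`, `H (J (x, y)) = 0` for `y`, tangentially to a prescribed
linear displacement `b`. -/
lemma exists_feasible_solution [CompleteSpace E] {X Z₁ Z₂ : Type*} [NormedAddCommGroup X] [NormedSpace ℝ X]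
    [CompleteSpace X] [NormedAddCommGroup Z₁] [NormedSpace ℝ Z₁] [FiniteDimensional ℝ Z₁]
    [NormedAddCommGroup Z₂] [NormedSpace ℝ Z₂] [FiniteDimensional ℝ Z₂]
    {G : E → Z₁} {H : E₂ → Z₂} {G' : E →L[ℝ] Z₁} {H' : E₂ →L[ℝ] Z₂} {y₀ : E} {x₀ : X}
    {J : X × E → E₂} {J' : X × E →L[ℝ] E₂} (b : X →L[ℝ] E)
    (hJ : HasStrictFDerivAt J J' (x₀, y₀)) (hG : HasStrictFDerivAt G G' y₀)
    (hH : HasStrictFDerivAt H H' (J (x₀, y₀))) (hG0 : G y₀ = 0) (hH0 : H (J (x₀, y₀)) = 0)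
    (hsurj : Function.Surjective (G'.prod (H' ∘L J' ∘L .inr ℝ X E))) :
    ∃ (Y : X → E) (Y' : X →L[ℝ] E), Y x₀ = y₀ ∧ HasFDerivAt Y Y' x₀ ∧
      (∀ ξ, G' (b ξ) = 0 → H' (J' (ξ, b ξ)) = 0 → Y' ξ = b ξ) ∧
      ∀ᶠ x in 𝓝 x₀, G (Y x) = 0 ∧ H (J (x, Y x)) = 0 := by
  have : CompleteSpace Z₁ := FiniteDimensional.complete ℝ Z₁
  have : CompleteSpace Z₂ := FiniteDimensional.complete ℝ Z₂
  obtain ⟨ρ, hρ⟩ := ContinuousLinearMap.exists_rightInverse_of_surjective _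
    (LinearMap.range_eq_top.2 hsurj)
  have hρ' : ∀ s, (G' (ρ s), H' (J' (0, ρ s))) = s := fun s => DFunLike.congr_fun hρ s
  let i : X × (Z₁ × Z₂) →L[ℝ] E := b.coprod ρ
  have hi : ∀ q, i q = b q.1 + ρ q.2 := fun q => by simp [i]
  -- The prescribed displacement `b`, shifted to pass through `y₀`, plus a correction `ρ s` across
  -- the constraints. The correction has zero derivative in directions where `b` solves the
  -- linearized constraints.
  let g : X × (Z₁ × Z₂) → E := fun q => y₀ - b x₀ + i q
  have hg0 : g (x₀, 0) = y₀ := by simp [g, hi]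
  have h1 : HasStrictFDerivAt g i (x₀, 0) := i.hasStrictFDerivAt.const_add _
  have h2 : HasStrictFDerivAt (fun q : X × (Z₁ × Z₂) => (q.1, g q))
      ((ContinuousLinearMap.fst ℝ X (Z₁ × Z₂)).prod i) (x₀, 0) :=
    hasStrictFDerivAt_fst.prodMk h1
  have hG2 : HasStrictFDerivAt (fun q => G (g q)) (G' ∘L i) (x₀, 0) :=
    HasStrictFDerivAt.comp (x₀, 0) (g := G) (by rwa [hg0]) h1
  have hJ2 : HasStrictFDerivAt (fun q => J (q.1, g q))
      (J' ∘L (ContinuousLinearMap.fst ℝ X (Z₁ × Z₂)).prod i) (x₀, 0) :=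
    HasStrictFDerivAt.comp (x₀, 0) (g := J) (f := fun q : X × (Z₁ × Z₂) => (q.1, g q))
      (by simpa only [hg0] using hJ) h2
  have hH2 : HasStrictFDerivAt (fun q => H (J (q.1, g q)))
      (H' ∘L J' ∘L (ContinuousLinearMap.fst ℝ X (Z₁ × Z₂)).prod i) (x₀, 0) :=
    HasStrictFDerivAt.comp (x₀, 0) (g := H) (f := fun q : X × (Z₁ × Z₂) => J (q.1, g q))
      (by simpa only [hg0] using hH) hJ2
  obtain ⟨σ, hσ0, hσ, hsol⟩ := (hG2.prodMk hH2).exists_implicit_solution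
    (by simp [hg0, hG0, hH0]) (fun s => by simpa [hi] using hρ' s)
  refine ⟨fun x => g (x, σ x), i ∘L (ContinuousLinearMap.id ℝ X).prod
    (-(((G' ∘L i).prod (H' ∘L J' ∘L (ContinuousLinearMap.fst ℝ X (Z₁ × Z₂)).prod i)) ∘L
      .inl ℝ X (Z₁ × Z₂))), by simp [hσ0, hg0], ?_, ?_, ?_⟩
  · exact (i.hasFDerivAt.comp x₀ ((hasFDerivAt_id x₀).prodMk hσ)).const_add _
  · intro ξ h3 h4
    simp [hi, h3, h4, show ((0 : Z₁), (0 : Z₂)) = 0 from rfl]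
  · filter_upwards [hsol] with x hx
    simpa using hx

variable [FiniteDimensional ℝ E] [FiniteDimensional ℝ E₂]

/-- Data of a minimization problem `h ∘ F + m` near a critical point `x₀`, with local models of
`m` and `h` along manifolds `M` and `K` that satisfy transversality and sharpness. -/
structure CompositeProblem {k j : ℕ} (F : E → E₂) (h : E₂ → EReal) (m : E → EReal) (η μ : ℝ)
    (x₀ : E) (M : Set E) (K : Set E₂) (G : E → EuclideanSpace ℝ (Fin k))
    (H : E₂ → EuclideanSpace ℝ (Fin j)) (φ : E → ℝ) (χ : E₂ → ℝ) : Prop where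
  contDiff : ContDiff ℝ 2 F
  convex_h : ConvexUpTo 0 h
  lsc_h : LowerSemicontinuous h
  ne_bot_h : ∀ u, h u ≠ ⊥
  convex_m : ConvexUpTo μ m
  lsc_m : LowerSemicontinuous m
  ne_bot_m : ∀ x, m x ≠ ⊥
  mu_nonneg : 0 ≤ μ
  eta_pos : 0 < η
  mu_lt : μ < η⁻¹
  modelM : IsLocalModel m M x₀ G φ
  modelK : IsLocalModel h K (F x₀) H χ
  transversal : ∀ v : E₂, ∃ a b, fderiv ℝ G x₀ a = 0 ∧ fderiv ℝ H (F x₀) b = 0 ∧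
    fderiv ℝ F x₀ a + b = v
  sharp : ∃ c : ℝ, 0 < c ∧ ∀ᶠ q : E × E₂ in 𝓝 (x₀, F x₀), ¬ (q.1 ∈ M ∧ q.2 ∈ K) →
    ∀ z ∈ subdiff h q.2, ∀ w ∈ subdiff m q.1,
      c ≤ ‖ContinuousLinearMap.adjoint (fderiv ℝ F x₀) z + w‖
  critical : IsCriticalPoint (fun x => h (F x) + m x) x₀

namespace CompositeProblem

variable {k j : ℕ} {F : E → E₂} {h : E₂ → EReal} {m : E → EReal} {η μ : ℝ}
    {x₀ : E} {M : Set E} {K : Set E₂} {G : E → EuclideanSpace ℝ (Fin k)}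
    {H : E₂ → EuclideanSpace ℝ (Fin j)} {φ : E → ℝ} {χ : E₂ → ℝ}

lemma surjective_constraint (P : CompositeProblem F h m η μ x₀ M K G H φ χ) :
    Function.Surjective ((fderiv ℝ G x₀).prod (fderiv ℝ H (F x₀) ∘L fderiv ℝ F x₀)) :=
  surjective_prod_of_transversal P.modelM.surjective P.modelK.surjective P.transversal

lemma kappa_pos (P : CompositeProblem F h m η μ x₀ M K G H φ χ) : 0 < η⁻¹ - μ :=
  sub_pos.2 P.mu_lt

/-- Feasible points for the perturbed linearized constraints. -/
lemma exists_feasible (P : CompositeProblem F h m η μ x₀ M K G H φ χ) :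
    ∃ (Y : E₂ × E × E → E) (Y' : E₂ × E × E →L[ℝ] E), Y (0, x₀, 0) = x₀ ∧
      HasFDerivAt Y Y' (0, x₀, 0) ∧
      (∀ ξ a, fderiv ℝ G x₀ a = 0 → fderiv ℝ H (F x₀) (fderiv ℝ F x₀ a) = 0 →
        Y' (0, ξ, a) = a) ∧
      ∀ᶠ q in 𝓝 ((0 : E₂), x₀, (0 : E)), G (Y q) = 0 ∧ H (linModel F q.2.1 (Y q) + q.1) = 0 := by
  -- The parameters are a perturbation of the inner argument, the model centre and the prescribed
  -- displacement, in this order.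
  let pr : (E₂ × E × E) × E →L[ℝ] E × E :=
    (ContinuousLinearMap.fst ℝ E E ∘L ContinuousLinearMap.snd ℝ E₂ (E × E) ∘L
      ContinuousLinearMap.fst ℝ (E₂ × E × E) E).prod (ContinuousLinearMap.snd ℝ (E₂ × E × E) E)
  let pe : (E₂ × E × E) × E →L[ℝ] E₂ :=
    ContinuousLinearMap.fst ℝ E₂ (E × E) ∘L ContinuousLinearMap.fst ℝ (E₂ × E × E) E
  have hJ : HasStrictFDerivAt
      (fun q : (E₂ × E × E) × E => linModel F q.1.2.1 q.2 + q.1.1)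
      ((fderiv ℝ F x₀ ∘L .snd ℝ E E) ∘L pr + pe) ((0, x₀, 0), x₀) :=
    (HasStrictFDerivAt.comp ((0, x₀, 0), x₀) (g := fun q : E × E => linModel F q.1 q.2) (f := pr)
      (hasStrictFDerivAt_linModel P.contDiff x₀) pr.hasStrictFDerivAt).add pe.hasStrictFDerivAt
  have hJ0 : linModel F x₀ x₀ + 0 = F x₀ := by simp [linModel]
  obtain ⟨Y, Y', h1, h2, h3, h4⟩ := exists_feasible_solution
    (ContinuousLinearMap.snd ℝ E E ∘L ContinuousLinearMap.snd ℝ E₂ (E × E)) hJ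
    P.modelM.hasStrictFDerivAt (by simpa only [hJ0] using P.modelK.hasStrictFDerivAt)
    P.modelM.eq_zero (by simpa only [hJ0] using P.modelK.eq_zero)
    (by
      rw [show ((fderiv ℝ F x₀ ∘L .snd ℝ E E) ∘L pr + pe) ∘L .inr ℝ (E₂ × E × E) E =
        fderiv ℝ F x₀ by ext; simp [pr, pe]]
      exact P.surjective_constraint)
  refine ⟨Y, Y', h1, h2, fun ξ a ha hb => ?_, h4⟩
  have := h3 (0, ξ, a) (by simpa using ha) (by simpa [pr, pe] using hb)
  simpa using this

/-- At a critical point the convex model has minimal value at `x₀`. -/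
lemma model_minimal (P : CompositeProblem F h m η μ x₀ M K G H φ χ) {y : E} {α β : ℝ}
    (hα : h (linModel F x₀ y) ≤ α) (hβ : m y ≤ β) :
    χ (F x₀) + φ x₀ ≤ α + β + μ / 2 * ‖y - x₀‖ ^ 2 := by
  set u := linModel F x₀ y with hu
  -- Chosen so that `(1 - t) • J (t, q) + t • u = F ((1 - t) • q + t • y)`: convexity of `h` applies
  -- to the true `F` at the combined point. The `t`-derivative at `(0, x₀)` is `F x₀ + F' (y - x₀) -
  -- u = 0`.
  let J : ℝ × E → E₂ := fun q => (1 - q.1)⁻¹ • (F ((1 - q.1) • q.2 + q.1 • y) - q.1 • u)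
  have hJ0 : J (0, x₀) = F x₀ := by simp [J]
  have hJ' : HasStrictFDerivAt J (fderiv ℝ F x₀ ∘L .snd ℝ ℝ E) (0, x₀) := by
    have hc : ContDiffAt ℝ 1 J (0, x₀) := by
      have hF1 : ContDiff ℝ 1 F := P.contDiff.of_le (by norm_num)
      refine ContDiffAt.smul (ContDiffAt.inv (by fun_prop) (by simp)) ?_
      exact (ContDiff.sub (hF1.comp (by fun_prop)) (by fun_prop)).contDiffAt
    refine hc.hasStrictFDerivAt' ?_ (by simp)
    have h3 : HasFDerivAt (fun q : ℝ × E => q.1) (ContinuousLinearMap.fst ℝ ℝ E) (0, x₀) :=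
      hasFDerivAt_fst
    have h4 : HasFDerivAt (fun q : ℝ × E => q.2) (ContinuousLinearMap.snd ℝ ℝ E) (0, x₀) :=
      hasFDerivAt_snd
    have h5 := h3.const_sub 1
    have h6 : HasFDerivAt (fun q : ℝ × E => (1 - q.1) • q.2 + q.1 • y) _ (0, x₀) :=
      (h5.smul h4).add (h3.smul_const y)
    have h1 : HasFDerivAt F (fderiv ℝ F x₀) ((1 - ((0 : ℝ), x₀).1) • ((0 : ℝ), x₀).2 +
        ((0 : ℝ), x₀).1 • y) := by
      simpa using (P.contDiff.differentiable (by simp) x₀).hasFDerivAt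
    have h7 := (HasFDerivAt.comp ((0 : ℝ), x₀) h1 h6).sub (h3.smul_const u)
    have h8 : HasFDerivAt (fun q : ℝ × E => (1 - q.1)⁻¹) _ (0, x₀) :=
      (hasDerivAt_inv (x := (1 - ((0 : ℝ), x₀).1)) (by simp)).comp_hasFDerivAt (0, x₀) h5
    refine (h8.smul h7).congr_fderiv ?_
    ext v
    · simp [hu, linModel]; abel
    · simp
  obtain ⟨Y, Y', hY0, hY, hY', hsol⟩ := exists_feasible_solution (0 : ℝ →L[ℝ] E) hJ'
    P.modelM.hasStrictFDerivAt (by simpa only [hJ0] using P.modelK.hasStrictFDerivAt)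
    P.modelM.eq_zero (by simpa only [hJ0] using P.modelK.eq_zero)
    (by
      rw [show (fderiv ℝ F x₀ ∘L .snd ℝ ℝ E) ∘L .inr ℝ ℝ E = fderiv ℝ F x₀ by ext; simp]
      exact P.surjective_constraint)
  have hY'0 : Y' = 0 := by
    ext; simpa using hY' 1 (by simp) (by simp)
  subst hY'0
  have hYd : HasDerivAt Y 0 0 := by simpa using hY.hasDerivAt
  have hYc : Tendsto Y (𝓝 0) (𝓝 x₀) := by simpa [hY0] using hYd.continuousAt.tendsto
  have hJc : Tendsto (fun t => J (t, Y t)) (𝓝 0) (𝓝 (F x₀)) := by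
    have h1 : Tendsto (fun t : ℝ => (t, Y t)) (𝓝 0) (𝓝 (0, x₀)) := by
      rw [nhds_prod_eq]; exact tendsto_id.prodMk hYc
    have h2 := hJ'.hasFDerivAt.continuousAt.tendsto.comp h1
    rwa [hJ0] at h2
  -- derivatives of the two smooth terms along the curve vanish
  have hφd : HasDerivAt (fun t => φ (Y t)) 0 0 := by
    have h1 := P.modelM.hasFDerivAt
    rw [← hY0] at h1
    simpa [Function.comp_def] using h1.comp_hasDerivAt 0 hYd
  have hJd : HasDerivAt (fun t => J (t, Y t)) 0 0 := by
    have h1 : HasDerivAt (fun t : ℝ => (t, Y t)) (1, 0) 0 := (hasDerivAt_id (0 : ℝ)).prodMk hYd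
    have h2 := hJ'.hasFDerivAt
    rw [← hY0] at h2
    simpa [Function.comp_def] using HasFDerivAt.comp_hasDerivAt (l := J) 0 h2 h1
  have hχd : HasDerivAt (fun t => χ (J (t, Y t))) 0 0 := by
    have h1 := P.modelK.hasFDerivAt
    have h2 : J (0, Y 0) = F x₀ := by rw [hY0, hJ0]
    rw [← h2] at h1
    simpa [Function.comp_def] using h1.comp_hasDerivAt 0 hJd
  -- the test curve
  set X : ℝ → E := fun t => (1 - t) • Y t + t • y with hX
  have hXd : HasDerivAt X (y - x₀) 0 := by
    have h1 : HasDerivAt (fun t : ℝ => 1 - t) (-1) 0 := by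
      simpa using (hasDerivAt_id (0 : ℝ)).const_sub 1
    have h2 := (h1.smul hYd).add ((hasDerivAt_id (0 : ℝ)).smul_const y)
    refine h2.congr_deriv ?_
    simp [hY0]; abel
  have hX0 : X 0 = x₀ := by simp [hX, hY0]
  have hXc : Tendsto X (𝓝 0) (𝓝 x₀) := by simpa [hX0] using hXd.continuousAt.tendsto
  have hval : ∀ᶠ t : ℝ in 𝓝[>] 0, h (F (X t)) + m (X t) ≤
      (((1 - t) * (χ (J (t, Y t)) + φ (Y t)) + t * (α + β)
        + μ / 2 * ((1 - t) * t) * ‖Y t - y‖ ^ 2 : ℝ) : EReal) := by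
    have e1 := (hsol.and ((hYc.eventually P.modelM.eq_on).and
      (hJc.eventually P.modelK.eq_on))).filter_mono (nhdsWithin_le_nhds (s := Set.Ioi 0))
    filter_upwards [e1, Ioo_mem_nhdsGT (show (0 : ℝ) < 1 by norm_num)] with t ht ht01
    obtain ⟨⟨h1, h2⟩, h3, h4⟩ := ht
    have hm := P.convex_m (h3 h1).le hβ (sub_nonneg.2 ht01.2.le) ht01.1.le (by ring)
    have hh := P.convex_h (h4 h2).le hα (sub_nonneg.2 ht01.2.le) ht01.1.le (by ring)
    have hne : (1 - t) ≠ 0 := (sub_pos.2 ht01.2).ne'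
    have hJX : (1 - t) • J (t, Y t) + t • u = F (X t) := by
      simp only [J, hX, smul_smul, mul_inv_cancel₀ hne, one_smul]; abel
    rw [hJX] at hh
    refine (add_le_add hh hm).trans ?_
    rw [← EReal.coe_add]
    exact EReal.coe_le_coe_iff.2 (le_of_eq (by ring))
  have hf0 : h (F x₀) + m x₀ = ((χ (F x₀) + φ x₀ : ℝ) : EReal) := by
    rw [P.modelM.apply_self, P.modelK.apply_self, EReal.coe_add]
  set B : ℝ → ℝ := fun t => (1 - t) * (χ (J (t, Y t)) + φ (Y t)) + t * (α + β)
        + μ / 2 * ((1 - t) * t) * ‖Y t - y‖ ^ 2 with hB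
  have hBd : HasDerivAt B (-(χ (F x₀) + φ x₀) + (α + β) + μ / 2 * ‖x₀ - y‖ ^ 2) 0 := by
    have h1 : HasDerivAt (fun t : ℝ => 1 - t) (-1) 0 := by
      simpa using (hasDerivAt_id (0 : ℝ)).const_sub 1
    have h2 : HasDerivAt (fun t : ℝ => t) 1 0 := hasDerivAt_id 0
    have h3 := ((h1.mul (hχd.add hφd)).add (h2.mul_const (α + β))).add
      (((h1.mul h2).const_mul (μ / 2)).mul (hYd.sub_const y).norm_sq)
    refine h3.congr_deriv ?_
    simp [hY0, hJ0]
  have hs1 := hBd.tendsto_slope_zero_right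
  have hs2 := hXd.tendsto_slope_zero_right
  have hB0 : B 0 = χ (F x₀) + φ x₀ := by simp [hB, hY0, hJ0]
  -- Along `X`, criticality bounds the objective below with slope `-ε ‖y - x₀‖`, and `B` bounds it
  -- above; slopes at `0` are compared.
  have hkey : ∀ ε ∈ Set.Ioo (0 : ℝ) 1, -(ε * ‖y - x₀‖) ≤
      -(χ (F x₀) + φ x₀) + (α + β) + μ / 2 * ‖x₀ - y‖ ^ 2 := by
    intro ε hε
    refine le_of_tendsto_of_tendsto ((tendsto_const_nhds.mul hs2.norm).neg) hs1 ?_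
    have e2 := (hXc.eventually (P.critical.2.2 ε hε.1)).filter_mono
      (nhdsWithin_le_nhds (s := Set.Ioi 0))
    filter_upwards [hval, e2, self_mem_nhdsWithin] with t h1 h2 ht0
    have ht0 : 0 < t := ht0
    have h3 := h2.trans h1
    simp only [inner_zero_left, zero_sub] at h3
    rw [hf0, ← EReal.coe_add] at h3
    have h4 := EReal.coe_le_coe_iff.1 h3
    simp only [zero_add, hX0, hB0, norm_smul, Real.norm_eq_abs, smul_eq_mul,
      abs_of_pos (inv_pos.2 ht0)]
    rw [show -(ε * (t⁻¹ * ‖X t - x₀‖)) = t⁻¹ * (-(ε * ‖X t - x₀‖)) by ring]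
    exact mul_le_mul_of_nonneg_left (by simp only [hB]; linarith) (inv_pos.2 ht0).le
  rw [norm_sub_rev y x₀]
  refine le_of_forall_Ioo_le_add_mul (Y := ‖y - x₀‖) fun t ht => ?_
  linarith [hkey t ht]

end CompositeProblem

end Composite

/-! ### Primal-dual solutions of the subproblems -/

section Composite

variable {E E₂ : Type*} [NormedAddCommGroup E] [InnerProductSpace ℝ E]
  [NormedAddCommGroup E₂] [InnerProductSpace ℝ E₂]

lemma linModel_eq_add (F : E → E₂) (x y : E) :
    linModel F x y = (F x - fderiv ℝ F x x) + fderiv ℝ F x y := by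
  rw [linModel, map_sub]; abel

lemma linModel_sub (F : E → E₂) (x y y' : E) :
    linModel F x y - linModel F x y' = fderiv ℝ F x (y - y') := by
  simp only [linModel_eq_add, map_sub]; abel

/-- A primal-dual solution of the convex subproblem with model centre `x` and proximal centre
`c`. -/
structure IsPrimalDual (F : E → E₂) (h : E₂ → EReal) (m : E → EReal) (η μ : ℝ) (x c y : E)
    (z : E₂) (α β : ℝ) : Prop where
  h_eq : h (linModel F x y) = α
  m_eq : m y = β
  growth : ∀ (y' : E) (α' β' : ℝ), h (linModel F x y') ≤ α' → m y' ≤ β' →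
    α + β + 1 / (2 * η) * ‖y - c‖ ^ 2 + (η⁻¹ - μ) / 2 * ‖y' - y‖ ^ 2 ≤
      α' + β' + 1 / (2 * η) * ‖y' - c‖ ^ 2
  h_le : ∀ (u : E₂) (α' : ℝ), h u ≤ α' → α + inner ℝ z (u - linModel F x y) ≤ α'
  m_le : ∀ (y' : E) (β' : ℝ), m y' ≤ β' → β - inner ℝ z (fderiv ℝ F x (y' - y))
    - η⁻¹ * inner ℝ (y - c) (y' - y) - 1 / (2 * η) * ‖y' - y‖ ^ 2 ≤ β'

lemma young_lower_bound {κ b D : ℝ} (hκ : 0 < κ) : -(b ^ 2 / (2 * κ)) ≤ κ / 2 * D ^ 2 - b * D := by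
  have h1 : 0 ≤ (κ * D - b) ^ 2 / (2 * κ) := by positivity
  have h2 : (κ * D - b) ^ 2 / (2 * κ) = κ / 2 * D ^ 2 - b * D + b ^ 2 / (2 * κ) := by
    field_simp; ring
  linarith

namespace CompositeProblem

variable [FiniteDimensional ℝ E] [FiniteDimensional ℝ E₂]
variable {k j : ℕ} {F : E → E₂} {h : E₂ → EReal} {m : E → EReal} {η μ : ℝ}
    {x₀ : E} {M : Set E} {K : Set E₂} {G : E → EuclideanSpace ℝ (Fin k)}
    {H : E₂ → EuclideanSpace ℝ (Fin j)} {φ : E → ℝ} {χ : E₂ → ℝ}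

lemma continuous_fderiv (P : CompositeProblem F h m η μ x₀ M K G H φ χ) :
    Continuous (fderiv ℝ F) := P.contDiff.continuous_fderiv (by simp)

lemma continuous_linModel (P : CompositeProblem F h m η μ x₀ M K G H φ χ) :
    Continuous fun q : E × E => linModel F q.1 q.2 :=
  (P.contDiff.continuous.comp continuous_fst).add
    ((P.continuous_fderiv.comp continuous_fst).clm_apply (continuous_snd.sub continuous_fst))

/-- Perturbed feasible points with uniformly bounded values. -/
lemma exists_bounded_feasible (P : CompositeProblem F h m η μ x₀ M K G H φ χ) :
    ∃ r > 0, ∀ x, ‖x - x₀‖ < r → ∀ e : E₂, ‖e‖ < r → ∃ (y : E) (α β : ℝ),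
      h (linModel F x y + e) ≤ α ∧ m y ≤ β ∧ α + β ≤ χ (F x₀) + φ x₀ + 2 ∧ ‖y - x₀‖ ≤ 1 := by
  obtain ⟨Y, Y', hY0, hY, -, hsol⟩ := P.exists_feasible
  have hYc : Tendsto Y (𝓝 (0, x₀, 0)) (𝓝 x₀) := by
    simpa only [hY0] using hY.continuousAt.tendsto
  have huc : Tendsto (fun q : E₂ × E × E => linModel F q.2.1 (Y q) + q.1) (𝓝 (0, x₀, 0))
      (𝓝 (F x₀)) := by
    have h1 : Tendsto (fun q : E₂ × E × E => (q.2.1, Y q)) (𝓝 (0, x₀, 0)) (𝓝 (x₀, x₀)) := by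
      refine Tendsto.prodMk_nhds ?_ hYc
      exact (continuous_fst.comp continuous_snd).tendsto ((0 : E₂), x₀, (0 : E))
    have h2 := ((P.continuous_linModel.tendsto (x₀, x₀)).comp h1).add
      (continuous_fst.tendsto ((0 : E₂), x₀, (0 : E)))
    simpa [linModel] using h2
  have hφ := (P.modelM.hasFDerivAt.continuousAt.tendsto.comp hYc).eventually
    (gt_mem_nhds (lt_add_one _))
  have hχ := (P.modelK.hasFDerivAt.continuousAt.tendsto.comp huc).eventually
    (gt_mem_nhds (lt_add_one _))
  have hball := hYc.eventually (Metric.closedBall_mem_nhds x₀ one_pos)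
  obtain ⟨r, hr, hr'⟩ := Metric.eventually_nhds_iff.1 (hsol.and ((hYc.eventually P.modelM.eq_on).and
    ((huc.eventually P.modelK.eq_on).and (hφ.and (hχ.and hball)))))
  refine ⟨r, hr, fun x hx e he => ?_⟩
  obtain ⟨⟨h1, h2⟩, h3, h4, h5, h6, h7⟩ := hr' (y := (e, x, 0)) (by
    simp [dist_eq_norm, hx, he])
  refine ⟨Y (e, x, 0), _, _, (h4 h2).le, (h3 h1).le, ?_, by simpa [dist_eq_norm] using h7⟩
  simp only [Function.comp_apply] at h5 h6
  linarith

/-- Multipliers at the critical point. -/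
lemma exists_base_multiplier (P : CompositeProblem F h m η μ x₀ M K G H φ χ) :
    ∃ z₀ : E₂, (∀ (u : E₂) (α : ℝ), h u ≤ α → χ (F x₀) + inner ℝ z₀ (u - F x₀) ≤ α) ∧
      ∀ (y : E) (β : ℝ), m y ≤ β →
        φ x₀ - inner ℝ z₀ (fderiv ℝ F x₀ (y - x₀)) - μ / 2 * ‖y - x₀‖ ^ 2 ≤ β := by
  obtain ⟨r, hr, hfeas⟩ := P.exists_bounded_feasible
  have hk : ConvexUpTo 0 fun y => m y + ((μ / 2 * ‖y - x₀‖ ^ 2 : ℝ) : EReal) := by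
    have := P.convex_m.add (convexUpTo_quadratic (μ / 2) x₀) P.ne_bot_m
      (fun _ => EReal.coe_ne_bot _)
    convert! this using 1; ring
  have hlin : linModel F x₀ x₀ = F x₀ := by simp [linModel]
  -- Criticality enters through `model_minimal`: adding `μ / 2 ‖· - x₀‖²` makes the model convex and
  -- minimal at `x₀`. The `μ / 2` in `C` bounds that term within distance one of `x₀`.
  obtain ⟨z, -, hz⟩ := exists_multiplier P.convex_h hk (fderiv ℝ F x₀)
    (F x₀ - fderiv ℝ F x₀ x₀) (v := χ (F x₀) + φ x₀) (C := χ (F x₀) + φ x₀ + 2 + μ / 2) hr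
    (fun y α β hα hβ => by
      rw [← linModel_eq_add] at hα
      obtain ⟨b, c, h1, h2, h3⟩ := EReal.exists_coe_of_add_le (P.ne_bot_m y)
        (EReal.coe_ne_bot _) hβ
      have := P.model_minimal hα h1.le
      have := EReal.coe_injective h2
      linarith)
    (fun e he => by
      obtain ⟨y, α, β, h1, h2, h3, h4⟩ := hfeas x₀ (by simpa using hr) e he
      refine ⟨y, α, β + μ / 2 * ‖y - x₀‖ ^ 2, by rwa [← linModel_eq_add], ?_, ?_⟩
      · rw [EReal.coe_add]; gcongr
      · have h5 : ‖y - x₀‖ ^ 2 ≤ 1 := pow_le_one₀ (norm_nonneg _) h4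
        have := mul_le_mul_of_nonneg_left h5 (div_nonneg P.mu_nonneg zero_le_two)
        linarith)
  refine ⟨z, fun u α hα => ?_, fun y β hβ => ?_⟩
  · have := hz x₀ u α (φ x₀) hα (by simp [P.modelM.apply_self])
    rw [← linModel_eq_add, hlin] at this
    linarith
  · have := hz y (F x₀) (χ (F x₀)) (β + μ / 2 * ‖y - x₀‖ ^ 2) P.modelK.apply_self.le (by
      rw [EReal.coe_add]; gcongr)
    rw [← linModel_eq_add, ← hlin, linModel_sub, ← neg_sub y x₀, map_neg, inner_neg_right,
      hlin] at this
    linarith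

-- Adding the two base multiplier inequalities at a displaced model centre cancels `⟪z₀, F' x₀ (y -
-- x₀)⟫`; only the variation of `F'` and the weak convexity of `m` remain as errors.
omit [FiniteDimensional ℝ E] [FiniteDimensional ℝ E₂] in
lemma lower_bound {z₀ : E₂}
    (hz₀ : ∀ (u : E₂) (α : ℝ), h u ≤ α → χ (F x₀) + inner ℝ z₀ (u - F x₀) ≤ α)
    (hw₀ : ∀ (y : E) (β : ℝ), m y ≤ β →
      φ x₀ - inner ℝ z₀ (fderiv ℝ F x₀ (y - x₀)) - μ / 2 * ‖y - x₀‖ ^ 2 ≤ β)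
    {x y : E} {α β : ℝ} (hα : h (linModel F x y) ≤ α) (hβ : m y ≤ β) :
    χ (F x₀) + φ x₀ + inner ℝ z₀ (linModel F x x₀ - F x₀)
      + inner ℝ z₀ ((fderiv ℝ F x - fderiv ℝ F x₀) (y - x₀)) - μ / 2 * ‖y - x₀‖ ^ 2 ≤ α + β := by
  have h1 := hz₀ _ _ hα
  have h2 := hw₀ _ _ hβ
  have h3 : linModel F x y - F x₀ = (linModel F x x₀ - F x₀) + fderiv ℝ F x (y - x₀) := by
    rw [← linModel_sub F x y x₀]; abel
  rw [h3, inner_add_right] at h1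
  rw [sub_apply, inner_sub_right z₀ (fderiv ℝ F x (y - x₀))]
  linarith

/-- The subproblems near the critical point have primal-dual solutions, with bounded
multipliers. -/
lemma exists_primalDual (P : CompositeProblem F h m η μ x₀ M K G H φ χ) :
    ∃ Z : ℝ, ∀ᶠ p : E × E in 𝓝 0, ∃ (y : E) (z : E₂) (α β : ℝ),
      IsPrimalDual F h m η μ (x₀ + p.1) (x₀ + p.2) y z α β ∧ ‖z‖ ≤ Z := by
  obtain ⟨r, hr, hfeas⟩ := P.exists_bounded_feasible
  obtain ⟨z₀, hz₀, hw₀⟩ := P.exists_base_multiplier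
  have hκ := P.kappa_pos
  have hη := P.eta_pos
  -- `C` bounds the subproblem at feasible competitors, for which `‖y' - c‖ ≤ 2`; `V` bounds its
  -- optimal value below, by `lower_bound` and Young's inequality. The gap between them bounds the
  -- multipliers.
  set C : ℝ := χ (F x₀) + φ x₀ + 2 + 1 / (2 * η) * 4
  set V : ℝ := χ (F x₀) + φ x₀ - ‖z₀‖ - (‖z₀‖ + η⁻¹) ^ 2 / (2 * (η⁻¹ - μ))
  refine ⟨2 * (C + 1 - V) / r, ?_⟩
  have ht : Tendsto (fun p : E × E => x₀ + p.1) (𝓝 0) (𝓝 x₀) := by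
    have : Tendsto (fun p : E × E => x₀ + p.1) (𝓝 0) (𝓝 (x₀ + (0 : E × E).1)) :=
      Continuous.tendsto (by fun_prop) 0
    simpa using this
  have e1 : ∀ᶠ p : E × E in 𝓝 0, ‖linModel F (x₀ + p.1) x₀ - F x₀‖ < 1 := by
    have h1 : Tendsto (fun p : E × E => (x₀ + p.1, x₀)) (𝓝 0) (𝓝 (x₀, x₀)) :=
      ht.prodMk_nhds tendsto_const_nhds
    have h2 := (((P.continuous_linModel.tendsto (x₀, x₀)).comp h1).sub_const (F x₀)).norm
    simp only [linModel, sub_self, map_zero, add_zero, norm_zero] at h2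
    exact h2.eventually (gt_mem_nhds one_pos)
  have e2 : ∀ᶠ p : E × E in 𝓝 0, ‖fderiv ℝ F (x₀ + p.1) - fderiv ℝ F x₀‖ < 1 := by
    have h2 := (((P.continuous_fderiv.tendsto x₀).comp ht).sub_const (fderiv ℝ F x₀)).norm
    simp only [sub_self, norm_zero] at h2
    exact h2.eventually (gt_mem_nhds one_pos)
  filter_upwards [e1, e2, Metric.ball_mem_nhds (0 : E × E) (lt_min one_pos hr)] with p h1 h2 h3
  rw [mem_ball_zero_iff, lt_min_iff] at h3
  set x := x₀ + p.1 with hx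
  set c := x₀ + p.2 with hc
  have hxr : ‖x - x₀‖ < r := by
    rw [hx, add_sub_cancel_left]; exact (norm_fst_le p).trans_lt h3.2
  have hc1 : ‖p.2‖ ≤ 1 := (norm_snd_le p).trans h3.1.le
  have hkc : ConvexUpTo (-(η⁻¹ - μ)) fun y => m y + ((1 / (2 * η) * ‖y - c‖ ^ 2 : ℝ) : EReal) := by
    have := P.convex_m.add (convexUpTo_quadratic (1 / (2 * η)) c) P.ne_bot_m
      (fun _ => EReal.coe_ne_bot _)
    convert! this using 1
    field_simp; ring
  have hhc : ConvexUpTo 0 fun y => h (linModel F x y) := by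
    simp only [linModel_eq_add]
    exact P.convex_h.comp_affine _ _
  have hconv := hhc.add hkc (fun y => P.ne_bot_h _)
    (fun y => EReal.add_coe_ne_bot (P.ne_bot_m y) _)
  rw [zero_add] at hconv
  have hlinc : Continuous fun y => linModel F x y :=
    P.continuous_linModel.comp (continuous_const.prodMk continuous_id)
  have hlsc : LowerSemicontinuous fun y => h (linModel F x y) +
      (m y + ((1 / (2 * η) * ‖y - c‖ ^ 2 : ℝ) : EReal)) := by
    have hl1 : LowerSemicontinuous fun y => h (linModel F x y) := P.lsc_h.comp hlinc
    refine hl1.add' (P.lsc_m.add_coe (by fun_prop)) fun y => ?_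
    exact EReal.continuousAt_add (Or.inr (EReal.add_coe_ne_bot (P.ne_bot_m y) _))
      (Or.inl (P.ne_bot_h _))
  obtain ⟨y₁, α₁, β₁, hα₁, hβ₁, -⟩ := hfeas x hxr 0 (by simpa using hr)
  rw [add_zero] at hα₁
  obtain ⟨y, v, hv, hgrow⟩ := hconv.exists_minimizer hκ hlsc
    (fun y => by
      rw [ne_eq, EReal.add_eq_bot_iff, not_or]
      exact ⟨P.ne_bot_h _, EReal.add_coe_ne_bot (P.ne_bot_m y) _⟩)
    (x₀ := y₁) (by
      refine EReal.add_ne_top (ne_top_of_le_ne_top (EReal.coe_ne_top _) hα₁) ?_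
      exact EReal.add_ne_top (ne_top_of_le_ne_top (EReal.coe_ne_top _) hβ₁) (EReal.coe_ne_top _))
  obtain ⟨α, b, hα, hb, -⟩ := EReal.exists_coe_of_add_le (P.ne_bot_h _)
    (EReal.add_coe_ne_bot (P.ne_bot_m y) _) hv.le
  obtain ⟨β, b', hβ, hb', -⟩ := EReal.exists_coe_of_add_le (P.ne_bot_m y)
    (EReal.coe_ne_bot _) hb.le
  have hv' : v = α + β + 1 / (2 * η) * ‖y - c‖ ^ 2 := by
    simp only [hα, hβ] at hv
    have : ((α + (β + 1 / (2 * η) * ‖y - c‖ ^ 2) : ℝ) : EReal) = v := by exact_mod_cast hv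
    rw [← EReal.coe_injective this]; ring
  have hgrowth : ∀ (y' : E) (α' β' : ℝ), h (linModel F x y') ≤ α' → m y' ≤ β' →
      α + β + 1 / (2 * η) * ‖y - c‖ ^ 2 + (η⁻¹ - μ) / 2 * ‖y' - y‖ ^ 2 ≤
        α' + β' + 1 / (2 * η) * ‖y' - c‖ ^ 2 := by
    intro y' α' β' h4 h5
    have h6 : h (linModel F x y') + (m y' + ((1 / (2 * η) * ‖y' - c‖ ^ 2 : ℝ) : EReal)) ≤
        ((α' + (β' + 1 / (2 * η) * ‖y' - c‖ ^ 2) : ℝ) : EReal) := by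
      rw [EReal.coe_add, EReal.coe_add]; gcongr
    have := EReal.coe_le_coe_iff.1 ((hgrow y').trans h6)
    rw [hv'] at this
    linarith
  obtain ⟨z, hzZ, hz⟩ := exists_multiplier P.convex_h (hkc.mono (by linarith)) (fderiv ℝ F x)
    (F x - fderiv ℝ F x x) (v := α + β + 1 / (2 * η) * ‖y - c‖ ^ 2) (C := C) hr
    (fun y' α' b hα' hb => by
      rw [← linModel_eq_add] at hα'
      obtain ⟨β', c', h4, h5, h6⟩ := EReal.exists_coe_of_add_le (P.ne_bot_m y')
        (EReal.coe_ne_bot _) hb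
      have h7 := hgrowth y' α' β' hα' h4.le
      have h8 := EReal.coe_injective h5
      have : 0 ≤ (η⁻¹ - μ) / 2 * ‖y' - y‖ ^ 2 := by positivity
      linarith)
    (fun e he => by
      obtain ⟨y', α', β', h4, h5, h6, h7⟩ := hfeas x hxr e he
      refine ⟨y', α', β' + 1 / (2 * η) * ‖y' - c‖ ^ 2, by rwa [← linModel_eq_add], ?_, ?_⟩
      · rw [EReal.coe_add]; gcongr
      · have h8 : ‖y' - c‖ ≤ 2 := by
          rw [hc, ← sub_sub]
          exact (norm_sub_le _ _).trans (by linarith)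
        have h9 : ‖y' - c‖ ^ 2 ≤ 4 := by nlinarith [norm_nonneg (y' - c)]
        have := mul_le_mul_of_nonneg_left h9 (show 0 ≤ 1 / (2 * η) by positivity)
        simp only [C]
        linarith)
  refine ⟨y, z, α, β, ⟨hα, hβ, hgrowth, fun u α' hu => ?_, fun y' β' hy' => ?_⟩, ?_⟩
  · have := hz y u α' (β + 1 / (2 * η) * ‖y - c‖ ^ 2) hu (by rw [hβ, EReal.coe_add])
    rw [← linModel_eq_add] at this
    linarith
  · have := hz y' (linModel F x y) α (β' + 1 / (2 * η) * ‖y' - c‖ ^ 2) hα.le (by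
      rw [EReal.coe_add]; gcongr)
    rw [← linModel_eq_add, linModel_sub, ← neg_sub y' y, map_neg, inner_neg_right] at this
    have h4 : ‖y' - c‖ ^ 2 = ‖y' - y‖ ^ 2 + 2 * inner ℝ (y - c) (y' - y) + ‖y - c‖ ^ 2 := by
      rw [show y' - c = (y' - y) + (y - c) by abel, norm_add_sq_real, real_inner_comm]
    rw [h4] at this
    have h5 : 1 / (2 * η) * (2 * inner ℝ (y - c) (y' - y)) = η⁻¹ * inner ℝ (y - c) (y' - y) := by
      field_simp
    linarith
  · rw [le_div_iff₀ hr]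
    refine hzZ.trans ?_
    have hlow := lower_bound hz₀ hw₀ hα.le hβ.le
    have h4 := abs_le.1 (abs_real_inner_le_norm z₀ (linModel F x x₀ - F x₀))
    have h5 := abs_le.1 (abs_real_inner_le_norm z₀ ((fderiv ℝ F x - fderiv ℝ F x₀) (y - x₀)))
    have h6 : ‖(fderiv ℝ F x - fderiv ℝ F x₀) (y - x₀)‖ ≤ 1 * ‖y - x₀‖ :=
      (ContinuousLinearMap.le_opNorm _ _).trans (by gcongr)
    have h7 := mul_le_mul_of_nonneg_left h6 (norm_nonneg z₀)
    have h8 := mul_le_mul_of_nonneg_left h1.le (norm_nonneg z₀)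
    have h9 : ‖y - c‖ ^ 2 ≥ ‖y - x₀‖ ^ 2 - 2 * ‖y - x₀‖ := by
      rw [hc, ← sub_sub, norm_sub_sq_real]
      have h10 := real_inner_le_norm (y - x₀) p.2
      have h11 := mul_le_mul_of_nonneg_left hc1 (norm_nonneg (y - x₀))
      nlinarith [sq_nonneg ‖p.2‖]
    have h10 := mul_le_mul_of_nonneg_left h9 (show 0 ≤ 1 / (2 * η) by positivity)
    have h11 := young_lower_bound (b := ‖z₀‖ + η⁻¹) (D := ‖y - x₀‖) hκ
    have h12 : 1 / (2 * η) * (‖y - x₀‖ ^ 2 - 2 * ‖y - x₀‖) =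
        η⁻¹ / 2 * ‖y - x₀‖ ^ 2 - η⁻¹ * ‖y - x₀‖ := by field_simp
    have h13 : V ≤ α + β + 1 / (2 * η) * ‖y - c‖ ^ 2 := by
      simp only [V]
      linarith
    linarith

end CompositeProblem

end Composite

/-! ### Second-order expansion of the subproblem -/

section Expansion

variable {E E₂ : Type*} [NormedAddCommGroup E] [InnerProductSpace ℝ E]
  [NormedAddCommGroup E₂] [InnerProductSpace ℝ E₂] {ι : Type*} {l : Filter ι}

lemma ContDiffAt.taylor_two_comp {X Y : Type*} [NormedAddCommGroup X] [NormedSpace ℝ X]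
    [NormedAddCommGroup Y] [NormedSpace ℝ Y] {f : X → Y} {x₀ : X}
    (hf : ContDiffAt ℝ 2 f x₀) {d : ι → X} {g : ι → ℝ} (hg : Tendsto g l (𝓝 0))
    (hd : d =O[l] g) :
    (fun i => f (x₀ + d i) - f x₀ - fderiv ℝ f x₀ (d i)
      - (1 / 2 : ℝ) • fderiv ℝ (fderiv ℝ f) x₀ (d i) (d i)) =o[l] fun i => g i ^ 2 := by
  have hd0 : Tendsto d l (𝓝 0) := hd.trans_tendsto hg
  have h1 : Tendsto (fun i => x₀ + d i) l (𝓝 x₀) := by simpa using tendsto_const_nhds.add hd0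
  have h2 := hf.taylor_two.comp_tendsto h1
  simp only [Function.comp_def, add_sub_cancel_left] at h2
  exact h2.trans_isBigO (hd.norm_left.pow 2)

lemma isLittleO_fderiv_sub {X Y : Type*} [NormedAddCommGroup X] [NormedSpace ℝ X]
    [NormedAddCommGroup Y] [NormedSpace ℝ Y] {F : X → Y} (hF : ContDiff ℝ 2 F) {x₀ : X}
    {ξ : ι → X} {g : ι → ℝ} (hg : Tendsto g l (𝓝 0)) (hξ : ξ =O[l] g) :
    (fun i => fderiv ℝ F (x₀ + ξ i) - fderiv ℝ F x₀ - fderiv ℝ (fderiv ℝ F) x₀ (ξ i))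
      =o[l] g := by
  have h0 : Tendsto ξ l (𝓝 0) := hξ.trans_tendsto hg
  have h1 : Tendsto (fun i => x₀ + ξ i) l (𝓝 x₀) := by simpa using tendsto_const_nhds.add h0
  have h2 : HasFDerivAt (fderiv ℝ F) (fderiv ℝ (fderiv ℝ F) x₀) x₀ :=
    ((hF.fderiv_right (m := 1) (by norm_num)).differentiable (by simp) x₀).hasFDerivAt
  have h3 := h2.isLittleO.comp_tendsto h1
  simp only [Function.comp_def, add_sub_cancel_left] at h3
  exact h3.trans_isBigO hξ

/-- Second order expansion of the inner model. -/
lemma isLittleO_linModel {F : E → E₂} (hF : ContDiff ℝ 2 F) {x₀ : E} {ξ d : ι → E} {g : ι → ℝ}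
    (hg : Tendsto g l (𝓝 0)) (hξ : ξ =O[l] g) (hd : d =O[l] g) :
    (fun i => linModel F (x₀ + ξ i) (x₀ + d i) - F x₀ - fderiv ℝ F x₀ (d i)
      - fderiv ℝ (fderiv ℝ F) x₀ (ξ i) (d i)
      + (1 / 2 : ℝ) • fderiv ℝ (fderiv ℝ F) x₀ (ξ i) (ξ i)) =o[l] fun i => g i ^ 2 := by
  -- Taylor expansion of `F` contributes `½ F'' ξ ξ`, and that of `F'` applied to `d - ξ`
  -- contributes `-F'' ξ ξ`; the net coefficient is `-½`.
  have h1 := hF.contDiffAt.taylor_two_comp (x₀ := x₀) hg hξ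
  have h2 := isLittleO_bilin (ContinuousLinearMap.id ℝ (E →L[ℝ] E₂))
    (isLittleO_fderiv_sub hF (x₀ := x₀) hg hξ) (hd.sub hξ)
  have h3 : (fun i => g i * g i) = fun i => g i ^ 2 := by funext i; ring
  rw [h3] at h2
  refine (h1.add h2).congr_left fun i => ?_
  have h4 : x₀ + d i - (x₀ + ξ i) = d i - ξ i := by abel
  simp only [linModel, h4, ContinuousLinearMap.id_apply, sub_apply, map_sub]
  module

lemma isBigO_linModel {F : E → E₂} (hF : ContDiff ℝ 2 F) {x₀ : E} {ξ d : ι → E} {g : ι → ℝ}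
    (hg : Tendsto g l (𝓝 0)) (hξ : ξ =O[l] g) (hd : d =O[l] g) :
    (fun i => linModel F (x₀ + ξ i) (x₀ + d i) - F x₀ - fderiv ℝ F x₀ (d i))
      =O[l] fun i => g i ^ 2 := by
  have h1 := (isLittleO_linModel hF (x₀ := x₀) hg hξ hd).isBigO
  have h2 := isBigO_bilin (fderiv ℝ (fderiv ℝ F) x₀) hξ hd
  have h3 := (isBigO_bilin (fderiv ℝ (fderiv ℝ F) x₀) hξ hξ).const_smul_left (1 / 2 : ℝ)
  have h4 : (fun i => g i * g i) = fun i => g i ^ 2 := by funext i; ring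
  rw [h4] at h2 h3
  refine ((h1.add h2).sub h3).congr_left fun i => ?_
  simp only [Pi.smul_apply]
  abel

/-- The real inner product as a bilinear map. -/
noncomputable def realInnerCLM (E : Type*) [NormedAddCommGroup E] [InnerProductSpace ℝ E] :
    E →L[ℝ] E →L[ℝ] ℝ :=
  LinearMap.mkContinuous₂ (innerₗ E) 1 fun x y => by
    simpa using norm_inner_le_norm (𝕜 := ℝ) x y

@[simp] lemma realInnerCLM_apply (a b : E) : realInnerCLM E a b = inner ℝ a b := rfl

/-- The Hessian of the Lagrangian of the proximal subproblem. -/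
noncomputable def lagrangianHessian (F : E → E₂) (φ : E → ℝ) (χ : E₂ → ℝ) (η : ℝ) (x₀ : E) :
    E →L[ℝ] E →L[ℝ] ℝ :=
  fderiv ℝ (fderiv ℝ φ) x₀
    + (fderiv ℝ (fderiv ℝ χ) (F x₀)).bilinearComp (fderiv ℝ F x₀) (fderiv ℝ F x₀)
    + η⁻¹ • realInnerCLM E

lemma lagrangianHessian_apply (F : E → E₂) (φ : E → ℝ) (χ : E₂ → ℝ) (η : ℝ) (x₀ a b : E) :
    lagrangianHessian F φ χ η x₀ a b = fderiv ℝ (fderiv ℝ φ) x₀ a b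
      + fderiv ℝ (fderiv ℝ χ) (F x₀) (fderiv ℝ F x₀ a) (fderiv ℝ F x₀ b)
      + η⁻¹ * inner ℝ a b := by
  simp [lagrangianHessian]

lemma lagrangianHessian_symm {F : E → E₂} {φ : E → ℝ} {χ : E₂ → ℝ} {η : ℝ} {x₀ : E}
    (hφ : ContDiffAt ℝ 2 φ x₀) (hχ : ContDiffAt ℝ 2 χ (F x₀)) (a b : E) :
    lagrangianHessian F φ χ η x₀ a b = lagrangianHessian F φ χ η x₀ b a := by
  rw [lagrangianHessian_apply, lagrangianHessian_apply, real_inner_comm,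
    (hφ.isSymmSndFDerivAt (by simp)).eq, (hχ.isSymmSndFDerivAt (by simp)).eq]

/-- Dependence of the linear part of the subproblem on the model centre and the proximal
centre. -/
noncomputable def centreForm (F : E → E₂) (z₀ : E₂) (η : ℝ) (x₀ : E) :
    E × E →L[ℝ] E →L[ℝ] ℝ :=
  η⁻¹ • (realInnerCLM E ∘L ContinuousLinearMap.snd ℝ E E)
    - (ContinuousLinearMap.compL ℝ E E₂ ℝ (innerSL ℝ z₀)) ∘L fderiv ℝ (fderiv ℝ F) x₀ ∘L
      ContinuousLinearMap.fst ℝ E E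

lemma centreForm_apply (F : E → E₂) (z₀ : E₂) (η : ℝ) (x₀ : E) (p : E × E) (d : E) :
    centreForm F z₀ η x₀ p d =
      η⁻¹ * inner ℝ p.2 d - inner ℝ z₀ (fderiv ℝ (fderiv ℝ F) x₀ p.1 d) := by
  simp [centreForm]

/-- Second order expansion of the objective of the proximal subproblem. -/
lemma isLittleO_objective {F : E → E₂} (hF : ContDiff ℝ 2 F) {φ : E → ℝ} {χ : E₂ → ℝ} {η : ℝ}
    {x₀ : E} {z₀ : E₂} (hφ : ContDiffAt ℝ 2 φ x₀) (hχ : ContDiffAt ℝ 2 χ (F x₀))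
    (hφ' : fderiv ℝ φ x₀ = -(innerSL ℝ z₀ ∘L fderiv ℝ F x₀))
    (hχ' : fderiv ℝ χ (F x₀) = innerSL ℝ z₀) {ξ γ d : ι → E} {g : ι → ℝ}
    (hg : Tendsto g l (𝓝 0)) (hξ : ξ =O[l] g) (hd : d =O[l] g) :
    (fun i => φ (x₀ + d i) + χ (linModel F (x₀ + ξ i) (x₀ + d i))
        + 1 / (2 * η) * ‖d i - γ i‖ ^ 2
      - (χ (F x₀) + φ x₀ + (1 / 2 * lagrangianHessian F φ χ η x₀ (d i) (d i)
        - centreForm F z₀ η x₀ (ξ i, γ i) (d i)) + (1 / (2 * η) * ‖γ i‖ ^ 2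
        - 1 / 2 * inner ℝ z₀ (fderiv ℝ (fderiv ℝ F) x₀ (ξ i) (ξ i)))))
      =o[l] fun i => g i ^ 2 := by
  set A := fderiv ℝ F x₀ with hA
  set u : ι → E₂ := fun i => linModel F (x₀ + ξ i) (x₀ + d i) - F x₀ with hu
  have hgg : (fun i => g i * g i) = fun i => g i ^ 2 := by funext i; ring
  have hg2 : (fun i => g i ^ 2) =o[l] g := by
    have := (isBigO_refl g l).mul_isLittleO ((isLittleO_one_iff ℝ).2 hg)
    rw [hgg] at this
    simpa using this
  have hAd : (fun i => A (d i)) =O[l] g := (A.isBigO_comp d l).trans hd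
  have huA : (fun i => u i - A (d i)) =O[l] fun i => g i ^ 2 := isBigO_linModel hF hg hξ hd
  have hu' : u =O[l] g := by simpa using (huA.trans hg2.isBigO).add hAd
  have h1 := hφ.taylor_two_comp hg hd
  have h2 := hχ.taylor_two_comp hg hu'
  have h3 := isLittleO_linModel hF (x₀ := x₀) hg hξ hd
  have h4 : (fun i => inner ℝ z₀ (linModel F (x₀ + ξ i) (x₀ + d i) - F x₀ - A (d i)
      - fderiv ℝ (fderiv ℝ F) x₀ (ξ i) (d i)
      + (1 / 2 : ℝ) • fderiv ℝ (fderiv ℝ F) x₀ (ξ i) (ξ i))) =o[l] fun i => g i ^ 2 :=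
    ((innerSL ℝ z₀).isBigO_comp _ l).trans_isLittleO h3
  have huA' := huA.trans_isLittleO hg2
  have h5 := isLittleO_bilin (fderiv ℝ (fderiv ℝ χ) (F x₀)) huA' hu'
  have h6 := isLittleO_bilin (fderiv ℝ (fderiv ℝ χ) (F x₀)).flip huA' hAd
  rw [hgg] at h5 h6
  -- The first-order terms `-⟪z₀, A d⟫` of `φ` and `⟪z₀, u⟫` of `χ` cancel up to the second-order
  -- part of `u`, which supplies the `F''` terms. In the Hessian of `χ`, `h5` and `h6` replace `u`
  -- by `A d`.
  refine ((h1.add h2).add (h4.add ((h5.add h6).const_mul_left (1 / 2)))).congr_left fun i => ?_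
  have e1 : F x₀ + u i = linModel F (x₀ + ξ i) (x₀ + d i) := by simp only [hu]; abel
  rw [e1, hφ', hχ', lagrangianHessian_apply, centreForm_apply, norm_sub_sq_real, ← hA]
  have e2 : linModel F (x₀ + ξ i) (x₀ + d i) - F x₀ = u i := rfl
  rw [e2]
  have e3 : 1 / (2 * η) * (‖d i‖ ^ 2 - 2 * inner ℝ (d i) (γ i) + ‖γ i‖ ^ 2) =
      1 / 2 * (η⁻¹ * ‖d i‖ ^ 2) - η⁻¹ * inner ℝ (d i) (γ i) + 1 / (2 * η) * ‖γ i‖ ^ 2 := by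
    rw [show 1 / (2 * η) = 1 / 2 * η⁻¹ by rw [one_div, mul_inv, one_div]]; ring
  rw [e3, real_inner_self_eq_norm_sq, real_inner_comm (d i) (γ i)]
  simp only [neg_apply, ContinuousLinearMap.comp_apply, innerSL_apply_apply, inner_add_right,
    inner_sub_right, inner_smul_right, map_sub, sub_apply, ContinuousLinearMap.flip_apply,
    smul_eq_mul]
  ring

end Expansion

/-- Otherwise `n ≤ D` and `D² > (a + b + 1) n D ≥ a n² + b n D`. It turns an energy estimate into a
Lipschitz bound. -/
lemma le_of_sq_le_quadratic {a b n D : ℝ} (ha : 0 ≤ a) (hb : 0 ≤ b) (hn : 0 ≤ n)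
    (h : D ^ 2 ≤ a * n ^ 2 + b * (n * D)) : D ≤ (a + b + 1) * n := by
  by_contra! hlt
  have hab : 0 ≤ (a + b) * n := by positivity
  have hnD : n ≤ D := by linarith
  have hD0 : 0 < D := by linarith
  have h1 : a * n * n ≤ a * n * D := mul_le_mul_of_nonneg_left hnD (by positivity)
  have h2 := mul_lt_mul_of_pos_right hlt hD0
  have h3 : 0 ≤ n * D := by positivity
  linarith

/-! ### Stability of solutions and identification of the active manifolds -/

section SolutionMap

variable {E E₂ : Type*} [NormedAddCommGroup E] [InnerProductSpace ℝ E] [FiniteDimensional ℝ E]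
  [NormedAddCommGroup E₂] [InnerProductSpace ℝ E₂] [FiniteDimensional ℝ E₂]
  {k j : ℕ} {F : E → E₂} {h : E₂ → EReal} {m : E → EReal} {η μ : ℝ}
  {x₀ : E} {M : Set E} {K : Set E₂} {G : E → EuclideanSpace ℝ (Fin k)}
  {H : E₂ → EuclideanSpace ℝ (Fin j)} {φ : E → ℝ} {χ : E₂ → ℝ}

/-- Feasible competitors, tangential to a prescribed linear displacement. -/
lemma CompositeProblem.exists_competitor (P : CompositeProblem F h m η μ x₀ M K G H φ χ)
    {X : Type*} [NormedAddCommGroup X] [NormedSpace ℝ X] (Ξ D : X →L[ℝ] E)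
    (hDG : ∀ q, fderiv ℝ G x₀ (D q) = 0)
    (hDH : ∀ q, fderiv ℝ H (F x₀) (fderiv ℝ F x₀ (D q)) = 0) :
    ∃ d : X → E, (fun q => d q - D q) =o[𝓝 0] (fun q => ‖q‖) ∧ ∀ᶠ q in 𝓝 0,
      m (x₀ + d q) = φ (x₀ + d q) ∧
      h (linModel F (x₀ + Ξ q) (x₀ + d q)) = χ (linModel F (x₀ + Ξ q) (x₀ + d q)) := by
  obtain ⟨Y, Y', hY0, hY, hY', hsol⟩ := P.exists_feasible
  let i : X →L[ℝ] E₂ × E × E := (0 : X →L[ℝ] E₂).prod (Ξ.prod D)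
  have h1 : HasFDerivAt (fun q => ((0 : E₂), x₀, (0 : E)) + i q) i 0 := i.hasFDerivAt.const_add _
  have h2 : HasFDerivAt (fun q => Y (((0 : E₂), x₀, (0 : E)) + i q)) (Y' ∘L i) 0 := by
    refine HasFDerivAt.comp (g := Y) (0 : X) ?_ h1
    simpa using hY
  have hD : Y' ∘L i = D := by
    ext q
    exact hY' (Ξ q) (D q) (hDG q) (hDH q)
  rw [hD] at h2
  have ht : Tendsto (fun q => ((0 : E₂), x₀, (0 : E)) + i q) (𝓝 0) (𝓝 (0, x₀, 0)) := by
    simpa using h1.continuousAt.tendsto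
  have hYc : Tendsto (fun q => Y (((0 : E₂), x₀, (0 : E)) + i q)) (𝓝 0) (𝓝 x₀) := by
    simpa [hY0] using h2.continuousAt.tendsto
  have hxc : Tendsto (fun q => x₀ + Ξ q) (𝓝 0) (𝓝 x₀) := by
    have : Tendsto (fun q => x₀ + Ξ q) (𝓝 0) (𝓝 (x₀ + Ξ 0)) := Continuous.tendsto (by fun_prop) 0
    simpa using this
  have huc := (P.continuous_linModel.tendsto (x₀, x₀)).comp (hxc.prodMk_nhds hYc)
  simp only [linModel, sub_self, map_zero, add_zero] at huc
  refine ⟨fun q => Y (((0 : E₂), x₀, (0 : E)) + i q) - x₀, ?_, ?_⟩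
  · have h3 := h2.isLittleO.norm_right
    simpa [hY0] using h3
  · filter_upwards [ht.eventually hsol, hYc.eventually P.modelM.eq_on,
      huc.eventually P.modelK.eq_on] with q h3 h4 h5
    rw [add_sub_cancel]
    refine ⟨h4 h3.1, h5 ?_⟩
    simpa [i, linModel] using h3.2

/-- A family of primal-dual solutions near a critical point, with normalized local models. -/
structure SolutionFamily (F : E → E₂) (h : E₂ → EReal) (m : E → EReal) (η μ : ℝ)
    (x₀ : E) (M : Set E) (K : Set E₂) (G : E → EuclideanSpace ℝ (Fin k))
    (H : E₂ → EuclideanSpace ℝ (Fin j)) (φ : E → ℝ) (χ : E₂ → ℝ) (z₀ : E₂)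
    (y : E × E → E) (z : E × E → E₂) (α β : E × E → ℝ) : Prop where
  problem : CompositeProblem F h m η μ x₀ M K G H φ χ
  base_h : ∀ (u : E₂) (a : ℝ), h u ≤ a → χ (F x₀) + inner ℝ z₀ (u - F x₀) ≤ a
  base_m : ∀ (y : E) (b : ℝ), m y ≤ b →
    φ x₀ - inner ℝ z₀ (fderiv ℝ F x₀ (y - x₀)) - μ / 2 * ‖y - x₀‖ ^ 2 ≤ b
  fderiv_m : fderiv ℝ φ x₀ = -(innerSL ℝ z₀ ∘L fderiv ℝ F x₀)
  fderiv_h : fderiv ℝ χ (F x₀) = innerSL ℝ z₀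
  primalDual : ∀ᶠ p : E × E in 𝓝 0,
    IsPrimalDual F h m η μ (x₀ + p.1) (x₀ + p.2) (y p) (z p) (α p) (β p)
  bounded : ∃ Z : ℝ, ∀ᶠ p in 𝓝 0, ‖z p‖ ≤ Z

/-- The smooth models are replaced by ones with gradients `-F'ᵀ z₀` and `z₀`, so that the Lagrangian
is stationary in all directions and not only in tangential ones. Solutions are then chosen for each
parameter, with a dummy value where none is guaranteed. -/
lemma CompositeProblem.exists_solutionFamily
    (P : CompositeProblem F h m η μ x₀ M K G H φ χ) :
    ∃ φ' χ' z₀ y z α β, SolutionFamily F h m η μ x₀ M K G H φ' χ' z₀ y z α β := by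
  obtain ⟨z₀, hz₀, hw₀⟩ := P.exists_base_multiplier
  have hz₀' : z₀ ∈ subdiff h (F x₀) := by
    refine mem_subdiff_of_forall_le (C := 0) P.modelK.apply_self fun u =>
      EReal.coe_le_of_forall_real fun a ha => ?_
    simpa using hz₀ u a ha
  have hw₀' : -(ContinuousLinearMap.adjoint (fderiv ℝ F x₀) z₀) ∈ subdiff m x₀ := by
    refine mem_subdiff_of_forall_le (C := μ / 2) P.modelM.apply_self fun y =>
      EReal.coe_le_of_forall_real fun b hb => ?_
    rw [inner_neg_left, ContinuousLinearMap.adjoint_inner_left]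
    simpa [sub_eq_add_neg] using hw₀ y b hb
  obtain ⟨φ', hφ', hφ'd⟩ := P.modelM.exists_fderiv_eq hw₀'
  obtain ⟨χ', hχ', hχ'd⟩ := P.modelK.exists_fderiv_eq hz₀'
  have hφφ' : φ' x₀ = φ x₀ :=
    EReal.coe_injective (hφ'.apply_self.symm.trans P.modelM.apply_self)
  have hχχ' : χ' (F x₀) = χ (F x₀) :=
    EReal.coe_injective (hχ'.apply_self.symm.trans P.modelK.apply_self)
  obtain ⟨Z, hZ⟩ := P.exists_primalDual
  have hex : ∀ p : E × E, ∃ q : E × E₂ × ℝ × ℝ, (∃ (y : E) (z : E₂) (α β : ℝ),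
      IsPrimalDual F h m η μ (x₀ + p.1) (x₀ + p.2) y z α β ∧ ‖z‖ ≤ Z) →
      IsPrimalDual F h m η μ (x₀ + p.1) (x₀ + p.2) q.1 q.2.1 q.2.2.1 q.2.2.2 ∧
        ‖q.2.1‖ ≤ Z := by
    intro p
    by_cases hp : ∃ (y : E) (z : E₂) (α β : ℝ),
      IsPrimalDual F h m η μ (x₀ + p.1) (x₀ + p.2) y z α β ∧ ‖z‖ ≤ Z
    · obtain ⟨y, z, α, β, hp'⟩ := hp
      exact ⟨(y, z, α, β), fun _ => hp'⟩
    · exact ⟨0, fun h => absurd h hp⟩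
  choose q hq using hex
  refine ⟨φ', χ', z₀, fun p => (q p).1, fun p => (q p).2.1, fun p => (q p).2.2.1,
    fun p => (q p).2.2.2, ⟨{ P with modelM := hφ', modelK := hχ' }, by rwa [hχχ'],
      by rwa [hφφ'], ?_, hχ'd, hZ.mono fun p hp => (hq p hp).1,
      ⟨Z, hZ.mono fun p hp => (hq p hp).2⟩⟩⟩
  rw [hφ'd]
  ext a
  simp [ContinuousLinearMap.adjoint_inner_left]

namespace SolutionFamily

variable {z₀ : E₂} {y : E × E → E} {z : E × E → E₂} {α β : E × E → ℝ}

lemma expansion (S : SolutionFamily F h m η μ x₀ M K G H φ χ z₀ y z α β) {ι : Type*}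
    {l : Filter ι} {ξ γ d : ι → E} {g : ι → ℝ}
    (hg : Tendsto g l (𝓝 0)) (hξ : ξ =O[l] g) (hd : d =O[l] g) :
    (fun i => φ (x₀ + d i) + χ (linModel F (x₀ + ξ i) (x₀ + d i))
        + 1 / (2 * η) * ‖d i - γ i‖ ^ 2
      - (χ (F x₀) + φ x₀ + (1 / 2 * lagrangianHessian F φ χ η x₀ (d i) (d i)
        - centreForm F z₀ η x₀ (ξ i, γ i) (d i)) + (1 / (2 * η) * ‖γ i‖ ^ 2
        - 1 / 2 * inner ℝ z₀ (fderiv ℝ (fderiv ℝ F) x₀ (ξ i) (ξ i)))))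
      =o[l] fun i => g i ^ 2 :=
  isLittleO_objective S.problem.contDiff S.problem.modelM.contDiffAt S.problem.modelK.contDiffAt
    S.fderiv_m S.fderiv_h hg hξ hd

omit [InnerProductSpace ℝ E] [FiniteDimensional ℝ E] in
lemma tendsto_norm_zero : Tendsto (fun p : E × E => ‖p‖) (𝓝 0) (𝓝 0) := by
  simpa using (continuous_norm.tendsto (0 : E × E))

omit [InnerProductSpace ℝ E] [FiniteDimensional ℝ E] in
lemma isBigO_fst : (fun p : E × E => p.1) =O[𝓝 0] fun p => ‖p‖ :=
  IsBigO.of_bound 1 (Eventually.of_forall fun p => by simpa using norm_fst_le p)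

omit [InnerProductSpace ℝ E] [FiniteDimensional ℝ E] in
lemma isBigO_snd : (fun p : E × E => p.2) =O[𝓝 0] fun p => ‖p‖ :=
  IsBigO.of_bound 1 (Eventually.of_forall fun p => by simpa using norm_snd_le p)

/-- The expansion has no first-order term, so displacements of size `O(‖p‖)` change the value by
`O(‖p‖²)`. -/
lemma isBigO_objective (S : SolutionFamily F h m η μ x₀ M K G H φ χ z₀ y z α β) {d : E × E → E}
    (hdO : d =O[𝓝 0] fun p => ‖p‖) :
    (fun p : E × E => φ (x₀ + d p) + χ (linModel F (x₀ + p.1) (x₀ + d p))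
      + 1 / (2 * η) * ‖d p - p.2‖ ^ 2 - (χ (F x₀) + φ x₀)) =O[𝓝 0] fun p => ‖p‖ ^ 2 := by
  have hsq : (fun p : E × E => ‖p‖ * ‖p‖) = fun p => ‖p‖ ^ 2 := by funext p; ring
  have h1 := (S.expansion (γ := fun p : E × E => p.2) tendsto_norm_zero isBigO_fst hdO).isBigO
  have h2 := (isBigO_bilin (lagrangianHessian F φ χ η x₀) hdO hdO).const_mul_left (1 / 2)
  have h3 := isBigO_bilin (centreForm F z₀ η x₀) (isBigO_fst.prod_left isBigO_snd) hdO
  have h4 := ((isBigO_snd (E := E)).norm_left.pow 2).const_mul_left (1 / (2 * η))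
  have h5 := (((innerSL ℝ z₀).isBigO_comp _ _).trans (isBigO_bilin (fderiv ℝ (fderiv ℝ F) x₀)
    (isBigO_fst (E := E)) isBigO_fst)).const_mul_left (1 / 2)
  rw [hsq] at h2 h3 h5
  refine (h1.add ((h2.sub h3).add (h4.sub h5))).congr_left fun p => ?_
  simp only [innerSL_apply_apply]
  ring

/-- Lipschitz stability of the solutions. -/
lemma isBigO_sub (S : SolutionFamily F h m η μ x₀ M K G H φ χ z₀ y z α β) :
    (fun p => y p - x₀) =O[𝓝 0] fun p => ‖p‖ := by
  have P := S.problem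
  have hη := P.eta_pos
  have hκ := P.kappa_pos
  -- A feasible competitor with zero first-order displacement. Its value from above and
  -- `lower_bound` from below give `D² ≤ a n² + b n D` for the distance `D` from `y p` to `x₀` and
  -- `n = ‖p‖`.
  obtain ⟨d, hd, hdv⟩ := P.exists_competitor (ContinuousLinearMap.fst ℝ E E) 0
    (by simp) (by simp)
  have hdO : d =O[𝓝 0] fun p => ‖p‖ := by simpa using hd.isBigO
  have hV := S.isBigO_objective hdO
  have hr : (fun p : E × E => inner ℝ z₀ (linModel F (x₀ + p.1) x₀ - F x₀)) =O[𝓝 0]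
      fun p => ‖p‖ ^ 2 := by
    have h1 := isBigO_linModel P.contDiff (x₀ := x₀) (d := fun _ : E × E => (0 : E))
      tendsto_norm_zero isBigO_fst (isBigO_zero _ _)
    simpa using ((innerSL ℝ z₀).isBigO_comp _ _).trans h1
  have hF' : (fun p : E × E => fderiv ℝ F (x₀ + p.1) - fderiv ℝ F x₀) =O[𝓝 0]
      fun p => ‖p‖ := by
    have h1 := (isLittleO_fderiv_sub P.contDiff (x₀ := x₀) tendsto_norm_zero
      (isBigO_fst (E := E))).isBigO
    have h2 := ((fderiv ℝ (fderiv ℝ F) x₀).isBigO_comp _ _).trans (isBigO_fst (E := E))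
    simpa using h1.add h2
  obtain ⟨C₁, hC₁, h1⟩ := hV.exists_pos
  obtain ⟨C₂, hC₂, h2⟩ := hr.exists_pos
  obtain ⟨C₃, hC₃, h3⟩ := hF'.exists_pos
  set a := 2 * (C₁ + C₂) / (η⁻¹ - μ) with ha
  set b := 2 * (‖z₀‖ * C₃ + η⁻¹) / (η⁻¹ - μ) with hb
  refine IsBigO.of_bound (a + b + 1) ?_
  filter_upwards [h1.bound, h2.bound, h3.bound, hdv, S.primalDual] with p h1 h2 h3 h4 h5
  have hg := h5.growth _ _ _ h4.2.le h4.1.le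
  have hlow := CompositeProblem.lower_bound S.base_h S.base_m h5.h_eq.le h5.m_eq.le
  rw [add_sub_add_left_eq_sub] at hg
  change _ ≤ χ (linModel F (x₀ + p.1) (x₀ + d p)) + φ (x₀ + d p) + _ at hg
  set n := ‖p‖ with hn
  have hn0 : 0 ≤ n := norm_nonneg _
  rw [norm_norm]
  simp only [Real.norm_eq_abs, abs_pow, abs_of_nonneg hn0] at h1 h2
  rw [norm_norm] at h3
  set D := ‖y p - x₀‖ with hD
  have hD0 : 0 ≤ D := norm_nonneg _
  have e1 : ‖y p - (x₀ + p.2)‖ ^ 2 ≥ D ^ 2 - 2 * (n * D) := by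
    rw [← sub_sub, norm_sub_sq_real]
    have h10 := real_inner_le_norm (y p - x₀) p.2
    have h11 := mul_le_mul_of_nonneg_left (norm_snd_le p) hD0
    nlinarith [sq_nonneg ‖p.2‖]
  have e2 := mul_le_mul_of_nonneg_left e1 (show 0 ≤ 1 / (2 * η) by positivity)
  have e3 : 1 / (2 * η) * (D ^ 2 - 2 * (n * D)) = η⁻¹ / 2 * D ^ 2 - η⁻¹ * (n * D) := by
    field_simp
  have e4 := abs_le.1 (abs_real_inner_le_norm z₀
    ((fderiv ℝ F (x₀ + p.1) - fderiv ℝ F x₀) (y p - x₀)))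
  have e5 : ‖(fderiv ℝ F (x₀ + p.1) - fderiv ℝ F x₀) (y p - x₀)‖ ≤ C₃ * n * D :=
    (ContinuousLinearMap.le_opNorm _ _).trans (by gcongr)
  have e6 := mul_le_mul_of_nonneg_left e5 (norm_nonneg z₀)
  have e7 := (abs_le.1 h1).2
  have e8 := (abs_le.1 h2).1
  have e9 : 0 ≤ (η⁻¹ - μ) / 2 * ‖x₀ + d p - y p‖ ^ 2 := by positivity
  have e10 : (η⁻¹ - μ) / 2 * D ^ 2 ≤ (C₁ + C₂) * n ^ 2 + (‖z₀‖ * C₃ + η⁻¹) * (n * D) := by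
    linarith
  have e11 : D ^ 2 ≤ a * n ^ 2 + b * (n * D) := by
    have : a * n ^ 2 + b * (n * D) =
      ((C₁ + C₂) * n ^ 2 + (‖z₀‖ * C₃ + η⁻¹) * (n * D)) * (2 / (η⁻¹ - μ)) := by
      rw [ha, hb]; ring
    rw [this, ← div_le_iff₀ (by positivity)]
    refine le_trans (le_of_eq ?_) e10
    field_simp
  exact le_of_sq_le_quadratic (by positivity) (by positivity) hn0 e11

lemma tendsto_solution (S : SolutionFamily F h m η μ x₀ M K G H φ χ z₀ y z α β) :
    Tendsto y (𝓝 0) (𝓝 x₀) := by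
  have := (S.isBigO_sub.trans_tendsto tendsto_norm_zero).add_const x₀
  simpa using this

lemma tendsto_model (S : SolutionFamily F h m η μ x₀ M K G H φ χ z₀ y z α β) :
    Tendsto (fun p => linModel F (x₀ + p.1) (y p)) (𝓝 0) (𝓝 (F x₀)) := by
  have h1 : Tendsto (fun p : E × E => x₀ + p.1) (𝓝 0) (𝓝 x₀) := by
    simpa using tendsto_const_nhds.add ((isBigO_fst (E := E)).trans_tendsto tendsto_norm_zero)
  have h2 := (S.problem.continuous_linModel.tendsto (x₀, x₀)).comp
    (h1.prodMk_nhds S.tendsto_solution)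
  have h3 : linModel F (x₀, x₀).1 (x₀, x₀).2 = F x₀ := by simp [linModel]
  rwa [h3] at h2

/-- The solutions eventually lie on the active manifolds. -/
lemma eventually_active (S : SolutionFamily F h m η μ x₀ M K G H φ χ z₀ y z α β) :
    ∀ᶠ p in 𝓝 0, (G (y p) = 0 ∧ H (linModel F (x₀ + p.1) (y p)) = 0) ∧ β p = φ (y p) ∧
      α p = χ (linModel F (x₀ + p.1) (y p)) := by
  have P := S.problem
  obtain ⟨c, hc, hsharp⟩ := P.sharp
  obtain ⟨Z, hZ⟩ := S.bounded
  have ht := S.tendsto_solution.prodMk_nhds S.tendsto_model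
  have h1 : Tendsto (fun p : E × E => x₀ + p.1) (𝓝 0) (𝓝 x₀) := by
    simpa using tendsto_const_nhds.add ((isBigO_fst (E := E)).trans_tendsto tendsto_norm_zero)
  have h1' : Tendsto (fun p : E × E => x₀ + p.2) (𝓝 0) (𝓝 x₀) := by
    simpa using tendsto_const_nhds.add ((isBigO_snd (E := E)).trans_tendsto tendsto_norm_zero)
  have h2 : Tendsto (fun p : E × E => ‖fderiv ℝ F (x₀ + p.1) - fderiv ℝ F x₀‖ * Z
      + η⁻¹ * ‖y p - (x₀ + p.2)‖) (𝓝 0) (𝓝 0) := by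
    have h3 := (((P.continuous_fderiv.tendsto x₀).comp h1).sub_const (fderiv ℝ F x₀)).norm
    have h4 := (S.tendsto_solution.sub h1').norm
    simpa using (h3.mul_const Z).add (h4.const_mul η⁻¹)
  filter_upwards [ht.eventually hsharp, hZ, S.primalDual, h2.eventually (gt_mem_nhds hc),
    S.tendsto_solution.eventually (P.modelM.mem_iff.and P.modelM.eq_on),
    S.tendsto_model.eventually (P.modelK.mem_iff.and P.modelK.eq_on)] with p h3 h4 h5 h6 h7 h8
  -- Off `M × K`, sharpness would apply to `z p` and to the subgradient of `m` given by optimality.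
  -- Their residual at `x₀` is only the change in `F'ᵀ z` plus the proximal term, which tends to
  -- zero because the multipliers are bounded.
  have hmem : y p ∈ M ∧ linModel F (x₀ + p.1) (y p) ∈ K := by
    by_contra hnot
    have hz : z p ∈ subdiff h (linModel F (x₀ + p.1) (y p)) := by
      refine mem_subdiff_of_forall_le (C := 0) h5.h_eq fun u =>
        EReal.coe_le_of_forall_real fun a ha => ?_
      simpa using h5.h_le u a ha
    have hw : -(ContinuousLinearMap.adjoint (fderiv ℝ F (x₀ + p.1)) (z p))
        - η⁻¹ • (y p - (x₀ + p.2)) ∈ subdiff m (y p) := by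
      refine mem_subdiff_of_forall_le (C := 1 / (2 * η)) h5.m_eq fun y' =>
        EReal.coe_le_of_forall_real fun b hb => ?_
      have := h5.m_le y' b hb
      rw [inner_sub_left, inner_neg_left, ContinuousLinearMap.adjoint_inner_left,
        inner_smul_left]
      simp only [conj_trivial]
      linarith
    have h9 := h3 hnot _ hz _ hw
    have h10 : ContinuousLinearMap.adjoint (fderiv ℝ F x₀) (z p) +
        (-(ContinuousLinearMap.adjoint (fderiv ℝ F (x₀ + p.1)) (z p))
        - η⁻¹ • (y p - (x₀ + p.2))) =
        -(ContinuousLinearMap.adjoint (fderiv ℝ F (x₀ + p.1) - fderiv ℝ F x₀) (z p)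
        + η⁻¹ • (y p - (x₀ + p.2))) := by
      rw [map_sub, sub_apply]; abel
    rw [h10, norm_neg] at h9
    have h11 : ‖ContinuousLinearMap.adjoint (fderiv ℝ F (x₀ + p.1) - fderiv ℝ F x₀) (z p)‖ ≤
        ‖fderiv ℝ F (x₀ + p.1) - fderiv ℝ F x₀‖ * Z := by
      refine (ContinuousLinearMap.le_opNorm _ _).trans ?_
      rw [LinearIsometryEquiv.norm_map]
      gcongr
    have h12 := norm_add_le
      (ContinuousLinearMap.adjoint (fderiv ℝ F (x₀ + p.1) - fderiv ℝ F x₀) (z p))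
      (η⁻¹ • (y p - (x₀ + p.2)))
    rw [norm_smul η⁻¹, Real.norm_of_nonneg (inv_pos.2 P.eta_pos).le] at h12
    linarith
  have hG := h7.1.1 hmem.1
  have hH := h8.1.1 hmem.2
  exact ⟨⟨hG, hH⟩, EReal.coe_injective (h5.m_eq.symm.trans (h7.2 hG)),
    EReal.coe_injective (h5.h_eq.symm.trans (h8.2 hH))⟩

end SolutionFamily

end SolutionMap

lemma tendsto_inv_smul_of_isLittleO {ι V : Type*} [NormedAddCommGroup V] [NormedSpace ℝ V]
    {l : Filter ι} {d : ι → V} {g : ι → ℝ} {a : V} (hd : (fun i => d i - g i • a) =o[l] g)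
    (hg : ∀ᶠ i in l, g i ≠ 0) : Tendsto (fun i => (g i)⁻¹ • d i) l (𝓝 a) := by
  have h1 : Tendsto (fun i => (g i)⁻¹ • (d i - g i • a)) l (𝓝 0) := by
    rw [tendsto_zero_iff_norm_tendsto_zero]
    refine (tendsto_zero_iff_norm_tendsto_zero.1 hd.norm_left.tendsto_div_nhds_zero).congr
      fun i => ?_
    rw [norm_smul, norm_inv, norm_div, norm_norm, div_eq_inv_mul]
  refine (by simpa using h1.add_const a : Tendsto _ l (𝓝 a)).congr' ?_
  filter_upwards [hg] with i hi
  rw [smul_sub, inv_smul_smul₀ hi, sub_add_cancel]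

/-! ### First-order expansion of the solution map -/

section Derivative

variable {E E₂ : Type*} [NormedAddCommGroup E] [InnerProductSpace ℝ E] [FiniteDimensional ℝ E]
  [NormedAddCommGroup E₂] [InnerProductSpace ℝ E₂] [FiniteDimensional ℝ E₂]
  {k j : ℕ} {F : E → E₂} {h : E₂ → EReal} {m : E → EReal} {η μ : ℝ}
  {x₀ : E} {M : Set E} {K : Set E₂} {G : E → EuclideanSpace ℝ (Fin k)}
  {H : E₂ → EuclideanSpace ℝ (Fin j)} {φ : E → ℝ} {χ : E₂ → ℝ}

/-- The tangent space of `M ∩ F⁻¹(K)`. -/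
noncomputable def constraintKernel (F : E → E₂) (G : E → EuclideanSpace ℝ (Fin k))
    (H : E₂ → EuclideanSpace ℝ (Fin j)) (x₀ : E) : Submodule ℝ E :=
  ((fderiv ℝ G x₀).prod (fderiv ℝ H (F x₀) ∘L fderiv ℝ F x₀)).ker

omit [FiniteDimensional ℝ E] [FiniteDimensional ℝ E₂] in
lemma mem_constraintKernel {a : E} : a ∈ constraintKernel F G H x₀ ↔
    fderiv ℝ G x₀ a = 0 ∧ fderiv ℝ H (F x₀) (fderiv ℝ F x₀ a) = 0 := by
  simp [constraintKernel]

namespace SolutionFamily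

variable {z₀ : E₂} {y : E × E → E} {z : E × E → E₂} {α β : E × E → ℝ}

/-- The Hessian of the Lagrangian is coercive on the tangent space. -/
lemma coercive (S : SolutionFamily F h m η μ x₀ M K G H φ χ z₀ y z α β) {a : E}
    (ha : a ∈ constraintKernel F G H x₀) :
    (η⁻¹ - μ) * ‖a‖ ^ 2 ≤ lagrangianHessian F φ χ η x₀ a a := by
  have P := S.problem
  obtain ⟨h1, h2⟩ := mem_constraintKernel.1 ha
  -- With both centres at `x₀`, a feasible displacement `d = t a + o(t)` lowers `h + m` by at most
  -- `μ / 2 ‖d‖²`, by `lower_bound`. Adding the proximal term and comparing with the expansion at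
  -- order `t²` gives the coercivity constant.
  obtain ⟨d, hd, hdv⟩ := P.exists_competitor (0 : ℝ →L[ℝ] E)
    (ContinuousLinearMap.toSpanSingleton ℝ a) (by simp [h1]) (by simp [h2])
  have hg : Tendsto (fun t : ℝ => t) (𝓝[>] 0) (𝓝 0) := nhdsWithin_le_nhds
  have hd1 : (fun t : ℝ => d t - t • a) =o[𝓝[>] 0] fun t : ℝ => t := by
    simpa using (hd.mono (nhdsWithin_le_nhds (s := Set.Ioi 0))).of_norm_right
  have hne : ∀ᶠ t : ℝ in 𝓝[>] 0, t ≠ 0 := by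
    filter_upwards [self_mem_nhdsWithin] with t (ht : 0 < t) using ht.ne'
  have hlim := tendsto_inv_smul_of_isLittleO hd1 hne
  have hdO : d =O[𝓝[>] 0] fun t : ℝ => t := by
    have h3 : (fun t : ℝ => t • a) =O[𝓝[>] 0] fun t : ℝ => t :=
      IsBigO.of_bound ‖a‖ (Eventually.of_forall fun t => by rw [norm_smul, mul_comm])
    simpa using hd1.isBigO.add h3
  have hex := S.expansion (ξ := fun _ => 0) (γ := fun _ => 0) hg (isBigO_zero _ _) hdO
  have hR : Tendsto (fun t : ℝ => 1 / 2 * lagrangianHessian F φ χ η x₀ (t⁻¹ • d t) (t⁻¹ • d t))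
      (𝓝[>] 0) (𝓝 (1 / 2 * lagrangianHessian F φ χ η x₀ a a)) := by
    have : Continuous fun v : E => 1 / 2 * lagrangianHessian F φ χ η x₀ v v := by fun_prop
    exact (this.tendsto a).comp hlim
  have hN : Tendsto (fun t : ℝ => (η⁻¹ - μ) / 2 * ‖t⁻¹ • d t‖ ^ 2)
      (𝓝[>] 0) (𝓝 ((η⁻¹ - μ) / 2 * ‖a‖ ^ 2)) := (hlim.norm.pow 2).const_mul _
  have hsum := hex.tendsto_div_nhds_zero.add hR
  rw [zero_add] at hsum
  have := le_of_tendsto_of_tendsto hN hsum ?_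
  · linarith
  filter_upwards [hne, hdv.filter_mono nhdsWithin_le_nhds] with t ht hv
  have hlow := CompositeProblem.lower_bound S.base_h S.base_m hv.2.le hv.1.le
  simp only [zero_apply, add_zero, sub_self, inner_zero_right, linModel,
    add_sub_cancel_left, map_zero] at hlow
  simp only [linModel, add_zero, map_smul, smul_apply, smul_eq_mul, norm_smul, sub_zero,
    map_zero, zero_apply, norm_zero, inner_zero_right, add_sub_cancel_left, Prod.mk_zero_zero]
  have e1 : η⁻¹ / 2 = 1 / (2 * η) := by rw [one_div, mul_inv]; ring
  have e2 : (η⁻¹ - μ) / 2 * (‖t⁻¹‖ * ‖d t‖) ^ 2 = (η⁻¹ - μ) / 2 * ‖d t‖ ^ 2 / t ^ 2 := by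
    rw [mul_pow, norm_inv, inv_pow, Real.norm_eq_abs, sq_abs]; ring
  rw [e2, show ∀ q r : ℝ, q / t ^ 2 + 1 / 2 * (t⁻¹ * (t⁻¹ * r)) = (q + 1 / 2 * r) / t ^ 2 by
    intro q r; field_simp]
  gcongr
  rw [show (η⁻¹ - μ) / 2 = 1 / (2 * η) - μ / 2 by rw [← e1]; ring]
  nlinarith

/-- First order expansion of the solution. -/
lemma isLittleO_solution (S : SolutionFamily F h m η μ x₀ M K G H φ χ z₀ y z α β)
    (D : E × E →L[ℝ] E) (hD : ∀ p, D p ∈ constraintKernel F G H x₀ ∧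
      ∀ b ∈ constraintKernel F G H x₀,
        lagrangianHessian F φ χ η x₀ (D p) b = centreForm F z₀ η x₀ p b) :
    (fun p => y p - x₀ - D p) =o[𝓝 0] fun p => ‖p‖ := by
  have P := S.problem
  have hsq : (fun p : E × E => ‖p‖ ^ 2) =o[𝓝 0] fun p => ‖p‖ := by
    have := (isBigO_refl (fun p : E × E => ‖p‖) (𝓝 0)).mul_isLittleO
      ((isLittleO_one_iff ℝ).2 tendsto_norm_zero)
    simpa [sq] using this
  obtain ⟨d, hd, hdv⟩ := P.exists_competitor (ContinuousLinearMap.fst ℝ E E) D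
    (fun q => (mem_constraintKernel.1 (hD q).1).1) (fun q => (mem_constraintKernel.1 (hD q).1).2)
  have hDO : (fun p => D p) =O[𝓝 0] fun p => ‖p‖ :=
    (D.isBigO_id (𝓝 0)).trans (isBigO_refl _ _).norm_right
  have hdO : d =O[𝓝 0] fun p => ‖p‖ := by simpa using hd.isBigO.add hDO
  have hex := S.expansion (γ := fun p : E × E => p.2) tendsto_norm_zero isBigO_fst S.isBigO_sub
  have hex' := S.expansion (γ := fun p : E × E => p.2) tendsto_norm_zero isBigO_fst hdO
  obtain ⟨ρ, hρ⟩ := ContinuousLinearMap.exists_rightInverse_of_surjective _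
    (LinearMap.range_eq_top.2 P.surjective_constraint)
  set A := (fderiv ℝ G x₀).prod (fderiv ℝ H (F x₀) ∘L fderiv ℝ F x₀) with hA
  have hρ' : ∀ s, A (ρ s) = s := fun s => DFunLike.congr_fun hρ s
  have hact := S.eventually_active
  -- Solutions satisfy both constraints exactly, so their linearizations are `o(‖p‖)`; subtracting
  -- `ρ (A (y - x₀))` moves the displacement into the tangent space at that cost.
  have hGo : (fun p => fderiv ℝ G x₀ (y p - x₀)) =o[𝓝 0] fun p => ‖p‖ := by
    have h1 := (P.modelM.hasStrictFDerivAt.hasFDerivAt.isLittleO.comp_tendsto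
      S.tendsto_solution).trans_isBigO S.isBigO_sub
    refine h1.neg_left.congr' ?_ EventuallyEq.rfl
    filter_upwards [hact] with p hp
    simp [hp.1.1, P.modelM.eq_zero]
  have hlin : (fun p => linModel F (x₀ + p.1) (y p) - F x₀ - fderiv ℝ F x₀ (y p - x₀))
      =o[𝓝 0] fun p => ‖p‖ := by
    have := (isBigO_linModel P.contDiff (x₀ := x₀) tendsto_norm_zero (isBigO_fst (E := E))
      S.isBigO_sub).trans_isLittleO hsq
    simpa using this
  have hHo : (fun p => fderiv ℝ H (F x₀) (fderiv ℝ F x₀ (y p - x₀))) =o[𝓝 0] fun p => ‖p‖ := by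
    have hu : (fun p => linModel F (x₀ + p.1) (y p) - F x₀) =O[𝓝 0] fun p => ‖p‖ := by
      simpa using hlin.isBigO.add (((fderiv ℝ F x₀).isBigO_comp _ _).trans S.isBigO_sub)
    have h1 := (P.modelK.hasStrictFDerivAt.hasFDerivAt.isLittleO.comp_tendsto
      S.tendsto_model).trans_isBigO hu
    have h2 := ((fderiv ℝ H (F x₀)).isBigO_comp _ _).trans_isLittleO hlin
    refine (h1.add h2).neg_left.congr' ?_ EventuallyEq.rfl
    filter_upwards [hact] with p hp
    simp [hp.1.2, P.modelK.eq_zero]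
  have hAo : (fun p => A (y p - x₀)) =o[𝓝 0] fun p => ‖p‖ := hGo.prod_left hHo
  refine isLittleO_minimizer_sub (constraintKernel F G H x₀) (lagrangianHessian F φ χ η x₀)
    (lagrangianHessian_symm P.modelM.contDiffAt P.modelK.contDiffAt) P.kappa_pos
    (fun a ha => S.coercive ha) (centreForm F z₀ η x₀) D (fun p => (hD p).1)
    (fun p => (hD p).2) (τ := fun p => y p - x₀ - ρ (A (y p - x₀))) S.isBigO_sub ?_ ?_ hd
    (hex'.sub hex) ?_
  · intro p
    change A _ = 0
    rw [map_sub, hρ', sub_self]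
  · simpa using (ρ.isBigO_comp _ _).trans_isLittleO hAo
  · filter_upwards [hact, S.primalDual, hdv] with p h1 h2 h3
    have hg := h2.growth _ _ _ h3.2.le h3.1.le
    change _ ≤ χ (linModel F (x₀ + p.1) (x₀ + d p)) + φ (x₀ + d p) + _ at hg
    have hκ := P.kappa_pos
    have h4 : 0 ≤ (η⁻¹ - μ) / 2 * ‖x₀ + d p - y p‖ ^ 2 := by positivity
    rw [h1.2.1, h1.2.2, add_sub_add_left_eq_sub, ← sub_sub] at hg
    rw [add_sub_cancel]
    linarith

end SolutionFamily

end Derivative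

/-! ### Quadratic decrease forces an eigenvalue above one -/

section Instability

variable {E E₂ : Type*} [NormedAddCommGroup E] [InnerProductSpace ℝ E] [FiniteDimensional ℝ E]
  [NormedAddCommGroup E₂] [InnerProductSpace ℝ E₂] [FiniteDimensional ℝ E₂]
  {k j : ℕ} {F : E → E₂} {h : E₂ → EReal} {m : E → EReal} {η μ : ℝ}
  {x₀ : E} {M : Set E} {K : Set E₂} {G : E → EuclideanSpace ℝ (Fin k)}
  {H : E₂ → EuclideanSpace ℝ (Fin j)} {φ : E → ℝ} {χ : E₂ → ℝ}

-- Quadratic growth makes the minimizer unique, so the point selected by `argmin` can only be `y`.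
omit [FiniteDimensional ℝ E] [FiniteDimensional ℝ E₂] in
lemma IsPrimalDual.proxLinMap_eq {x y : E} {z : E₂} {α β : ℝ}
    (hp : IsPrimalDual F h m η μ x x y z α β) (hκ : 0 < η⁻¹ - μ) (hh : ∀ u, h u ≠ ⊥)
    (hm : ∀ x, m x ≠ ⊥) : proxLinMap η h F m x = y := by
  have hsplit : ∀ (w : E) (a : ℝ), h (F x + fderiv ℝ F x (w - x)) + m w
      + ((1 / (2 * η) * ‖w - x‖ ^ 2 : ℝ) : EReal) ≤ a →
      α + β + 1 / (2 * η) * ‖y - x‖ ^ 2 + (η⁻¹ - μ) / 2 * ‖w - y‖ ^ 2 ≤ a := by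
    intro w a hw
    obtain ⟨b, c, h1, h2, h3⟩ := EReal.exists_coe_of_add_le
      (by simp [EReal.add_eq_bot_iff, hh, hm]) (EReal.coe_ne_bot _) hw
    obtain ⟨s, t, h4, h5, h6⟩ := EReal.exists_coe_of_add_le (hh _) (hm _) h1.le
    have := hp.growth w s t h4.le h5.le
    have := EReal.coe_injective h2
    linarith
  have hval : h (F x + fderiv ℝ F x (y - x)) + m y
      + ((1 / (2 * η) * ‖y - x‖ ^ 2 : ℝ) : EReal) =
      ((α + β + 1 / (2 * η) * ‖y - x‖ ^ 2 : ℝ) : EReal) := by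
    have h1 := hp.h_eq
    rw [linModel] at h1
    rw [h1, hp.m_eq, EReal.coe_add, EReal.coe_add]
  have hmin := Classical.epsilon_spec (p := fun y : E => ∀ w : E,
    h (F x + fderiv ℝ F x (y - x)) + m y + ((1 / (2 * η) * ‖y - x‖ ^ 2 : ℝ) : EReal) ≤
    h (F x + fderiv ℝ F x (w - x)) + m w + ((1 / (2 * η) * ‖w - x‖ ^ 2 : ℝ) : EReal))
    ⟨y, fun w => by
      rw [hval]
      refine EReal.coe_le_of_forall_real fun a ha => ?_
      have h1 := hsplit w a ha
      have h2 : 0 ≤ (η⁻¹ - μ) / 2 * ‖w - y‖ ^ 2 := by positivity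
      linarith⟩
  have h1 := hsplit _ _ ((hmin y).trans hval.le)
  change proxLinMap η h F m x = y
  change _ + (η⁻¹ - μ) / 2 * ‖proxLinMap η h F m x - y‖ ^ 2 ≤ _ at h1
  by_contra hne
  have h2 := norm_pos_iff.2 (sub_ne_zero.2 hne)
  have h3 : 0 < (η⁻¹ - μ) / 2 * ‖proxLinMap η h F m x - y‖ ^ 2 := by positivity
  linarith

namespace SolutionFamily

variable {z₀ : E₂} {y : E × E → E} {z : E × E → E₂} {α β : E × E → ℝ}

/-- The derivative of the solution map of the proximal linear method. -/
lemma hasFDerivAt_proxLinMap (S : SolutionFamily F h m η μ x₀ M K G H φ χ z₀ y z α β)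
    (D : E × E →L[ℝ] E) (hD : ∀ p, D p ∈ constraintKernel F G H x₀ ∧
      ∀ b ∈ constraintKernel F G H x₀,
        lagrangianHessian F φ χ η x₀ (D p) b = centreForm F z₀ η x₀ p b) :
    HasFDerivAt (proxLinMap η h F m)
      (D ∘L (ContinuousLinearMap.id ℝ E).prod (ContinuousLinearMap.id ℝ E)) x₀ := by
  have P := S.problem
  have ht : Tendsto (fun x : E => (x - x₀, x - x₀)) (𝓝 x₀) (𝓝 0) :=
    (tendsto_sub_self_nhds_zero x₀).prodMk_nhds (tendsto_sub_self_nhds_zero x₀)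
  have heq : ∀ᶠ x in 𝓝 x₀, proxLinMap η h F m x = y (x - x₀, x - x₀) := by
    filter_upwards [ht.eventually S.primalDual] with x hx
    simp only [add_sub_cancel] at hx
    exact hx.proxLinMap_eq P.kappa_pos P.ne_bot_h P.ne_bot_m
  have h0 : y 0 = x₀ := by
    obtain ⟨C, hC⟩ := S.isBigO_sub.bound
    simpa [sub_eq_zero] using hC.self_of_nhds
  have hx₀ : proxLinMap η h F m x₀ = x₀ := by
    rw [heq.self_of_nhds, sub_self]; exact h0
  refine HasFDerivAt.of_isLittleO ?_
  have h1 := (S.isLittleO_solution D hD).comp_tendsto ht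
  refine (h1.congr' ?_ EventuallyEq.rfl).trans_isBigO ?_
  · filter_upwards [heq] with x hx
    simp [hx, hx₀]
  · refine IsBigO.of_bound 1 (Eventually.of_forall fun x => ?_)
    simp [Prod.norm_def]

/-- The multipliers converge. -/
lemma tendsto_multiplier (S : SolutionFamily F h m η μ x₀ M K G H φ χ z₀ y z α β) :
    Tendsto z (𝓝 0) (𝓝 z₀) := by
  have P := S.problem
  obtain ⟨Z, hZ⟩ := S.bounded
  -- Multipliers are bounded, so it suffices to identify their cluster points; a cluster point
  -- inherits both subgradient relations.
  refine (isCompact_closedBall (0 : E₂) Z).tendsto_nhds_of_unique_mapClusterPt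
    (hZ.mono fun p hp => by simpa using hp) fun z' _ hz' => ?_
  obtain ⟨U, hU, hzU⟩ := mapClusterPt_iff_ultrafilter.1 hz'
  have hα : Tendsto α U (𝓝 (χ (F x₀))) := by
    refine ((P.modelK.contDiffAt.continuousAt.tendsto.comp S.tendsto_model).congr' ?_).mono_left hU
    filter_upwards [S.eventually_active] with p hp using hp.2.2.symm
  have hβ : Tendsto β U (𝓝 (φ x₀)) := by
    refine ((P.modelM.contDiffAt.continuousAt.tendsto.comp S.tendsto_solution).congr' ?_).mono_left
      hU
    filter_upwards [S.eventually_active] with p hp using hp.2.1.symm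
  have hy := S.tendsto_solution.mono_left hU
  have hu := S.tendsto_model.mono_left hU
  have hc1 : Tendsto (fun p : E × E => x₀ + p.1) U (𝓝 x₀) := by
    have : Tendsto (fun p : E × E => x₀ + p.1) (𝓝 0) (𝓝 (x₀ + (0 : E × E).1)) :=
      Continuous.tendsto (by fun_prop) 0
    simpa using this.mono_left hU
  have hc2 : Tendsto (fun p : E × E => x₀ + p.2) U (𝓝 x₀) := by
    have : Tendsto (fun p : E × E => x₀ + p.2) (𝓝 0) (𝓝 (x₀ + (0 : E × E).2)) :=
      Continuous.tendsto (by fun_prop) 0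
    simpa using this.mono_left hU
  have hzh : z' ∈ subdiff h (F x₀) := by
    refine mem_subdiff_of_forall_le (C := 0) P.modelK.apply_self fun u =>
      EReal.coe_le_of_forall_real fun a ha => ?_
    have h1 := hα.add (hzU.inner (tendsto_const_nhds (x := u) |>.sub hu))
    have h2 := le_of_tendsto h1 (b := a) (by
      filter_upwards [hU S.primalDual] with p hp using hp.h_le u a ha)
    simpa using h2
  have hzm : -(ContinuousLinearMap.adjoint (fderiv ℝ F x₀) z') ∈ subdiff m x₀ := by
    refine mem_subdiff_of_forall_le (C := 1 / (2 * η)) P.modelM.apply_self fun w =>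
      EReal.coe_le_of_forall_real fun b hb => ?_
    have hd := tendsto_const_nhds (x := w) |>.sub hy
    have hF : Tendsto (fun p : E × E => fderiv ℝ F (x₀ + p.1) (w - y p)) U
        (𝓝 (fderiv ℝ F x₀ (w - x₀))) :=
      (isBoundedBilinearMap_apply.continuous.tendsto (fderiv ℝ F x₀, w - x₀)).comp
        (((P.continuous_fderiv.tendsto x₀).comp hc1).prodMk_nhds hd)
    have h1 := ((hβ.sub (hzU.inner hF)).sub (((hy.sub hc2).inner hd).const_mul η⁻¹)).sub
      ((hd.norm.pow 2).const_mul (1 / (2 * η)))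
    have h2 := le_of_tendsto h1 (b := b) (by
      filter_upwards [hU S.primalDual] with p hp using hp.m_le w b hb)
    rw [inner_neg_left, ContinuousLinearMap.adjoint_inner_left]
    simpa [sub_eq_add_neg] using h2
  -- Subgradients of `h` are determined on the tangent space of `K`, and those of `m` on that of
  -- `M`. By transversality the two conditions fix the multiplier on the whole space.
  refine ext_inner_right ℝ fun v => ?_
  obtain ⟨a, b, ha, hb, rfl⟩ := P.transversal v
  have h1 := P.modelK.fderiv_eq_inner hzh hb
  have h2 := P.modelM.fderiv_eq_inner hzm ha
  rw [S.fderiv_h, innerSL_apply_apply] at h1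
  rw [S.fderiv_m, inner_neg_left, ContinuousLinearMap.adjoint_inner_left] at h2
  simp only [neg_apply, ContinuousLinearMap.comp_apply, innerSL_apply_apply, neg_inj] at h2
  rw [inner_add_right, inner_add_right, h1, h2]

/-- A direction of quadratic decrease, tested against a nearby proximal subproblem. -/
lemma decrease_le (S : SolutionFamily F h m η μ x₀ M K G H φ χ z₀ y z α β)
    (D : E × E →L[ℝ] E) (hD : ∀ p, D p ∈ constraintKernel F G H x₀ ∧
      ∀ b ∈ constraintKernel F G H x₀,
        lagrangianHessian F φ χ η x₀ (D p) b = centreForm F z₀ η x₀ p b) {u : E} {c : ℝ}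
    (hfreq : ∃ᶠ q : ℝ × E in 𝓝[>] (0 : ℝ) ×ˢ 𝓝 u, h (F (x₀ + q.1 • q.2)) + m (x₀ + q.1 • q.2)
      ≤ ((χ (F x₀) + φ x₀ - c * q.1 ^ 2 : ℝ) : EReal)) (v : E) :
    1 / 2 * lagrangianHessian F φ χ η x₀ (D (0, v)) (D (0, v))
      - 1 / (2 * η) * ‖D (0, v)‖ ^ 2
      + 1 / 2 * inner ℝ z₀ (fderiv ℝ (fderiv ℝ F) x₀ u u)
      - η⁻¹ * inner ℝ (D (0, v) - v) (u - D (0, v))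
      - 1 / (2 * η) * ‖u - D (0, v)‖ ^ 2 ≤ -c := by
  have P := S.problem
  set l : Filter (ℝ × E) := 𝓝[>] (0 : ℝ) ×ˢ 𝓝 u with hl
  set b := D (0, v) with hb
  have hg : Tendsto (fun q : ℝ × E => q.1) l (𝓝 0) := tendsto_fst.mono_right nhdsWithin_le_nhds
  have hu : Tendsto (fun q : ℝ × E => q.2) l (𝓝 u) := tendsto_snd
  have hne : ∀ᶠ q : ℝ × E in l, q.1 ≠ 0 := by
    have : ∀ᶠ t : ℝ in 𝓝[>] 0, t ≠ 0 := by
      filter_upwards [self_mem_nhdsWithin] with t (ht : 0 < t) using ht.ne'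
    exact tendsto_fst.eventually this
  -- The model centre stays at `x₀` and the proximal centre is `x₀ + t v`, so the solution is `x₀ +
  -- t b + o(t)`.
  have hp : Tendsto (fun q : ℝ × E => ((0 : E), q.1 • v)) l (𝓝 0) := by
    have h1 : Tendsto (fun q : ℝ × E => q.1 • v) l (𝓝 0) := by simpa using hg.smul_const v
    exact (tendsto_const_nhds (x := (0 : E))).prodMk_nhds h1
  have hδ : (fun q : ℝ × E => y (0, q.1 • v) - x₀ - q.1 • b) =o[l] fun q => q.1 := by
    have h1 := (S.isLittleO_solution D hD).comp_tendsto hp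
    refine (h1.congr_left fun q => ?_).trans_isBigO (IsBigO.of_bound ‖v‖
      (Eventually.of_forall fun q => ?_))
    · have : ((0 : E), q.1 • v) = q.1 • ((0 : E), v) := by simp
      simp only [Function.comp_apply]
      rw [this, map_smul, hb]
    · simp only [Function.comp_apply, Prod.norm_def, norm_zero, norm_smul]
      rw [max_eq_right (by positivity), norm_mul, norm_norm, norm_norm, mul_comm]
  have hδO : (fun q : ℝ × E => y (0, q.1 • v) - x₀) =O[l] fun q => q.1 := by
    have h3 : (fun q : ℝ × E => q.1 • b) =O[l] fun q => q.1 :=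
      IsBigO.of_bound ‖b‖ (Eventually.of_forall fun q => by rw [norm_smul, mul_comm])
    simpa using hδ.isBigO.add h3
  have hδl := tendsto_inv_smul_of_isLittleO hδ hne
  have hwO : (fun q : ℝ × E => q.1 • q.2) =O[l] fun q => q.1 := by
    simpa using (isBigO_refl (fun q : ℝ × E => q.1) l).smul (hu.isBigO_one ℝ)
  have hex := (S.expansion (ξ := fun _ => 0) (γ := fun _ => 0) hg (isBigO_zero _ _)
    hδO).tendsto_div_nhds_zero
  have hT := tendsto_zero_iff_norm_tendsto_zero.1
    ((P.contDiff.contDiffAt.taylor_two_comp (x₀ := x₀) hg hwO).norm_left.tendsto_div_nhds_zero)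
  have hT' : Tendsto (fun q : ℝ × E => (q.1 ^ 2)⁻¹ • (F (x₀ + q.1 • q.2) - F x₀
      - fderiv ℝ F x₀ (q.1 • q.2))) l (𝓝 ((1 / 2 : ℝ) • fderiv ℝ (fderiv ℝ F) x₀ u u)) := by
    have h1 : Tendsto (fun q : ℝ × E => (q.1 ^ 2)⁻¹ • (F (x₀ + q.1 • q.2) - F x₀
      - fderiv ℝ F x₀ (q.1 • q.2) - (1 / 2 : ℝ) • fderiv ℝ (fderiv ℝ F) x₀ (q.1 • q.2)
        (q.1 • q.2))) l (𝓝 0) := by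
      refine tendsto_zero_iff_norm_tendsto_zero.2 (hT.congr fun q => ?_)
      rw [norm_smul, norm_inv, norm_div, norm_norm, div_eq_inv_mul]
    have h2 : Tendsto (fun q : ℝ × E => (1 / 2 : ℝ) • fderiv ℝ (fderiv ℝ F) x₀ q.2 q.2) l
        (𝓝 ((1 / 2 : ℝ) • fderiv ℝ (fderiv ℝ F) x₀ u u)) := by
      have : Continuous fun w : E => (1 / 2 : ℝ) • fderiv ℝ (fderiv ℝ F) x₀ w w := by fun_prop
      exact (this.tendsto u).comp hu
    have h3 := h1.add h2
    rw [zero_add] at h3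
    refine h3.congr' ?_
    filter_upwards [hne] with q hq
    have : fderiv ℝ (fderiv ℝ F) x₀ q.2 q.2 =
        (q.1 ^ 2)⁻¹ • fderiv ℝ (fderiv ℝ F) x₀ (q.1 • q.2) (q.1 • q.2) := by
      simp only [map_smul, smul_apply, smul_smul]
      rw [show (q.1 ^ 2)⁻¹ * (q.1 * q.1) = 1 by field_simp, one_smul]
    rw [this]
    module
  have hR : Tendsto (fun q : ℝ × E => 1 / 2 * lagrangianHessian F φ χ η x₀
      (q.1⁻¹ • (y (0, q.1 • v) - x₀)) (q.1⁻¹ • (y (0, q.1 • v) - x₀))) l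
      (𝓝 (1 / 2 * lagrangianHessian F φ χ η x₀ b b)) := by
    have : Continuous fun v : E => 1 / 2 * lagrangianHessian F φ χ η x₀ v v := by fun_prop
    exact (this.tendsto b).comp hδl
  have hz := (S.tendsto_multiplier.comp hp).inner (𝕜 := ℝ) hT'
  have hlim := ((((hex.add hR).sub ((hδl.norm.pow 2).const_mul (1 / (2 * η)))).add hz).sub
    (((hδl.sub_const v).inner (hu.sub hδl)).const_mul η⁻¹)).sub
    (((hu.sub hδl).norm.pow 2).const_mul (1 / (2 * η)))
  rw [zero_add, inner_smul_right] at hlim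
  refine le_of_tendsto_of_frequently hlim ?_
  have hpd := hp.eventually (S.primalDual.and S.eventually_active)
  refine (hfreq.and_eventually (hne.and hpd)).mono ?_
  rintro ⟨t, w⟩ ⟨hle, ht, hpd, ⟨-, hβφ, hαχ⟩⟩
  simp only at hle ht hpd hβφ hαχ ⊢
  -- The multiplier inequalities are tested at `F (x₀ + t w)` and `x₀ + t w`. On adding them the
  -- `F'` terms cancel, leaving the second-order remainder `r` of `F`; no tangency of `w` is needed.
  obtain ⟨a', b', h1, h2, h3⟩ := EReal.exists_coe_of_add_le (P.ne_bot_h _) (P.ne_bot_m _) hle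
  have h4 := hpd.h_le _ _ h1.le
  have h5 := hpd.m_le _ _ h2.le
  rw [add_zero] at h4 h5 hαχ
  set δ := y (0, t • v) - x₀ with hδdef
  have hyδ : y (0, t • v) = x₀ + δ := by rw [hδdef]; abel
  clear_value δ
  set ζ := z (0, t • v) with hζ
  rw [hβφ] at h5
  rw [hαχ] at h4
  rw [hyδ] at h4 h5
  set V := φ (x₀ + δ) + χ (linModel F x₀ (x₀ + δ)) with hV
  set r := F (x₀ + t • w) - F x₀ - fderiv ℝ F x₀ (t • w) with hr
  have e1 : F (x₀ + t • w) - linModel F x₀ (x₀ + δ) = r + fderiv ℝ F x₀ (t • w - δ) := by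
    rw [hr, linModel, add_sub_cancel_left, map_sub _ (t • w) δ]; abel
  have e2 : x₀ + t • w - (x₀ + δ) = t • w - δ := by abel
  have e3 : x₀ + δ - (x₀ + t • v) = δ - t • v := by abel
  rw [e1, inner_add_right] at h4
  rw [e2, e3] at h5
  have key : V + inner ℝ ζ r - η⁻¹ * inner ℝ (δ - t • v) (t • w - δ)
      - 1 / (2 * η) * ‖t • w - δ‖ ^ 2 ≤ χ (F x₀) + φ x₀ - c * t ^ 2 := by linarith
  have s1 : t⁻¹ • δ - v = t⁻¹ • (δ - t • v) := by rw [smul_sub, inv_smul_smul₀ ht]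
  have s2 : w - t⁻¹ • δ = t⁻¹ • (t • w - δ) := by rw [smul_sub, inv_smul_smul₀ ht]
  have ht2 : 0 < t ^ 2 := by positivity
  simp only [Function.comp_apply, add_zero, sub_zero, s1, s2, inner_smul_left, inner_smul_right, map_smul,
    smul_apply, smul_eq_mul, norm_smul, Prod.mk_zero_zero, map_zero, zero_apply, norm_zero,
    inner_zero_right, conj_trivial, mul_pow, norm_inv, Real.norm_eq_abs, inv_pow, sq_abs]
  rw [← hV, ← hζ]
  have hfin : ∀ A B C I J N : ℝ, (V + 1 / (2 * η) * B - (A + (1 / 2 * C) +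
      (1 / (2 * η) * 0 ^ 2 - 1 / 2 * 0))) / t ^ 2 + 1 / 2 * (t⁻¹ * (t⁻¹ * C))
      - 1 / (2 * η) * ((t ^ 2)⁻¹ * B) + (t ^ 2)⁻¹ * I - η⁻¹ * (t⁻¹ * (t⁻¹ * J))
      - 1 / (2 * η) * ((t ^ 2)⁻¹ * N) =
      (V + I - η⁻¹ * J - 1 / (2 * η) * N - A) / t ^ 2 := by
    intro A B C I J N
    have hη := P.eta_pos.ne'
    field_simp
    ring
  rw [hfin, div_le_iff₀ ht2]
  linarith

/-- A direction of quadratic decrease forces an eigenvalue of the update map above one. -/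
lemma one_lt_lambdaMax (S : SolutionFamily F h m η μ x₀ M K G H φ χ z₀ y z α β) {u : E} {c : ℝ}
    (hc : 0 < c)
    (hfreq : ∃ᶠ q : ℝ × E in 𝓝[>] (0 : ℝ) ×ˢ 𝓝 u, h (F (x₀ + q.1 • q.2)) + m (x₀ + q.1 • q.2)
      ≤ ((χ (F x₀) + φ x₀ - c * q.1 ^ 2 : ℝ) : EReal)) :
    1 < lambdaMax (fderiv ℝ (proxLinMap η h F m) x₀) := by
  have P := S.problem
  have hη := P.eta_pos
  set T := constraintKernel F G H x₀ with hT
  set R := lagrangianHessian F φ χ η x₀ with hR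
  obtain ⟨D, hD⟩ := exists_variational_solution T R P.kappa_pos (fun a ha => S.coercive ha)
    (centreForm F z₀ η x₀)
  have huniq : ∀ a ∈ T, ∀ b ∈ T, (∀ w ∈ T, R a w = R b w) → a = b := by
    intro a ha b hb hab
    have h1 := S.coercive (T.sub_mem ha hb)
    rw [← hR, map_sub R a b, sub_apply, hab _ (T.sub_mem ha hb), sub_self] at h1
    by_contra hne
    have h2 := norm_pos_iff.2 (sub_ne_zero.2 hne)
    have h3 := P.kappa_pos
    have : 0 < (η⁻¹ - μ) * ‖a - b‖ ^ 2 := by positivity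
    linarith
  have hdec := S.decrease_le D hD hfreq
  have huT : u ∈ T := by
    rw [← T.orthogonal_orthogonal, Submodule.mem_orthogonal]
    intro v hv
    -- A proximal shift normal to `T` does not move the solution to first order, since its form `η⁻¹
    -- ⟪v, ·⟫` vanishes on `T`.
    have h1 : ∀ s : ℝ, D (0, s • v) = 0 := fun s => by
      refine huniq _ (hD _).1 _ T.zero_mem fun w hw => ?_
      rw [(hD _).2 w hw, centreForm_apply]
      simp [inner_smul_left, Submodule.inner_left_of_mem_orthogonal hw hv]
    by_contra hne
    set A := 1 / 2 * inner ℝ z₀ (fderiv ℝ (fderiv ℝ F) x₀ u u) - 1 / (2 * η) * ‖u‖ ^ 2 with hA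
    -- This multiple of `v` makes the left side of the decrease inequality exactly zero, against `-c
    -- < 0`.
    have h2 := hdec ((-A * η * (inner ℝ v u)⁻¹) • v)
    simp only [h1, map_zero, norm_zero, zero_sub, sub_zero, inner_neg_left, inner_smul_left,
      conj_trivial, inv_mul_cancel_right₀ hne] at h2
    have h3 : η⁻¹ * (-A * η) = -A := by field_simp
    simp only [mul_neg, h3] at h2
    linarith
  -- The proximal shift whose form is `R u`, hence whose first-order solution is `u` itself.
  have huD : D (0, η • (InnerProductSpace.toDual ℝ E).symm (R u)) = u := by
    refine huniq _ (hD _).1 _ huT fun w hw => ?_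
    rw [(hD _).2 w hw, centreForm_apply]
    simp [inner_smul_left, hη.ne']
  have hlt := hdec (η • (InnerProductSpace.toDual ℝ E).symm (R u))
  rw [huD, sub_self, inner_zero_right, norm_zero] at hlt
  -- With `D (0, v) = u` the decrease inequality reads `R u u < W u u`, for `W` the form of equal
  -- centres.
  obtain ⟨r, a, hr, haT, ha0, hra⟩ := exists_pencil_eigenvector T R
    (centreForm F z₀ η x₀ ∘L (ContinuousLinearMap.id ℝ E).prod (ContinuousLinearMap.id ℝ E))
    (lagrangianHessian_symm P.modelM.contDiffAt P.modelK.contDiffAt)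
    (fun a b => by
      simp [centreForm_apply, real_inner_comm a b,
        (P.contDiff.contDiffAt.isSymmSndFDerivAt (x := x₀) (by simp)).eq a b])
    P.kappa_pos (fun a ha => S.coercive ha) huT (by
      simp only [ContinuousLinearMap.comp_apply, ContinuousLinearMap.prod_apply,
        ContinuousLinearMap.id_apply, centreForm_apply, real_inner_self_eq_norm_sq]
      have : 1 / (2 * η) * ‖u‖ ^ 2 = 1 / 2 * (η⁻¹ * ‖u‖ ^ 2) := by
        rw [one_div, mul_inv]; ring
      simp only [this] at hlt
      rw [← hR] at hlt
      linarith)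
  have hDa : D (a, a) = r • a := by
    refine huniq _ (hD _).1 _ (T.smul_mem _ haT) fun w hw => ?_
    rw [(hD _).2 w hw, map_smul, smul_apply, smul_eq_mul, ← hra w hw]
    simp
  rw [(S.hasFDerivAt_proxLinMap D hD).fderiv]
  -- Finiteness of the spectrum is needed here: `sSup` of an unbounded set would be a default value.
  refine hr.trans_le (le_csSup (Module.End.finite_hasEigenvalue _).bddAbove ?_)
  refine Module.End.hasEigenvalue_of_hasEigenvector (x := a)
    ⟨Module.End.mem_eigenspace_iff.2 ?_, ha0⟩
  simpa using hDa

end SolutionFamily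

end Instability

/-! ### Conclusion for the proximal linear method -/

section ProximalLinear

variable {E E₂ : Type*} [NormedAddCommGroup E] [InnerProductSpace ℝ E] [FiniteDimensional ℝ E]
  [NormedAddCommGroup E₂] [InnerProductSpace ℝ E₂] [FiniteDimensional ℝ E₂]

/-- The proximal fixed-point inequality is a global lower bound with zero slope and quadratic error.
-/
lemma isCriticalPoint_of_gradient_moreauEnvelope_eq_zero {f : E → EReal} {ℓ lam : ℝ}
    (hf : ConvexUpTo ℓ f) (hlsc : LowerSemicontinuous f) (hbot : ∀ x, f x ≠ ⊥)
    (hlam : 0 < lam) (hℓ : ℓ < lam⁻¹) {x₀ : E} (hx₀ : f x₀ ≠ ⊤)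
    (hgrad : gradient (moreauEnvelope lam f) x₀ = 0) : IsCriticalPoint f x₀ := by
  refine mem_subdiff_of_forall_le (C := 1 / (2 * lam)) (EReal.coe_toReal hx₀ (hbot x₀)).symm
    fun y => EReal.coe_le_of_forall_real fun a ha => ?_
  have h1 := le_add_sq_of_gradient_moreauEnvelope_eq_zero hf hlsc hbot hlam hℓ hx₀ hgrad y
  have h2 : f x₀ ≤ ((a + 1 / (2 * lam) * ‖y - x₀‖ ^ 2 : ℝ) : EReal) := by
    rw [EReal.coe_add]; exact h1.trans (by gcongr)
  rw [← EReal.coe_toReal hx₀ (hbot x₀), EReal.coe_le_coe_iff] at h2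
  rw [inner_zero_left]
  linarith

/-- Local minimality from the spectrum of the proximal linear map. -/
theorem isLocalMin_of_lambdaMax_proxLinMap_le_one {x₀ : E} {ℓ lam η μ : ℝ}
    (hlam : 0 < lam) (hℓ : ℓ < lam⁻¹) (hη : 0 < η) {F : E → E₂} {h : E₂ → EReal}
    {m f : E → EReal} (hf : ∀ x, f x = h (F x) + m x) (hF : ContDiff ℝ 2 F)
    (hh : ∀ u, h u ≠ ⊥) (hhl : LowerSemicontinuous h) (hhc : ExtConvex h)
    (hm : ∀ x, m x ≠ ⊥) (hml : LowerSemicontinuous m) (hμ : 0 ≤ μ) (hmc : WeaklyConvex μ m)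
    (hημ : η * μ < 1) (hfc : WeaklyConvex ℓ f) (hsaddle : StrictSaddleProperty f)
    (hact : AdmitsCompositeActiveManifold 2 h F m x₀)
    (hgrad : gradient (moreauEnvelope lam f) x₀ = 0)
    (hmax : lambdaMax (fderiv ℝ (proxLinMap η h F m) x₀) ≤ 1) : IsLocalMin f x₀ := by
  obtain ⟨M, K, hxM, hxK, U, V, hU, hxU, hV, hxV, ⟨hM, hmM⟩, ⟨hK, hhK⟩, htrans, c, hc,
    hsharp⟩ := hact
  obtain ⟨k, G, φ, hG⟩ := exists_isLocalModel hxM hU hxU hM hmM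
  obtain ⟨j, H, χ, hH⟩ := exists_isLocalModel hxK hV hxV hK hhK
  have hbot : ∀ x, f x ≠ ⊥ := fun x => by simp [hf, EReal.add_eq_bot_iff, hh, hm]
  have hval : f x₀ = ((χ (F x₀) + φ x₀ : ℝ) : EReal) := by
    rw [hf, hG.apply_self, hH.apply_self, EReal.coe_add]
  have hlsc : LowerSemicontinuous f := by
    rw [funext hf]
    exact (hhl.comp hF.continuous).add' hml fun x =>
      EReal.continuousAt_add (Or.inr (hm x)) (Or.inl (hh _))
  have hcrit := isCriticalPoint_of_gradient_moreauEnvelope_eq_zero hfc.convexUpTo hlsc hbot hlam hℓ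
    (hval ▸ EReal.coe_ne_top _) hgrad
  refine (hsaddle x₀ hcrit).resolve_right fun hstrict => ?_
  -- Only the sequence of decrease survives; the manifold of the saddle plays no further role.
  obtain ⟨u, a, e, ha, he, hfreq⟩ := hstrict.exists_frequently_le
  obtain rfl : a = χ (F x₀) + φ x₀ := EReal.coe_injective (ha.symm.trans hval)
  have P : CompositeProblem F h m η μ x₀ M K G H φ χ :=
    { contDiff := hF
      convex_h := hhc.convexUpTo
      lsc_h := hhl
      ne_bot_h := hh
      convex_m := hmc.convexUpTo
      lsc_m := hml
      ne_bot_m := hm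
      mu_nonneg := hμ
      eta_pos := hη
      mu_lt := by rw [← one_div, lt_div_iff₀ hη]; linarith
      modelM := hG
      modelK := hH
      transversal := fun v => by
        obtain ⟨a, ha, b, hb, hab⟩ := htrans v
        exact ⟨a, b, hG.fderiv_eq_zero_of_mem_tangentConeAt ha,
          hH.fderiv_eq_zero_of_mem_tangentConeAt hb, hab⟩
      sharp := ⟨c, hc, by
        filter_upwards [prod_mem_nhds (hU.mem_nhds hxU) (hV.mem_nhds hxV)] with q hq
        exact hsharp q.1 hq.1 q.2 hq.2⟩
      critical := by rwa [← funext hf] }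
  obtain ⟨φ', χ', z₀, y, z, α, β, S⟩ := P.exists_solutionFamily
  have hval' : χ' (F x₀) + φ' x₀ = χ (F x₀) + φ x₀ := by
    refine EReal.coe_injective (Eq.trans ?_ hval)
    rw [hf, S.problem.modelM.apply_self, S.problem.modelK.apply_self, EReal.coe_add]
  refine (S.one_lt_lambdaMax he (u := u) ?_).not_ge hmax
  simpa only [hf, hval'] using hfreq

end ProximalLinear

/-! ### Reduction of the proximal gradient method -/

section ProximalGradient

variable {E : Type*} [NormedAddCommGroup E] [InnerProductSpace ℝ E] [FiniteDimensional ℝ E]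

omit [FiniteDimensional ℝ E] in
lemma isSmoothManifold_univ (p : WithTop ℕ∞) : IsSmoothManifold p (Set.univ : Set E) :=
  fun x _ => ⟨0, Set.univ, fun _ => 0, isOpen_univ, trivial, contDiffOn_const,
    fun v => ⟨0, Subsingleton.elim _ _⟩, by simp⟩

lemma mem_subdiff_coe_iff {v u : ℝ} :
    v ∈ subdiff (fun t : ℝ => (t : EReal)) u ↔ v = 1 := by
  have hmod : IsLocalModel (fun t : ℝ => (t : EReal)) Set.univ u
      (fun _ => (0 : EuclideanSpace ℝ (Fin 0))) (fun t => t) :=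
    ⟨contDiffAt_const, fun v => ⟨0, Subsingleton.elim _ _⟩, rfl, contDiffAt_id, by simp, by simp⟩
  constructor
  · intro hv
    have := hmod.fderiv_eq_inner hv (a := 1) (Subsingleton.elim _ _)
    simpa using this.symm
  · rintro rfl
    exact mem_subdiff_of_forall_le (a := u) (C := 0) rfl fun y => by simp

lemma gradient_add_mem_subdiff {g : E → ℝ} {m : E → EReal} {y w : E}
    (hg : DifferentiableAt ℝ g y) (hw : w ∈ subdiff m y) :
    gradient g y + w ∈ subdiff (fun x => (g x : EReal) + m x) y := by
  obtain ⟨h1, h2, h3⟩ := hw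
  lift m y to ℝ using ⟨h2, h1⟩ with b hb
  refine ⟨by simp [← hb], by simp [← hb, ← EReal.coe_add], fun ε hε => ?_⟩
  have h4 := (hasGradientAt_iff_isLittleO.1 hg.hasGradientAt).def (half_pos hε)
  filter_upwards [h3 _ (half_pos hε), h4] with x hx hx'
  rw [← hb, ← EReal.coe_add, ← EReal.coe_add]
  have h5 := (abs_le.1 hx').1
  have h6 : g y + b + (inner ℝ (gradient g y + w) (x - y) - ε * ‖x - y‖) ≤
      g x + (b + (inner ℝ w (x - y) - ε / 2 * ‖x - y‖)) := by
    rw [inner_add_left]; linarith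
  refine (EReal.coe_le_coe_iff.2 h6).trans ?_
  rw [EReal.coe_add (g x)]
  gcongr
  rwa [EReal.coe_add]

/-- Completing the square, the objectives differ by the constant `g x - η / 2 ‖∇g x‖²`. The
predicates passed to `Classical.epsilon` are therefore equal, and so are the chosen points. -/
lemma proxLinMap_coe_eq_proxGradMap {η : ℝ} (hη : 0 < η) (g : E → ℝ) (m : E → EReal) :
    proxLinMap η (fun t : ℝ => (t : EReal)) g m = proxGradMap η g m := by
  funext x
  have hobj : ∀ y, ((g x + fderiv ℝ g x (y - x) : ℝ) : EReal) + m y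
      + ((1 / (2 * η) * ‖y - x‖ ^ 2 : ℝ) : EReal) =
      ((g x - η / 2 * ‖gradient g x‖ ^ 2 : ℝ) : EReal) + (m y
      + ((1 / (2 * η) * ‖y - (x - η • gradient g x)‖ ^ 2 : ℝ) : EReal)) := by
    intro y
    rw [add_right_comm, ← EReal.coe_add, add_left_comm, ← EReal.coe_add, add_comm (m y)]
    congr 2
    rw [← sub_add, norm_add_sq_real, inner_smul_right, real_inner_comm, inner_gradient_left,
      norm_smul, Real.norm_of_nonneg hη.le]
    field_simp
    ring
  unfold proxLinMap proxGradMap prox argmin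
  congr 1
  funext y
  simp only [hobj, (EReal.addLECancellable_coe _).add_le_add_iff_left]

/-- Local minimality from the spectrum of the proximal gradient map. -/
theorem isLocalMin_of_lambdaMax_proxGradMap_le_one {x₀ : E} {ℓ lam η μ : ℝ}
    (hlam : 0 < lam) (hℓ : ℓ < lam⁻¹) (hη : 0 < η) {g : E → ℝ} {m f : E → EReal}
    (hf : ∀ x, f x = (g x : EReal) + m x) (hg : ContDiff ℝ 2 g)
    (hm : ∀ x, m x ≠ ⊥) (hml : LowerSemicontinuous m) (hμ : 0 ≤ μ) (hmc : WeaklyConvex μ m)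
    (hημ : η * μ < 1) (hfc : WeaklyConvex ℓ f) (hsaddle : StrictSaddleProperty f)
    (hact : ∃ M, IsActiveManifold 2 f M x₀)
    (hgrad : gradient (moreauEnvelope lam f) x₀ = 0)
    (hmax : lambdaMax (fderiv ℝ (proxGradMap η g m) x₀) ≤ 1) : IsLocalMin f x₀ := by
  rw [← proxLinMap_coe_eq_proxGradMap hη] at hmax
  refine isLocalMin_of_lambdaMax_proxLinMap_le_one hlam hℓ hη hf hg
    (fun u => EReal.coe_ne_bot u) continuous_coe_real_ereal.lowerSemicontinuous
    (fun x y a b _ _ _ => by simp) hm hml hμ hmc hημ hfc hsaddle ?_ hgrad hmax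
  obtain ⟨M, hxM, U, hU, hxU, hM, hfM, c, hc, hsharp⟩ := hact
  have hcont : Continuous (gradient g) :=
    (InnerProductSpace.toDual ℝ E).symm.continuous.comp (hg.continuous_fderiv (by simp))
  -- Composite sharpness uses `∇g` frozen at `x₀`, while subgradients of `f` at `y` involve `∇g y`;
  -- on this neighbourhood the exchange costs less than `c / 2`.
  have hU' : IsOpen {y | ‖gradient g y - gradient g x₀‖ < c / 2} :=
    isOpen_lt (hcont.sub continuous_const).norm continuous_const
  have hsub : M ∩ (U ∩ {y | ‖gradient g y - gradient g x₀‖ < c / 2}) ⊆ M ∩ U :=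
    fun y hy => ⟨hy.1, hy.2.1⟩
  refine ⟨M, Set.univ, hxM, trivial, U ∩ {y | ‖gradient g y - gradient g x₀‖ < c / 2}, Set.univ,
    hU.inter hU', ⟨hxU, by simpa using hc⟩, isOpen_univ, trivial, ⟨?_, ?_⟩, ⟨?_, ?_⟩, ?_, c / 2,
    half_pos hc, ?_⟩
  · rintro x ⟨hxM, hxU, hx⟩
    obtain ⟨k, W, G, hW, hxW, hG, hs, hMW⟩ := hM x ⟨hxM, hxU⟩
    refine ⟨k, W ∩ {y | ‖gradient g y - gradient g x₀‖ < c / 2}, G, hW.inter hU', ⟨hxW, hx⟩,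
      hG.mono Set.inter_subset_left, hs, ?_⟩
    ext y
    have := Set.ext_iff.1 hMW y
    simp only [Set.mem_inter_iff, Set.mem_ofPred_eq] at this ⊢
    tauto
  · intro x hx
    obtain ⟨W, φ, hW, hxW, hφ, hfφ⟩ := hfM x (hsub hx)
    refine ⟨W, fun y => φ y - g y, hW, hxW, hφ.sub hg.contDiffOn, fun y hy => ?_⟩
    have h1 := hfφ y ⟨hsub hy.1, hy.2⟩
    rw [hf] at h1
    rw [EReal.coe_sub, ← h1, EReal.add_sub_cancel_left]
  · rw [Set.inter_univ]
    exact isSmoothManifold_univ 2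
  · exact fun u _ => ⟨Set.univ, id, isOpen_univ, trivial, contDiffOn_id, fun _ _ => rfl⟩
  · exact fun v => ⟨0, zero_mem_tangentConeAt (subset_closure hxM), v,
      by simp [tangentConeAt_univ], by simp⟩
  · intro y hy u _ hyu z hz w hw
    obtain rfl := mem_subdiff_coe_iff.1 hz
    have h1 : ContinuousLinearMap.adjoint (fderiv ℝ g x₀) (1 : ℝ) = gradient g x₀ := by
      refine ext_inner_right ℝ fun a => ?_
      rw [ContinuousLinearMap.adjoint_inner_left, inner_gradient_left]
      simp
    have h2 := gradient_add_mem_subdiff (hg.differentiable (by simp) y) hw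
    rw [← funext hf] at h2
    have h3 := hsharp y hy.1 (fun h => hyu ⟨h, trivial⟩) _ h2
    have h4 : ‖gradient g y - gradient g x₀‖ < c / 2 := hy.2
    have h5 := norm_add_le (gradient g x₀ + w) (gradient g y - gradient g x₀)
    rw [show gradient g x₀ + w + (gradient g y - gradient g x₀) = gradient g y + w by abel] at h5
    rw [h1]
    linarith

end ProximalGradient

/-! ### The three methods -/

theorem corollary3p6 {d n : ℕ} (x₀ : EuclideanSpace ℝ (Fin d)) (ℓ lam η : ℝ)
    (hℓ : 0 < ℓ) (hlam : lam ∈ Set.Ioo (0 : ℝ) ℓ⁻¹) (hη : 0 < η) :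
    -- proximal point: minimize `f`
    (∀ f : EuclideanSpace ℝ (Fin d) → EReal,
      (∀ x, f x ≠ ⊥) → LowerSemicontinuous f → WeaklyConvex ℓ f → η * ℓ < 1 →
      StrictSaddleProperty f →
      (∃ M, IsActiveManifold 2 f M x₀) →
      ‖gradient (moreauEnvelope lam f) x₀‖ = 0 →
      lambdaMax (fderiv ℝ (prox η f) x₀) ≤ 1 →
      IsLocalMin f x₀) ∧
    -- proximal gradient: minimize `g + m`
    (∀ (g : EuclideanSpace ℝ (Fin d) → ℝ) (m f : EuclideanSpace ℝ (Fin d) → EReal)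
      (β : NNReal) (μ : ℝ),
      (∀ x, f x = (g x : EReal) + m x) →
      ContDiff ℝ 2 g → LipschitzWith β (gradient g) →
      (∀ x, m x ≠ ⊥) → LowerSemicontinuous m → 0 ≤ μ → WeaklyConvex μ m → η * μ < 1 →
      WeaklyConvex ℓ f →
      StrictSaddleProperty f →
      (∃ M, IsActiveManifold 2 f M x₀) →
      ‖gradient (moreauEnvelope lam f) x₀‖ = 0 →
      lambdaMax (fderiv ℝ (proxGradMap η g m) x₀) ≤ 1 →
      IsLocalMin f x₀) ∧
    -- proximal linear: minimize `h ∘ F + m`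
    (∀ (F : EuclideanSpace ℝ (Fin d) → EuclideanSpace ℝ (Fin n))
      (h : EuclideanSpace ℝ (Fin n) → EReal) (m f : EuclideanSpace ℝ (Fin d) → EReal) (μ : ℝ),
      (∀ x, f x = h (F x) + m x) →
      ContDiff ℝ 2 F →
      (∀ u, h u ≠ ⊥) → LowerSemicontinuous h → ExtConvex h →
      (∀ x, m x ≠ ⊥) → LowerSemicontinuous m → 0 ≤ μ → WeaklyConvex μ m → η * μ < 1 →
      WeaklyConvex ℓ f →
      StrictSaddleProperty f →
      AdmitsCompositeActiveManifold 2 h F m x₀ →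
      ‖gradient (moreauEnvelope lam f) x₀‖ = 0 →
      lambdaMax (fderiv ℝ (proxLinMap η h F m) x₀) ≤ 1 →
      IsLocalMin f x₀) := by
  have hlam' : ℓ < lam⁻¹ := (lt_inv_comm₀ hlam.1 hℓ).1 hlam.2
  refine ⟨fun f hbot hlsc hfc hηℓ hsaddle hact hgrad hmax => ?_,
    fun g m f β μ hf hg _ hm hml hμ hmc hημ hfc hsaddle hact hgrad hmax =>
      isLocalMin_of_lambdaMax_proxGradMap_le_one hlam.1 hlam' hη hf hg hm hml hμ hmc hημ hfc
        hsaddle hact (norm_eq_zero.1 hgrad) hmax,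
    fun F h m f μ hf hF hh hhl hhc hm hml hμ hmc hημ hfc hsaddle hact hgrad hmax =>
      isLocalMin_of_lambdaMax_proxLinMap_le_one hlam.1 hlam' hη hf hF hh hhl hhc hm hml hμ hmc
        hημ hfc hsaddle hact (norm_eq_zero.1 hgrad) hmax⟩
  -- The proximal point method is the case `g = 0`, `m = f`, `μ = ℓ`.
  have hprox : proxGradMap η (fun _ => (0 : ℝ)) f = prox η f := by
    funext x
    rw [proxGradMap, gradient_fun_const, smul_zero, sub_zero]
  exact isLocalMin_of_lambdaMax_proxGradMap_le_one hlam.1 hlam' hη (g := fun _ => 0) (m := f)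
    (fun x => by simp) contDiff_const hbot hlsc hℓ.le hfc hηℓ hfc hsaddle hact
    (norm_eq_zero.1 hgrad) (by rwa [hprox])
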